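/- **Theorem.** Polynomials are given as explicit sums of monomials, with integer coefficients and with exponents written in binary, and rational numbers as fractions of integers in binary. The *existential theory of the reals* ETR is the problem of deciding whether a given sentence $\exists x_1\cdots\exists x_n\,\Phi(x_1,\dots,x_n)$ is true over $\mathbb R$, where $\Phi$ is a quantifier-free Boolean combination of polynomial equations and inequalities with integer coefficients. The class $\exists\mathbb R$ consists of all decision problems that are polynomial-time many-one reducible to ETR; a problem is *$\exists\mathbb R$-hard* if every problem in $\exists\mathbb R$ is polynomial-time many-one reducible to it, and *$\exists\mathbb R$-complete* if it is $\exists\mathbb R$-hard and belongs to $\exists\mathbb R$. The problem *Valley-Separated Clusters* (VSC) is the following. Instance: a polynomial $f\in\mathbb Z[x_1,\dots,x_d]$ and a rational threshold $\theta>0$. Question: do there exist two points $p,q\in\mathbb R^d$ such that $$f(p)\ge\theta,\qquad f(q)\ge\theta,\qquad f\!\left(\frac{p+q}{2}\right)<\theta\ ?$$ Then VSC belongs to $\exists\mathbb R$ and is $\exists\mathbb R$-hard; that is, VSC is $\exists\mathbb R$-complete. -/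

import Mathlib

namespace ExistsReals

/-! ### Decision problems and polynomial-time many-one reductions -/

/-- A decision problem: a type of instances, written down as strings over a finite alphabet
by an injective encoding, together with the set of yes-instances. A language `L` over a finite
alphabet `Γ` is the case `Instance = List Γ`, `encode = id`. -/
structure DecisionProblem where
  Instance : Type
  Alphabet : Type
  alphabet_finite : Finite Alphabet
  encode : Instance → List Alphabet
  encode_injective : Function.Injective encode
  Yes : Set Instance

/-- Polynomial-time many-one reducibility `A ≤ₚ B`: some map from instances of `A` to instances
of `B`, computed on the encodings by a Turing machine in time polynomial in the length of the
input string, preserves and reflects yes-instances. -/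
def PolyTimeReducible (A B : DecisionProblem) : Prop :=
  ∃ f : A.Instance → B.Instance,
    Nonempty (Turing.TM2ComputableInPolyTime A.encode B.encode f) ∧
      ∀ a, a ∈ A.Yes ↔ f a ∈ B.Yes

/-! ### Polynomials as explicit sums of monomials -/

/-- A polynomial in `n` variables with integer coefficients, written as an explicit finite sum of
terms, each a coefficient together with its exponent vector. -/
abbrev SumOfMonomials (n : ℕ) : Type := List (ℤ × (Fin n → ℕ))

/-- The element of `ℤ[x₁, …, xₙ]` that an explicit sum of monomials denotes. -/
noncomputable def SumOfMonomials.toPoly {n : ℕ} (P : SumOfMonomials n) :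
    MvPolynomial (Fin n) ℤ :=
  (P.map fun t => MvPolynomial.monomial (Finsupp.equivFunOnFinite.symm t.2) t.1).sum

/-- The value of the polynomial at a real point. -/
noncomputable def SumOfMonomials.eval {n : ℕ} (P : SumOfMonomials n) (x : Fin n → ℝ) : ℝ :=
  MvPolynomial.aeval x P.toPoly

/-! ### Strings -/

/-- The alphabet in which polynomials, rationals and formulas are written. -/
inductive Symbol
  | bit (b : Bool)
  | semi
  | var
  | plus
  | minus
  | eq
  | gt
  | ge
  | not
  | and
  | or
  deriving DecidableEq, Fintype

/-- A natural number in binary (least significant bit first), terminated by `semi`. -/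
def encNat (k : ℕ) : List Symbol := k.bits.map Symbol.bit ++ [Symbol.semi]

/-- An integer: its sign, then its absolute value in binary. -/
def encInt (z : ℤ) : List Symbol :=
  (if z < 0 then Symbol.minus else Symbol.plus) :: encNat z.natAbs

/-- A term: the coefficient in binary, followed by the `n` exponents in binary. -/
def encTerm {n : ℕ} (t : ℤ × (Fin n → ℕ)) : List Symbol :=
  encInt t.1 ++ (List.ofFn t.2).flatMap encNat

/-- A polynomial: its terms one after the other (each starts with a sign), terminated by
`semi`. -/
def encPoly {n : ℕ} (P : SumOfMonomials n) : List Symbol :=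
  P.flatMap encTerm ++ [Symbol.semi]

/-- The declaration of `n` variables: one symbol per variable, terminated by `semi`. -/
def encVars (n : ℕ) : List Symbol := List.replicate n Symbol.var ++ [Symbol.semi]

/-- A positive rational: numerator and denominator (of the reduced fraction) in binary. -/
def encPosRat (θ : ℚ) : List Symbol := encNat θ.num.natAbs ++ encNat θ.den

/-! ### The existential theory of the reals -/

/-- The comparisons of a polynomial with zero: `P = 0`, `P > 0`, `P ≥ 0`. The other ones are
obtained by a change of sign or a negation. -/
inductive Comparison
  | eq
  | gt
  | ge

def Comparison.Holds : Comparison → ℝ → Prop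
  | .eq, a => a = 0
  | .gt, a => 0 < a
  | .ge, a => 0 ≤ a

/-- Quantifier-free Boolean combinations of polynomial equations and inequalities with integer
coefficients in `n` variables. -/
inductive QFFormula (n : ℕ) : Type
  | atom (c : Comparison) (P : SumOfMonomials n)
  | not (φ : QFFormula n)
  | and (φ ψ : QFFormula n)
  | or (φ ψ : QFFormula n)

/-- Truth of a quantifier-free formula at a real point. -/
def QFFormula.Holds {n : ℕ} (x : Fin n → ℝ) : QFFormula n → Prop
  | .atom c P => c.Holds (P.eval x)
  | .not φ => ¬ φ.Holds x
  | .and φ ψ => φ.Holds x ∧ ψ.Holds x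
  | .or φ ψ => φ.Holds x ∨ ψ.Holds x

def Comparison.symbol : Comparison → Symbol
  | .eq => Symbol.eq
  | .gt => Symbol.gt
  | .ge => Symbol.ge

/-- Formulas are written in prefix (Polish) notation. -/
def encFormula {n : ℕ} : QFFormula n → List Symbol
  | .atom c P => c.symbol :: encPoly P
  | .not φ => Symbol.not :: encFormula φ
  | .and φ ψ => Symbol.and :: (encFormula φ ++ encFormula ψ)
  | .or φ ψ => Symbol.or :: (encFormula φ ++ encFormula ψ)

/-- A sentence `∃ x₁ … ∃ xₙ, Φ(x₁, …, xₙ)`. -/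
structure Sentence where
  n : ℕ
  Φ : QFFormula n

def Sentence.encode (S : Sentence) : List Symbol := encVars S.n ++ encFormula S.Φ

/-- The sentence is true over the reals. -/
def Sentence.IsTrue (S : Sentence) : Prop := ∃ x : Fin S.n → ℝ, S.Φ.Holds x

/-! ### Valley-Separated Clusters -/

/-- An instance of VSC: a polynomial `f ∈ ℤ[x₁, …, x_d]` and a rational threshold `θ > 0`. -/
structure VSCInstance where
  d : ℕ
  f : SumOfMonomials d
  θ : ℚ
  θ_pos : 0 < θ

def VSCInstance.encode (I : VSCInstance) : List Symbol :=
  encVars I.d ++ (encPoly I.f ++ encPosRat I.θ)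

/-- There are two points of `ℝ^d` where `f` is at least `θ` and whose midpoint has value
strictly below `θ`. -/
def VSCInstance.HasValley (I : VSCInstance) : Prop :=
  ∃ p q : Fin I.d → ℝ,
    (I.θ : ℝ) ≤ I.f.eval p ∧ (I.θ : ℝ) ≤ I.f.eval q ∧
      I.f.eval ((1 / 2 : ℝ) • (p + q)) < (I.θ : ℝ)

/-! ### The encodings are injective -/

/-- An encoding that can be decoded from the front of a longer string. -/
def SelfDelimiting {α : Type} (enc : α → List Symbol) : Prop :=
  ∀ a b u v, enc a ++ u = enc b ++ v → a = b ∧ u = v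

theorem SelfDelimiting.injective {α : Type} {enc : α → List Symbol} (h : SelfDelimiting enc) :
    Function.Injective enc := fun a b hab => (h a b [] [] (by rw [hab])).1

theorem bits_semi_inj : ∀ (l m : List Bool) (u v : List Symbol),
    l.map Symbol.bit ++ Symbol.semi :: u = m.map Symbol.bit ++ Symbol.semi :: v →
      l = m ∧ u = v
  | [], [], u, v, h => by simpa using h
  | [], b :: m, u, v, h => by simp at h
  | a :: l, [], u, v, h => by simp at h
  | a :: l, b :: m, u, v, h => by
    simp only [List.map_cons, List.cons_append, List.cons.injEq, Symbol.bit.injEq] at h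
    obtain ⟨h1, h2⟩ := bits_semi_inj l m u v h.2
    exact ⟨by rw [h.1, h1], h2⟩

theorem encNat_selfDelimiting : SelfDelimiting encNat := by
  intro a b u v h
  simp only [encNat, List.append_assoc, List.singleton_append] at h
  obtain ⟨h1, h2⟩ := bits_semi_inj _ _ _ _ h
  refine ⟨?_, h2⟩
  have hinj : Function.LeftInverse (fun l : List Bool => l.foldr Nat.bit 0) Nat.bits := by
    intro n
    induction n using Nat.binaryRec' with
    | zero => simp
    | bit b n hn ih => simp [Nat.bits_append_bit n b hn, ih]
  exact hinj.injective h1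

theorem encInt_selfDelimiting : SelfDelimiting encInt := by
  intro a b u v h
  simp only [encInt, List.cons_append, List.cons.injEq] at h
  obtain ⟨h1, h2⟩ := encNat_selfDelimiting _ _ _ _ h.2
  refine ⟨?_, h2⟩
  have h3 := h.1
  split_ifs at h3 <;> omega

theorem encTuple_inj : ∀ (l m : List ℕ) (u v : List Symbol), l.length = m.length →
    l.flatMap encNat ++ u = m.flatMap encNat ++ v → l = m ∧ u = v
  | [], [], u, v, _, h => by simpa using h
  | [], b :: m, u, v, hl, _ => by simp at hl
  | a :: l, [], u, v, hl, _ => by simp at hl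
  | a :: l, b :: m, u, v, hl, h => by
    simp only [List.flatMap_cons, List.append_assoc] at h
    obtain ⟨h1, h2⟩ := encNat_selfDelimiting _ _ _ _ h
    obtain ⟨h3, h4⟩ := encTuple_inj l m u v (by simpa using hl) h2
    exact ⟨by rw [h1, h3], h4⟩

theorem encTerm_selfDelimiting {n : ℕ} : SelfDelimiting (encTerm (n := n)) := by
  rintro ⟨c, e⟩ ⟨c', e'⟩ u v h
  simp only [encTerm, List.append_assoc] at h
  obtain ⟨h1, h2⟩ := encInt_selfDelimiting _ _ _ _ h
  obtain ⟨h3, h4⟩ := encTuple_inj _ _ _ _ (by simp) h2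
  exact ⟨by rw [h1, List.ofFn_injective h3], h4⟩

theorem encTerm_ne_semi {n : ℕ} (t : ℤ × (Fin n → ℕ)) (u v : List Symbol) :
    encTerm t ++ u ≠ Symbol.semi :: v := by
  simp only [encTerm, encInt, List.cons_append, ne_eq, List.cons.injEq, not_and]
  intro h
  split_ifs at h

theorem encTerms_inj {n : ℕ} : ∀ (P Q : SumOfMonomials n) (u v : List Symbol),
    P.flatMap encTerm ++ Symbol.semi :: u = Q.flatMap encTerm ++ Symbol.semi :: v →
      P = Q ∧ u = v
  | [], [], u, v, h => by simpa using h
  | [], t :: Q, u, v, h => by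
    rw [List.flatMap_cons, List.append_assoc] at h
    exact absurd h.symm (encTerm_ne_semi _ _ _)
  | s :: P, [], u, v, h => by
    rw [List.flatMap_cons, List.append_assoc] at h
    exact absurd h (encTerm_ne_semi _ _ _)
  | s :: P, t :: Q, u, v, h => by
    simp only [List.flatMap_cons, List.append_assoc] at h
    obtain ⟨h1, h2⟩ := encTerm_selfDelimiting _ _ _ _ h
    obtain ⟨h3, h4⟩ := encTerms_inj P Q u v h2
    exact ⟨by rw [h1, h3], h4⟩

theorem encPoly_selfDelimiting {n : ℕ} : SelfDelimiting (encPoly (n := n)) := by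
  intro P Q u v h
  simp only [encPoly, List.append_assoc, List.singleton_append] at h
  exact encTerms_inj P Q u v h

theorem encVars_selfDelimiting : SelfDelimiting encVars := by
  intro a
  induction a with
  | zero =>
    intro b u v h
    cases b <;> simp_all [encVars, List.replicate_succ]
  | succ a ih =>
    intro b u v h
    cases b with
    | zero => simp [encVars, List.replicate_succ] at h
    | succ b =>
      simp only [encVars, List.replicate_succ, List.cons_append, List.cons.injEq,
        true_and] at h
      obtain ⟨h1, h2⟩ := ih b u v h
      exact ⟨by rw [h1], h2⟩

theorem encPosRat_inj {a b : ℚ} (ha : 0 < a) (hb : 0 < b) (h : encPosRat a = encPosRat b) :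
    a = b := by
  obtain ⟨h1, h2⟩ := encNat_selfDelimiting _ _ _ _ h
  have h3 := encNat_selfDelimiting.injective h2
  have := Rat.num_pos.mpr ha
  have := Rat.num_pos.mpr hb
  exact Rat.ext (by omega) h3

theorem encFormula_selfDelimiting {n : ℕ} : SelfDelimiting (encFormula (n := n)) := by
  intro φ
  induction φ with
  | atom c P =>
    intro ψ u v h
    cases ψ with
    | atom c' Q =>
      simp only [encFormula, List.cons_append, List.cons.injEq] at h
      obtain ⟨h1, h2⟩ := encPoly_selfDelimiting _ _ _ _ h.2
      have h3 : c = c' := by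
        have h4 := h.1
        cases c <;> cases c' <;> simp_all [Comparison.symbol]
      exact ⟨by rw [h1, h3], h2⟩
    | _ => cases c <;> simp [encFormula, Comparison.symbol] at h
  | not φ ih =>
    intro ψ u v h
    cases ψ with
    | atom c Q => cases c <;> simp [encFormula, Comparison.symbol] at h
    | not ψ =>
      simp only [encFormula, List.cons_append, List.cons.injEq, true_and] at h
      obtain ⟨h1, h2⟩ := ih _ _ _ h
      exact ⟨by rw [h1], h2⟩
    | _ => simp [encFormula] at h
  | and φ₁ φ₂ ih₁ ih₂ =>
    intro ψ u v h
    cases ψ with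
    | atom c Q => cases c <;> simp [encFormula, Comparison.symbol] at h
    | and ψ₁ ψ₂ =>
      simp only [encFormula, List.cons_append, List.append_assoc, List.cons.injEq,
        true_and] at h
      obtain ⟨h1, h2⟩ := ih₁ _ _ _ h
      obtain ⟨h3, h4⟩ := ih₂ _ _ _ h2
      exact ⟨by rw [h1, h3], h4⟩
    | _ => simp [encFormula] at h
  | or φ₁ φ₂ ih₁ ih₂ =>
    intro ψ u v h
    cases ψ with
    | atom c Q => cases c <;> simp [encFormula, Comparison.symbol] at h
    | or ψ₁ ψ₂ =>
      simp only [encFormula, List.cons_append, List.append_assoc, List.cons.injEq,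
        true_and] at h
      obtain ⟨h1, h2⟩ := ih₁ _ _ _ h
      obtain ⟨h3, h4⟩ := ih₂ _ _ _ h2
      exact ⟨by rw [h1, h3], h4⟩
    | _ => simp [encFormula] at h

theorem Sentence.encode_injective : Function.Injective Sentence.encode := by
  rintro ⟨n, φ⟩ ⟨m, ψ⟩ h
  obtain ⟨h1, h2⟩ := encVars_selfDelimiting _ _ _ _ h
  dsimp only at h1
  subst h1
  obtain rfl : φ = ψ := encFormula_selfDelimiting.injective h2
  rfl

theorem VSCInstance.encode_injective : Function.Injective VSCInstance.encode := by
  rintro ⟨d, f, θ, hθ⟩ ⟨d', f', θ', hθ'⟩ h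
  obtain ⟨h1, h2⟩ := encVars_selfDelimiting _ _ _ _ h
  dsimp only at h1
  subst h1
  obtain ⟨h3, h4⟩ := encPoly_selfDelimiting _ _ _ _ h2
  dsimp only at h3 h4
  subst h3
  obtain rfl := encPosRat_inj hθ hθ' h4
  rfl

/-! ### The problems and the class -/

/-- The existential theory of the reals: is a given existential sentence true over `ℝ`? -/
def ETR : DecisionProblem where
  Instance := Sentence
  Alphabet := Symbol
  alphabet_finite := inferInstance
  encode := Sentence.encode
  encode_injective := Sentence.encode_injective
  Yes := {S | S.IsTrue}

/-- Valley-Separated Clusters. -/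
def VSC : DecisionProblem where
  Instance := VSCInstance
  Alphabet := Symbol
  alphabet_finite := inferInstance
  encode := VSCInstance.encode
  encode_injective := VSCInstance.encode_injective
  Yes := {I | I.HasValley}

/-- The complexity class `∃ℝ`: the decision problems that are polynomial-time many-one reducible
to the existential theory of the reals. -/
def ExistsR : Set DecisionProblem := {P | PolyTimeReducible P ETR}

/-- `Q` is `∃ℝ`-hard: every problem in `∃ℝ` reduces to `Q`. -/
def ExistsRHard (Q : DecisionProblem) : Prop := ∀ P ∈ ExistsR, PolyTimeReducible P Q

/-- `Q` is `∃ℝ`-complete: it belongs to `∃ℝ` and is `∃ℝ`-hard. -/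
def ExistsRComplete (Q : DecisionProblem) : Prop := Q ∈ ExistsR ∧ ExistsRHard Q

end ExistsReals

namespace ExistsReals

/-!
For the hardness, a formula in Polish notation is read from right to left and evaluated by a
straight-line program with boundedly many real registers: the values of the current polynomial,
monomial and power of a variable, square roots of the positive and the negative part of a value,
which decide its sign, and a stack of truth values, coded by the base 3 digits of a single real.
Every operation amounts to polynomial equations in the old and the new content of the registers.
With one more variable `sgn` and the equation `sgn ^ 2 = 1`, let `f` be `1` minus the sum of the
squares of all equations, so that `f ≥ 1` exactly on the set of solutions. Two solutions that differ
only in the sign of `sgn` have a midpoint with `sgn = 0`, where `f < 1`; without solutions there is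
no valley at height `1`.

For the membership, the sentence quantifies over the coordinates of the two points and of their
midpoint. Both reductions are computed by machines that store the input as a row of cells and sweep
over this row boundedly many times for every symbol of the input.
-/

open Turing

/-! ### Composition of polynomial-time machines -/

/-- `f` leads from `a` to `b` in exactly `n` steps: `StateTransition.EvalsTo` as a proposition, for
an evaluation that has not stopped by falling off. -/
def ReachesIn {σ : Type*} (f : σ → Option σ) (n : ℕ) (a b : σ) : Prop :=
  (flip bind f)^[n] (some a) = some b

namespace ReachesIn

variable {σ τ : Type*} {f : σ → Option σ} {n m : ℕ} {a b c : σ}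

theorem refl (f : σ → Option σ) (a : σ) : ReachesIn f 0 a a := rfl

theorem single (h : f a = some b) : ReachesIn f 1 a b := h

theorem trans (h₁ : ReachesIn f n a b) (h₂ : ReachesIn f m b c) : ReachesIn f (n + m) a c := by
  unfold ReachesIn at *
  rw [Nat.add_comm, Function.iterate_add_apply, h₁, h₂]

theorem head (h₁ : f a = some b) (h₂ : ReachesIn f n b c) : ReachesIn f (n + 1) a c := by
  rw [Nat.add_comm]
  exact (single h₁).trans h₂

theorem of_eq (h : ReachesIn f n a b) (e : n = m) : ReachesIn f m a b := e ▸ h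

theorem eq_of_zero (h : ReachesIn f 0 a b) : a = b := Option.some.inj h

theorem exists_of_succ (h : ReachesIn f (n + 1) a c) : ∃ b, f a = some b ∧ ReachesIn f n b c := by
  have iterate_none : (flip bind f)^[n] none = none := Function.iterate_fixed rfl n
  have h : (flip bind f)^[n] (f a) = some c := h
  cases hb : f a with
  | none => exact absurd (iterate_none.symm.trans (hb ▸ h)) (by simp)
  | some b => exact ⟨b, rfl, by rwa [hb] at h⟩

theorem map {g : τ → Option τ} {φ : σ → τ} (hφ : ∀ a b, f a = some b → g (φ a) = some (φ b))
    (h : ReachesIn f n a b) : ReachesIn g n (φ a) (φ b) := by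
  induction n generalizing a with
  | zero =>
    obtain rfl := h.eq_of_zero
    exact refl g _
  | succ n ih =>
    obtain ⟨c, hc, hn⟩ := h.exists_of_succ
    exact head (hφ a c hc) (ih hn)

/-- A two-step loop that moves a list, symbol by symbol, to the top of another one reverses it. -/
theorem pour {A B : Type*} {e : A → B} {loop : Option B → List A → List B → σ}
    {put : B → List A → List B → σ} {done : List B → σ}
    (hnil : ∀ o T, f (loop o [] T) = some (done T))
    (hcons : ∀ o a S T, f (loop o (a :: S) T) = some (put (e a) S T))
    (hput : ∀ b S T, f (put b S T) = some (loop (some b) S (b :: T)))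
    (o : Option B) (S : List A) (T : List B) :
    ReachesIn f (2 * S.length + 1) (loop o S T) (done ((S.map e).reverse ++ T)) := by
  induction S generalizing o T with
  | nil => exact single (hnil o T)
  | cons a S ih =>
    have h := head (hcons o a S T) (head (hput (e a) S T) (ih (some (e a)) (e a :: T)))
    simpa [List.reverse_cons, Nat.mul_succ, Nat.add_right_comm] using h

end ReachesIn

section StackLength

variable {K : Type*} {Γ : K → Type*} {Λ σ : Type*}

/-- The largest number of symbols that a statement can push, which bounds the growth of every
stack during one step. -/
def pushCount : TM2.Stmt Γ Λ σ → ℕ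
  | .push _ _ q => pushCount q + 1
  | .peek _ _ q => pushCount q
  | .pop _ _ q => pushCount q
  | .load _ q => pushCount q
  | .branch _ q₁ q₂ => max (pushCount q₁) (pushCount q₂)
  | .goto _ => 0
  | .halt => 0

variable [DecidableEq K]

theorem length_stepAux_le (k : K) (q : TM2.Stmt Γ Λ σ) (v : σ) (S : ∀ k, List (Γ k)) :
    ((TM2.stepAux q v S).stk k).length ≤ (S k).length + pushCount q := by
  induction q generalizing v S with
  | push k' f q ih =>
    refine (ih _ _).trans ?_
    obtain rfl | h := eq_or_ne k k'
    · simp only [Function.update_self, List.length_cons, pushCount]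
      omega
    · simp [pushCount, Function.update_of_ne h]
  | pop k' f q ih =>
    refine (ih _ _).trans ?_
    obtain rfl | h := eq_or_ne k k'
    · simp [pushCount]
    · simp [pushCount, Function.update_of_ne h]
  | peek _ _ _ ih | load _ _ ih => exact ih _ _
  | branch f q₁ q₂ ih₁ ih₂ =>
    simp only [TM2.stepAux, pushCount]
    cases f v
    · exact (ih₂ v S).trans (by simp)
    · exact (ih₁ v S).trans (by simp)
  | goto | halt => simp

theorem ReachesIn.length_stk_le {M : Λ → TM2.Stmt Γ Λ σ} {C n : ℕ} (hC : ∀ l, pushCount (M l) ≤ C)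
    (k : K) {c c' : TM2.Cfg Γ Λ σ} (h : ReachesIn (TM2.step M) n c c') :
    (c'.stk k).length ≤ (c.stk k).length + n * C := by
  induction n generalizing c with
  | zero => simp [h.eq_of_zero]
  | succ n ih =>
    obtain ⟨b, hb, hn⟩ := h.exists_of_succ
    obtain ⟨_ | l, v, S⟩ := c
    · simp at hb
    · obtain rfl := Option.some.inj hb
      have hrest := ih hn
      have hstep := length_stepAux_le k (M l) v S
      have hl := hC l
      simp only [Nat.succ_mul]
      omega

end StackLength

theorem exists_pushCount_le {K : Type*} {Γ : K → Type*} {Λ σ : Type*} [Finite Λ]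
    (M : Λ → TM2.Stmt Γ Λ σ) : ∃ C, ∀ l, pushCount (M l) ≤ C := by
  obtain ⟨C, hC⟩ := (Set.finite_range fun l => pushCount (M l)).bddAbove
  exact ⟨C, fun l => hC ⟨l, rfl⟩⟩

theorem initList_eq (tm : FinTM2) (s : List (tm.Γ tm.k₀)) :
    initList tm s = ⟨some tm.main, tm.initialState, Function.update (fun _ => []) tm.k₀ s⟩ := by
  unfold initList
  congr 1
  funext k
  obtain rfl | h := eq_or_ne k tm.k₀ <;> simp [*]

theorem haltList_eq (tm : FinTM2) (s : List (tm.Γ tm.k₁)) :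
    haltList tm s = ⟨none, tm.initialState, Function.update (fun _ => []) tm.k₁ s⟩ := by
  unfold haltList
  congr 1
  funext k
  obtain rfl | h := eq_or_ne k tm.k₁ <;> simp [*]

theorem length_output_le {tm : FinTM2} {C n : ℕ} (hC : ∀ l, pushCount (tm.m l) ≤ C)
    {s : List (tm.Γ tm.k₀)} {t : List (tm.Γ tm.k₁)}
    (h : ReachesIn tm.step n (initList tm s) (haltList tm t)) : t.length ≤ s.length + n * C := by
  rw [initList_eq, haltList_eq] at h
  have hk : (Function.update (fun _ => []) tm.k₀ s tm.k₁).length ≤ s.length := by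
    obtain hk | hk := eq_or_ne tm.k₁ tm.k₀
    · rw [hk]; simp
    · simp [hk]
  refine le_trans ?_ (Nat.add_le_add_right hk _)
  simpa using ReachesIn.length_stk_le hC tm.k₁ h

section Inclusion

variable {K K' : Type*} [DecidableEq K] [DecidableEq K'] {Γ' : K' → Type*} {Λ Λ' σ σ' : Type*}

/-- The syntactic data that make a machine with stacks `K`, labels `Λ` and variables `σ` a part of
a larger one with stacks `K'`, labels `Λ'` and variables `σ'`. The part owns the component
`get` of the variables, and where it would halt the larger machine continues at `exit`, or halts if
there is no `exit`. -/
structure MachineInclusion (K K' Λ Λ' σ σ' : Type*) where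
  stack : K → K'
  label : Λ → Λ'
  exit : Option Λ'
  get : σ' → σ
  set : σ → σ' → σ'
  get_set : ∀ v w, get (set v w) = v
  set_set : ∀ u v w, set u (set v w) = set u w

namespace MachineInclusion

/-- The statement of the larger machine that acts on its part as the given statement. -/
def lift (I : MachineInclusion K K' Λ Λ' σ σ') :
    TM2.Stmt (fun k => Γ' (I.stack k)) Λ σ → TM2.Stmt Γ' Λ' σ'
  | .push k f q => .push (I.stack k) (fun v => f (I.get v)) (I.lift q)
  | .peek k f q => .peek (I.stack k) (fun v o => I.set (f (I.get v) o) v) (I.lift q)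
  | .pop k f q => .pop (I.stack k) (fun v o => I.set (f (I.get v) o) v) (I.lift q)
  | .load f q => .load (fun v => I.set (f (I.get v)) v) (I.lift q)
  | .branch f q₁ q₂ => .branch (fun v => f (I.get v)) (I.lift q₁) (I.lift q₂)
  | .goto f => .goto fun v => I.label (f (I.get v))
  | .halt => match I.exit with
    | some l => .goto fun _ => l
    | none => .halt

/-- `F` completes the stacks of the part to stacks of the larger machine, with the same contents of
the other stacks for all stacks of the part. -/
structure IsFrame (I : MachineInclusion K K' Λ Λ' σ σ')
    (F : (∀ k, List (Γ' (I.stack k))) → ∀ k, List (Γ' k)) : Prop where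
  apply : ∀ S k, F S (I.stack k) = S k
  update : ∀ S k x, Function.update (F S) (I.stack k) x = F (Function.update S k x)

/-- A configuration of the part, seen as a configuration of the larger machine. -/
def embed (I : MachineInclusion K K' Λ Λ' σ σ')
    (F : (∀ k, List (Γ' (I.stack k))) → ∀ k, List (Γ' k)) (w : σ')
    (c : TM2.Cfg (fun k => Γ' (I.stack k)) Λ σ) : TM2.Cfg Γ' Λ' σ' :=
  ⟨(c.l.map I.label).or I.exit, I.set c.var w, F c.stk⟩

variable {I : MachineInclusion K K' Λ Λ' σ σ'}
  {F : (∀ k, List (Γ' (I.stack k))) → ∀ k, List (Γ' k)}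

theorem stepAux_lift (hF : I.IsFrame F) (w : σ') (q : TM2.Stmt (fun k => Γ' (I.stack k)) Λ σ)
    (v : σ) (S : ∀ k, List (Γ' (I.stack k))) :
    TM2.stepAux (I.lift q) (I.set v w) (F S) = I.embed F w (TM2.stepAux q v S) := by
  induction q generalizing v S with
  | push k f q ih | peek k f q ih | pop k f q ih | load f q ih =>
    simp only [lift, TM2.stepAux, I.get_set, I.set_set, hF.apply, hF.update, ih]
  | branch f q₁ q₂ ih₁ ih₂ =>
    simp only [lift, TM2.stepAux, I.get_set]
    cases f v
    · exact ih₂ _ _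
    · exact ih₁ _ _
  | goto f => simp [lift, embed, I.get_set]
  | halt =>
    cases h : I.exit <;> simp [lift, embed, h]

theorem reachesIn_embed (hF : I.IsFrame F) (w : σ')
    {M : Λ → TM2.Stmt (fun k => Γ' (I.stack k)) Λ σ} {M' : Λ' → TM2.Stmt Γ' Λ' σ'}
    (hM : ∀ l, M' (I.label l) = I.lift (M l)) {n : ℕ}
    {c c' : TM2.Cfg (fun k => Γ' (I.stack k)) Λ σ} (h : ReachesIn (TM2.step M) n c c') :
    ReachesIn (TM2.step M') n (I.embed F w c) (I.embed F w c') := by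
  refine h.map fun a b hab => ?_
  obtain ⟨_ | l, v, S⟩ := a
  · simp at hab
  · obtain rfl := Option.some.inj hab
    have := stepAux_lift hF w (M l) v S
    simpa [embed, TM2.step, hM] using this

end MachineInclusion

end Inclusion

namespace Composition

variable (tm₁ tm₂ : FinTM2) (e : tm₁.Γ tm₁.k₁ ≃ tm₂.Γ tm₂.k₀)

/-- Labels of the composed machine: those of the two machines, and those of the two loops that
move the output of the first machine to an auxiliary stack and from there to the input stack of
the second, so that it is not reversed. -/
inductive Label (Λ₁ Λ₂ G : Type)
  | first (l : Λ₁)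
  | second (l : Λ₂)
  | unload
  | unloadPut (g : G)
  | reload
  | reloadPut (g : G)
  deriving Fintype

/-- Stack alphabets of the composed machine. The third kind of stack is the auxiliary one. -/
abbrev Alphabet : tm₁.K ⊕ tm₂.K ⊕ Unit → Type
  | .inl k => tm₁.Γ k
  | .inr (.inl k) => tm₂.Γ k
  | .inr (.inr _) => tm₂.Γ tm₂.k₀

/-- Variables of the composed machine. The last one holds the symbol that is being moved. -/
abbrev Var := tm₁.σ × tm₂.σ × Option (tm₂.Γ tm₂.k₀)

/-- The first machine as a part of the composed one, handing over to the second one. -/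
def first : MachineInclusion tm₁.K (tm₁.K ⊕ tm₂.K ⊕ Unit) tm₁.Λ
    (Label tm₁.Λ tm₂.Λ (tm₂.Γ tm₂.k₀)) tm₁.σ (Var tm₁ tm₂) where
  stack := .inl
  label := .first
  exit := some .unload
  get v := v.1
  set u v := (u, v.2)
  get_set _ _ := rfl
  set_set _ _ _ := rfl

/-- The second machine as a part of the composed one. -/
def second : MachineInclusion tm₂.K (tm₁.K ⊕ tm₂.K ⊕ Unit) tm₂.Λ
    (Label tm₁.Λ tm₂.Λ (tm₂.Γ tm₂.k₀)) tm₂.σ (Var tm₁ tm₂) where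
  stack k := .inr (.inl k)
  label := .second
  exit := none
  get v := v.2.1
  set u v := (v.1, u, v.2.2)
  get_set _ _ := rfl
  set_set _ _ _ := rfl

/-- The program of the composed machine. -/
def program : Label tm₁.Λ tm₂.Λ (tm₂.Γ tm₂.k₀) →
    TM2.Stmt (Alphabet tm₁ tm₂) (Label tm₁.Λ tm₂.Λ (tm₂.Γ tm₂.k₀)) (Var tm₁ tm₂)
  | .first l => (first tm₁ tm₂).lift (tm₁.m l)
  | .second l => (second tm₁ tm₂).lift (tm₂.m l)
  | .unload => .pop (.inl tm₁.k₁) (fun v o => (v.1, v.2.1, o.map e)) <|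
      .goto fun v => match v.2.2 with
        | some g => .unloadPut g
        | none => .reload
  | .unloadPut g => .push (.inr (.inr ())) (fun _ => g) <| .goto fun _ => .unload
  | .reload => .pop (.inr (.inr ())) (fun v o => (v.1, v.2.1, o)) <|
      .goto fun v => match v.2.2 with
        | some g => .reloadPut g
        | none => .second tm₂.main
  | .reloadPut g => .push (.inr (.inl tm₂.k₀)) (fun _ => g) <| .goto fun _ => .reload

/-- The machine that runs `tm₁` and then `tm₂` on its output. -/
def machine : FinTM2 where
  K := tm₁.K ⊕ tm₂.K ⊕ Unit
  kDecidableEq := inferInstance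
  kFin := by have := tm₁.kFin; have := tm₂.kFin; infer_instance
  k₀ := .inl tm₁.k₀
  k₁ := .inr (.inl tm₂.k₁)
  Γ := Alphabet tm₁ tm₂
  Λ := Label tm₁.Λ tm₂.Λ (tm₂.Γ tm₂.k₀)
  main := .first tm₁.main
  ΛFin := by have := tm₁.ΛFin; have := tm₂.ΛFin; have := tm₂.Γk₀Fin; infer_instance
  σ := Var tm₁ tm₂
  initialState := (tm₁.initialState, tm₂.initialState, none)
  σFin := by have := tm₁.σFin; have := tm₂.σFin; have := tm₂.Γk₀Fin; infer_instance
  Γk₀Fin := tm₁.Γk₀Fin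
  m := program tm₁ tm₂ e

variable {tm₁ tm₂}

/-- The stacks of the composed machine, given those of the two machines and the auxiliary one. -/
def joinStacks (S₁ : ∀ k, List (tm₁.Γ k)) (S₂ : ∀ k, List (tm₂.Γ k)) (T : List (tm₂.Γ tm₂.k₀)) :
    ∀ k, List (Alphabet tm₁ tm₂ k)
  | .inl k => S₁ k
  | .inr (.inl k) => S₂ k
  | .inr (.inr _) => T

section Update

variable (S₁ : ∀ k, List (tm₁.Γ k)) (S₂ : ∀ k, List (tm₂.Γ k)) (T : List (tm₂.Γ tm₂.k₀))

theorem update_joinStacks_first (k : tm₁.K) (x : List (tm₁.Γ k)) :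
    Function.update (joinStacks S₁ S₂ T) (.inl k) x = joinStacks (Function.update S₁ k x) S₂ T := by
  funext k'
  rcases k' with k' | k' | k'
  · obtain rfl | h := eq_or_ne k' k <;> simp [joinStacks, *]
  all_goals simp [joinStacks]

theorem update_joinStacks_second (k : tm₂.K) (x : List (tm₂.Γ k)) :
    Function.update (joinStacks S₁ S₂ T) (.inr (.inl k)) x
      = joinStacks S₁ (Function.update S₂ k x) T := by
  funext k'
  rcases k' with k' | k' | k'
  · simp [joinStacks]
  · obtain rfl | h := eq_or_ne k' k <;> simp [joinStacks, *]
  · simp [joinStacks]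

theorem update_joinStacks_auxiliary (x : List (tm₂.Γ tm₂.k₀)) :
    Function.update (joinStacks S₁ S₂ T) (.inr (.inr ())) x = joinStacks S₁ S₂ x := by
  funext k'
  rcases k' with k' | k' | k' <;> simp [joinStacks]

theorem isFrame_first : (first tm₁ tm₂).IsFrame (Γ' := Alphabet tm₁ tm₂) (joinStacks · S₂ T) where
  apply _ _ := rfl
  update S k x := update_joinStacks_first S S₂ T k x

theorem isFrame_second : (second tm₁ tm₂).IsFrame (Γ' := Alphabet tm₁ tm₂) (joinStacks S₁ · T) where
  apply _ _ := rfl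
  update S k x := update_joinStacks_second S₁ S T k x

end Update

theorem reachesIn_unload (w : tm₁.σ × tm₂.σ) (S₁ : ∀ k, List (tm₁.Γ k))
    (S₂ : ∀ k, List (tm₂.Γ k)) (s : List (tm₁.Γ tm₁.k₁)) (T : List (tm₂.Γ tm₂.k₀)) :
    ReachesIn (TM2.step (program tm₁ tm₂ e)) (2 * s.length + 1)
      ⟨some .unload, (w.1, w.2, none), joinStacks (Function.update S₁ tm₁.k₁ s) S₂ T⟩
      ⟨some .reload, (w.1, w.2, none), joinStacks (Function.update S₁ tm₁.k₁ []) S₂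
        ((s.map e).reverse ++ T)⟩ := by
  refine ReachesIn.pour (f := TM2.step (program tm₁ tm₂ e)) (e := e)
    (loop := fun o s T => ⟨some .unload, (w.1, w.2, o), joinStacks (Function.update S₁ _ s) S₂ T⟩)
    (put := fun g s T =>
      ⟨some (.unloadPut g), (w.1, w.2, some g), joinStacks (Function.update S₁ _ s) S₂ T⟩)
    (done := fun T =>
      ⟨some .reload, (w.1, w.2, none), joinStacks (Function.update S₁ _ []) S₂ T⟩)
    ?_ ?_ ?_ none s T
  · simp [program, joinStacks, update_joinStacks_first]
  · simp [program, joinStacks, update_joinStacks_first]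
  · simp [program, joinStacks, update_joinStacks_auxiliary]

theorem reachesIn_reload (w : tm₁.σ × tm₂.σ) (S₁ : ∀ k, List (tm₁.Γ k))
    (S₂ : ∀ k, List (tm₂.Γ k)) (s T : List (tm₂.Γ tm₂.k₀)) :
    ReachesIn (TM2.step (program tm₁ tm₂ e)) (2 * s.length + 1)
      ⟨some .reload, (w.1, w.2, none), joinStacks S₁ (Function.update S₂ tm₂.k₀ T) s⟩
      ⟨some (.second tm₂.main), (w.1, w.2, none),
        joinStacks S₁ (Function.update S₂ tm₂.k₀ (s.reverse ++ T)) []⟩ := by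
  conv => enter [4]; rw [← List.map_id s]
  refine ReachesIn.pour (f := TM2.step (program tm₁ tm₂ e)) (e := id)
    (loop := fun o s T => ⟨some .reload, (w.1, w.2, o), joinStacks S₁ (Function.update S₂ _ T) s⟩)
    (put := fun g s T =>
      ⟨some (.reloadPut g), (w.1, w.2, some g), joinStacks S₁ (Function.update S₂ _ T) s⟩)
    (done := fun T =>
      ⟨some (.second tm₂.main), (w.1, w.2, none), joinStacks S₁ (Function.update S₂ _ T) []⟩)
    ?_ ?_ ?_ none s T
  · simp [program, joinStacks, update_joinStacks_auxiliary]
  · simp [program, joinStacks, update_joinStacks_auxiliary]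
  · simp [program, joinStacks, update_joinStacks_second]

theorem reachesIn_program {n₁ n₂ : ℕ} {s : List (tm₁.Γ tm₁.k₀)} {t : List (tm₁.Γ tm₁.k₁)}
    {r : List (tm₂.Γ tm₂.k₁)} (h₁ : ReachesIn tm₁.step n₁ (initList tm₁ s) (haltList tm₁ t))
    (h₂ : ReachesIn tm₂.step n₂ (initList tm₂ (t.map e)) (haltList tm₂ r)) :
    ReachesIn (TM2.step (program tm₁ tm₂ e)) (n₁ + (2 * t.length + 1) + (2 * t.length + 1) + n₂)
      ⟨some (.first tm₁.main), (tm₁.initialState, tm₂.initialState, none),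
        joinStacks (Function.update (fun _ => []) tm₁.k₀ s) (fun _ => []) []⟩
      ⟨none, (tm₁.initialState, tm₂.initialState, none),
        joinStacks (fun _ => []) (Function.update (fun _ => []) tm₂.k₁ r) []⟩ := by
  rw [initList_eq, haltList_eq] at h₁ h₂
  let w := (tm₁.initialState, tm₂.initialState)
  have run_first := MachineInclusion.reachesIn_embed (M' := program tm₁ tm₂ e)
    (isFrame_first (fun _ => []) []) (w.1, w.2, none) (fun _ => rfl) h₁
  have unload := reachesIn_unload e w (fun _ => []) (fun _ => []) t []
  have reload := reachesIn_reload e w (fun _ => []) (fun _ => []) (t.map e).reverse []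
  have run_second := MachineInclusion.reachesIn_embed (M' := program tm₁ tm₂ e)
    (isFrame_second (fun _ => []) []) (w.1, w.2, none) (fun _ => rfl) h₂
  have update_nil₁ : Function.update (fun k : tm₁.K => ([] : List (tm₁.Γ k))) tm₁.k₁ []
      = fun _ => [] := Function.update_eq_self tm₁.k₁ (fun _ => [])
  have update_nil₂ : Function.update (fun k : tm₂.K => ([] : List (tm₂.Γ k))) tm₂.k₀ []
      = fun _ => [] := Function.update_eq_self tm₂.k₀ (fun _ => [])
  simp only [List.reverse_reverse, List.length_reverse, List.length_map, List.append_nil,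
    update_nil₁, update_nil₂] at unload reload
  exact ((run_first.trans unload).trans reload).trans run_second

theorem reachesIn_machine {n₁ n₂ : ℕ} {s : List (tm₁.Γ tm₁.k₀)} {t : List (tm₁.Γ tm₁.k₁)}
    {r : List (tm₂.Γ tm₂.k₁)} (h₁ : ReachesIn tm₁.step n₁ (initList tm₁ s) (haltList tm₁ t))
    (h₂ : ReachesIn tm₂.step n₂ (initList tm₂ (t.map e)) (haltList tm₂ r)) :
    ReachesIn (machine tm₁ tm₂ e).step (n₁ + (2 * t.length + 1) + (2 * t.length + 1) + n₂)
      (initList (machine tm₁ tm₂ e) s) (haltList (machine tm₁ tm₂ e) r) := by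
  have h := reachesIn_program e h₁ h₂
  have joinStacks_nil :
      joinStacks (fun k => ([] : List (tm₁.Γ k))) (fun k => ([] : List (tm₂.Γ k))) [] =
        fun _ => [] := by
    funext k
    rcases k with k | k | k <;> rfl
  rw [← update_joinStacks_first, ← update_joinStacks_second, joinStacks_nil] at h
  have hinit := initList_eq (machine tm₁ tm₂ e) s
  have hhalt := haltList_eq (machine tm₁ tm₂ e) r
  exact hinit.symm ▸ hhalt.symm ▸ h

end Composition

theorem eval_le_eval_of_le (p : Polynomial ℕ) {a b : ℕ} (h : a ≤ b) : p.eval a ≤ p.eval b := by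
  simp only [Polynomial.eval_eq_sum_range]
  gcongr

theorem polyTime_comp {α β γ αΓ βΓ γΓ : Type} {eα : α → List αΓ} {eβ : β → List βΓ}
    {eγ : γ → List γΓ} {f : α → β} {g : β → γ} (hf : TM2ComputableInPolyTime eα eβ f)
    (hg : TM2ComputableInPolyTime eβ eγ g) :
    Nonempty (TM2ComputableInPolyTime eα eγ (g ∘ f)) := by
  have := hf.tm.ΛFin
  obtain ⟨C, hC⟩ := exists_pushCount_le hf.tm.m
  let e := hf.outputAlphabet.trans hg.inputAlphabet.symm
  let size : Polynomial ℕ := .X + hf.time * .C C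
  refine ⟨⟨⟨Composition.machine hf.tm hg.tm e, hf.inputAlphabet, hg.outputAlphabet⟩,
    hf.time + (4 * size + 2) + hg.time.comp size, fun a => ?_⟩⟩
  obtain ⟨⟨n₁, run₁⟩, hn₁⟩ := hf.outputsFun a
  obtain ⟨⟨n₂, run₂⟩, hn₂⟩ := hg.outputsFun (f a)
  have hsize : (eβ (f a)).length ≤ size.eval (eα a).length := by
    have h := length_output_le (n := n₁) hC run₁
    simp only [List.length_map] at h
    simp only [size, Polynomial.eval_add, Polynomial.eval_X, Polynomial.eval_mul,
      Polynomial.eval_C]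
    exact h.trans (by gcongr)
  have htime₂ := hn₂.trans (eval_le_eval_of_le hg.time hsize)
  have hinput : ((eβ (f a)).map hf.outputAlphabet.invFun).map e
      = (eβ (f a)).map hg.inputAlphabet.invFun := by
    simp [e]
  refine ⟨⟨_, Composition.reachesIn_machine (n₁ := n₁) (n₂ := n₂) e run₁ (hinput ▸ run₂)⟩, ?_⟩
  simp only [Polynomial.eval_add, Polynomial.eval_mul, Polynomial.eval_comp,
    Polynomial.eval_ofNat, List.length_map]
  dsimp only at hn₁ htime₂
  omega

theorem PolyTimeReducible.trans {A B C : DecisionProblem} (hAB : PolyTimeReducible A B)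
    (hBC : PolyTimeReducible B C) : PolyTimeReducible A C := by
  obtain ⟨f, ⟨hf⟩, hfA⟩ := hAB
  obtain ⟨g, ⟨hg⟩, hgB⟩ := hBC
  exact ⟨g ∘ f, polyTime_comp hf hg, fun a => (hfA a).trans (hgB _)⟩

/-! ### Sweeping machines -/

/-- A sweeping machine reads its input once from left to right, prepending instructions to an
instruction stack (initially `bottom`) and cells to a row (initially empty). It then executes the
instructions one after the other: each sweeps over the row, rewriting the cells in place and
prepending symbols to the output. `P` and `Q` are the states of the two finite controls. -/
structure Sweeper (Γ A B O P Q : Type) where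
  /-- The first state of the reading phase. -/
  start : P
  bottom : List A
  read : P → Γ → P × List A × List B
  /-- The instructions and cells prepended at the end of the input. -/
  close : List A × List B
  /-- The state in which an instruction enters the row. -/
  enter : A → Q
  sweep : Q → B → Q × B × List O
  /-- The symbols prepended to the output at the end of a sweep. -/
  leave : Q → List O

namespace Sweeper

variable {Γ A B O P Q : Type} (M : Sweeper Γ A B O P Q)

/-- The instructions and the row after the rest of the input has been read. -/
def load : P → List Γ → List A → List B → List A × List B
  | _, [], I, R => (M.close.1 ++ I, M.close.2 ++ R)
  | p, x :: xs, I, R => load (M.read p x).1 xs ((M.read p x).2.1 ++ I) ((M.read p x).2.2 ++ R)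

/-- The row after a sweep. -/
def rewriteRow : Q → List B → List B
  | _, [] => []
  | q, b :: r => (M.sweep q b).2.1 :: rewriteRow (M.sweep q b).1 r

/-- The string that a sweep prepends to the output. -/
def emit : Q → List B → List O
  | q, [] => M.leave q
  | q, b :: r => emit (M.sweep q b).1 r ++ (M.sweep q b).2.2

/-- The output after the given instructions have been executed. -/
def exec : List A → List B → List O → List O
  | [], _, out => out
  | a :: I, r, out => exec I (M.rewriteRow (M.enter a) r) (M.emit (M.enter a) r ++ out)

/-- The instructions and the row after the input has been read. -/
def loaded (x : List Γ) : List A × List B := M.load M.start x M.bottom []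

/-- The output of the machine. -/
def run (x : List Γ) : List O := M.exec (M.loaded x).1 (M.loaded x).2 []

@[simp]
theorem length_rewriteRow (q : Q) (r : List B) : (M.rewriteRow q r).length = r.length := by
  induction r generalizing q with
  | nil => rfl
  | cons b r ih => simp [rewriteRow, ih]

theorem rewriteRow_of_const {q : Q} {e : B → List O} (h : ∀ b, M.sweep q b = (q, b, e b))
    (r : List B) : M.rewriteRow q r = r := by
  induction r with
  | nil => rfl
  | cons b r ih => simp [rewriteRow, h, ih]

theorem emit_of_const {q : Q} {e : B → List O} (h : ∀ b, M.sweep q b = (q, b, e b))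
    (r : List B) : M.emit q r = M.leave q ++ r.reverse.flatMap e := by
  induction r with
  | nil => simp [emit]
  | cons b r ih => simp [emit, h, ih]

variable {M} in
theorem exec_cons_of_const {a : A} {e : B → List O}
    (h : ∀ b, M.sweep (M.enter a) b = (M.enter a, b, e b)) (I : List A) (r : List B)
    (out : List O) :
    M.exec (a :: I) r out = M.exec I r (M.leave (M.enter a) ++ r.reverse.flatMap e ++ out) := by
  rw [exec, M.rewriteRow_of_const h, M.emit_of_const h]

/-- The stacks of the Turing machine that simulates a sweeping machine. Cells that a sweep has
passed wait on `aux`. -/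
inductive Stack
  | input
  | instr
  | row
  | aux
  | output
  deriving DecidableEq

instance : Fintype Stack :=
  ⟨{.input, .instr, .row, .aux, .output}, fun k => by cases k <;> simp⟩

/-- The labels of the simulating machine. -/
inductive Label (Γ A B P Q : Type)
  | start
  | read (p : P)
  | store (p : P) (x : Γ)
  | close
  | next
  | pass (q : Q)
  | sweep (q : Q) (b : B)
  | leave (q : Q)
  | restore
  | put (b : B)
  | clear
  | done
  deriving Fintype

/-- The stack alphabets of the simulating machine. -/
abbrev Alphabet (Γ A B O : Type) : Stack → Type
  | .input => Γ
  | .instr => A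
  | .row => B
  | .aux => B
  | .output => O

/-- The memory of the simulating machine: the symbol popped last. -/
abbrev Memory (Γ A B : Type) := Option (Γ ⊕ A ⊕ B)

/-- Pushes the symbols of a list, the first one ending up on top. -/
def pushAll {K : Type*} {G : K → Type*} {Λ σ : Type*} (k : K) :
    List (G k) → TM2.Stmt G Λ σ → TM2.Stmt G Λ σ
  | [], q => q
  | a :: l, q => pushAll k l (.push k (fun _ => a) q)

theorem stepAux_pushAll {K : Type*} [DecidableEq K] {G : K → Type*} {Λ σ : Type*} (k : K)
    (l : List (G k)) (q : TM2.Stmt G Λ σ) (v : σ) (S : ∀ k, List (G k)) :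
    TM2.stepAux (pushAll k l q) v S = TM2.stepAux q v (Function.update S k (l ++ S k)) := by
  induction l generalizing q with
  | nil => simp [pushAll]
  | cons a l ih => simp [pushAll, ih]

/-- The program of the simulating machine. -/
def program : Label Γ A B P Q → TM2.Stmt (Alphabet Γ A B O) (Label Γ A B P Q) (Memory Γ A B)
  | .start => pushAll .instr M.bottom <| .goto fun _ => .read M.start
  | .read p => .pop .input (fun _ o => o.map .inl) <| .goto fun v => match v with
      | some (.inl x) => .store p x
      | _ => .close
  | .store p x => pushAll .instr (M.read p x).2.1 <| pushAll .row (M.read p x).2.2 <|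
      .goto fun _ => .read (M.read p x).1
  | .close => pushAll .instr M.close.1 <| pushAll .row M.close.2 <| .goto fun _ => .next
  | .next => .pop .instr (fun _ o => o.map (.inr ∘ .inl)) <| .goto fun v => match v with
      | some (.inr (.inl a)) => .pass (M.enter a)
      | _ => .clear
  | .pass q => .pop .row (fun _ o => o.map (.inr ∘ .inr)) <| .goto fun v => match v with
      | some (.inr (.inr b)) => .sweep q b
      | _ => .leave q
  | .sweep q b => .push .aux (fun _ => (M.sweep q b).2.1) <|
      pushAll .output (M.sweep q b).2.2 <| .goto fun _ => .pass (M.sweep q b).1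
  | .leave q => pushAll .output (M.leave q) <| .goto fun _ => .restore
  | .restore => .pop .aux (fun _ o => o.map (.inr ∘ .inr)) <| .goto fun v => match v with
      | some (.inr (.inr b)) => .put b
      | _ => .next
  | .put b => .push .row (fun _ => b) <| .goto fun _ => .restore
  | .clear => .pop .row (fun _ o => o.map (.inr ∘ .inr)) <| .goto fun v => match v with
      | some (.inr (.inr _)) => .clear
      | _ => .done
  | .done => .halt

/-- The stacks of the simulating machine, given their contents. -/
def stacksOf (x : List Γ) (I : List A) (R T : List B) (out : List O) :
    ∀ k, List (Alphabet Γ A B O k)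
  | .input => x
  | .instr => I
  | .row => R
  | .aux => T
  | .output => out

section Update

variable (x x' : List Γ) (I I' : List A) (R R' T T' : List B) (out out' : List O)

@[simp]
theorem update_input :
    Function.update (stacksOf x I R T out) .input x' = stacksOf x' I R T out := by
  funext k; cases k <;> rfl

@[simp]
theorem update_instr :
    Function.update (stacksOf x I R T out) .instr I' = stacksOf x I' R T out := by
  funext k; cases k <;> rfl

@[simp]
theorem update_row : Function.update (stacksOf x I R T out) .row R' = stacksOf x I R' T out := by
  funext k; cases k <;> rfl

@[simp]
theorem update_aux : Function.update (stacksOf x I R T out) .aux T' = stacksOf x I R T' out := by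
  funext k; cases k <;> rfl

@[simp]
theorem update_output :
    Function.update (stacksOf x I R T out) .output out' = stacksOf x I R T out' := by
  funext k; cases k <;> rfl

end Update

/-- A configuration of the simulating machine. -/
abbrev config (l : Option (Label Γ A B P Q)) (v : Memory Γ A B) (x : List Γ) (I : List A)
    (R T : List B) (out : List O) :
    TM2.Cfg (Alphabet Γ A B O) (Label Γ A B P Q) (Memory Γ A B) :=
  ⟨l, v, stacksOf x I R T out⟩

theorem reachesIn_read (p : P) (v : Memory Γ A B) (x : List Γ) (I : List A) (R : List B) :
    ReachesIn (TM2.step M.program) (2 * x.length + 2) (config (some (.read p)) v x I R [] [])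
      (config (some .next) none [] (M.load p x I R).1 (M.load p x I R).2 [] []) := by
  induction x generalizing p v I R with
  | nil =>
    refine .head (b := config (some .close) none [] I R [] []) ?_ (.single ?_)
    · simp [program, stacksOf]
    · simp [program, stacksOf, stepAux_pushAll, load]
  | cons a x ih =>
    refine (ReachesIn.head (b := config (some (.store p a)) (some (.inl a)) x I R [] []) ?_
      (.head ?_ (ih (M.read p a).1 (some (.inl a)) ((M.read p a).2.1 ++ I)
        ((M.read p a).2.2 ++ R)))).of_eq (by simp only [List.length_cons]; omega)
    · simp [program, stacksOf]
    · simp [program, stacksOf, stepAux_pushAll]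

theorem reachesIn_pass (q : Q) (v : Memory Γ A B) (I : List A) (R T : List B) (out : List O) :
    ReachesIn (TM2.step M.program) (2 * R.length + 2) (config (some (.pass q)) v [] I R T out)
      (config (some .restore) none [] I [] ((M.rewriteRow q R).reverse ++ T)
        (M.emit q R ++ out)) := by
  induction R generalizing q T v out with
  | nil =>
    refine .head (b := config (some (.leave q)) none [] I [] T out) ?_ (.single ?_)
    · simp [program, stacksOf]
    · simp [program, stacksOf, stepAux_pushAll, rewriteRow, emit]
  | cons b R ih =>
    have hrest := ih (M.sweep q b).1 (some (.inr (.inr b))) ((M.sweep q b).2.1 :: T)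
      ((M.sweep q b).2.2 ++ out)
    simp only [rewriteRow, emit, List.reverse_cons, List.append_assoc, List.singleton_append]
    refine (ReachesIn.head (b := config (some (.sweep q b)) (some (.inr (.inr b))) [] I R T out)
      ?_ (.head ?_ hrest)).of_eq (by simp only [List.length_cons]; omega)
    · simp [program, stacksOf]
    · simp [program, stacksOf, stepAux_pushAll]

theorem reachesIn_restore (I : List A) (R T : List B) (out : List O) :
    ReachesIn (TM2.step M.program) (2 * T.length + 1) (config (some .restore) none [] I R T out)
      (config (some .next) none [] I (T.reverse ++ R) [] out) := by
  have h := ReachesIn.pour (f := TM2.step M.program) (e := id)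
    (loop := fun o T R => config (some .restore) (o.map (.inr ∘ .inr)) [] I R T out)
    (put := fun b T R => config (some (.put b)) (some (.inr (.inr b))) [] I R T out)
    (done := fun R => config (some .next) none [] I R [] out)
    (by simp [program, stacksOf]) (by simp [program, stacksOf]) (by simp [program, stacksOf])
    none T R
  rwa [List.map_id] at h

theorem reachesIn_clear (v : Memory Γ A B) (R : List B) (out : List O) :
    ReachesIn (TM2.step M.program) (R.length + 2) (config (some .clear) v [] [] R [] out)
      (config none none [] [] [] [] out) := by
  induction R generalizing v with
  | nil =>
    refine .head (b := config (some .done) none [] [] [] [] out) ?_ (.single ?_)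
    · simp [program, stacksOf]
    · simp [program]
  | cons b R ih =>
    refine (ReachesIn.head ?_ (ih (some (.inr (.inr b))))).of_eq (by simp)
    simp [program, stacksOf]

theorem reachesIn_exec (I : List A) (R : List B) (out : List O) :
    ReachesIn (TM2.step M.program) (I.length * (4 * R.length + 4) + (R.length + 3))
      (config (some .next) none [] I R [] out) (config none none [] [] [] [] (M.exec I R out)) := by
  induction I generalizing R out with
  | nil =>
    refine (ReachesIn.head ?_ (M.reachesIn_clear none R out)).of_eq (by simp)
    simp [program, stacksOf]
  | cons a I ih =>
    have pass := M.reachesIn_pass (M.enter a) (some (.inr (.inl a))) I R [] out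
    have restore := M.reachesIn_restore I [] (M.rewriteRow (M.enter a) R).reverse
      (M.emit (M.enter a) R ++ out)
    have rest := ih (M.rewriteRow (M.enter a) R) (M.emit (M.enter a) R ++ out)
    simp only [List.append_nil, List.reverse_reverse] at pass restore
    refine (ReachesIn.head ?_ ((pass.trans restore).trans rest)).of_eq ?_
    · simp [program, stacksOf]
    · simp only [List.length_reverse, length_rewriteRow, List.length_cons]
      ring

theorem exists_length_read_le [Finite Γ] [Finite P] :
    ∃ c, ∀ p x, (M.read p x).2.1.length ≤ c ∧ (M.read p x).2.2.length ≤ c := by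
  obtain ⟨c, hc⟩ := (Set.finite_range fun z : P × Γ =>
    (M.read z.1 z.2).2.1.length + (M.read z.1 z.2).2.2.length).bddAbove
  refine ⟨c, fun p x => ?_⟩
  have hpx : (M.read p x).2.1.length + (M.read p x).2.2.length ≤ c := hc ⟨(p, x), rfl⟩
  omega

theorem length_load_le {c : ℕ}
    (hc : ∀ p x, (M.read p x).2.1.length ≤ c ∧ (M.read p x).2.2.length ≤ c)
    (p : P) (x : List Γ) (I : List A) (R : List B) :
    (M.load p x I R).1.length ≤ I.length + M.close.1.length + c * x.length ∧
      (M.load p x I R).2.length ≤ R.length + M.close.2.length + c * x.length := by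
  induction x generalizing p I R with
  | nil =>
    simp only [load, List.length_append, List.length_nil]
    omega
  | cons a x ih =>
    have hrest := ih (M.read p a).1 ((M.read p a).2.1 ++ I) ((M.read p a).2.2 ++ R)
    have hfirst := hc p a
    simp only [load, List.length_append, List.length_cons, Nat.mul_succ] at hrest ⊢
    omega

/-- The number of steps of the simulating machine on an input of length `n` that is loaded as `i`
instructions and a row of `r` cells. -/
def steps {R : Type*} [CommSemiring R] (n i r : R) : R :=
  1 + (2 * n + 2) + (i * (4 * r + 4) + (r + 3))

theorem exists_steps_le [Finite Γ] [Finite P] : ∃ p : Polynomial ℕ, ∀ x,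
    steps x.length (M.loaded x).1.length (M.loaded x).2.length ≤ p.eval x.length := by
  obtain ⟨c, hc⟩ := M.exists_length_read_le
  refine ⟨steps .X (.C (M.bottom.length + M.close.1.length) + .C c * .X)
    (.C M.close.2.length + .C c * .X), fun x => ?_⟩
  obtain ⟨hinstr, hrow⟩ := M.length_load_le hc M.start x M.bottom []
  simp only [List.length_nil, Nat.zero_add] at hrow
  simp only [steps, loaded, Polynomial.eval_add, Polynomial.eval_mul, Polynomial.eval_X,
    Polynomial.eval_C, Polynomial.eval_ofNat, Polynomial.eval_one]
  gcongr

section Machine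

variable [Fintype Γ] [Fintype A] [Fintype B] [Fintype P] [Fintype Q]

/-- The Turing machine that simulates a sweeping machine. -/
def machine : FinTM2 where
  K := Stack
  k₀ := .input
  k₁ := .output
  Γ := Alphabet Γ A B O
  Λ := Label Γ A B P Q
  main := .start
  σ := Memory Γ A B
  initialState := none
  Γk₀Fin := inferInstanceAs (Fintype Γ)
  m := M.program

theorem reachesIn_machine (x : List Γ) :
    ReachesIn M.machine.step (steps x.length (M.loaded x).1.length (M.loaded x).2.length)
      (initList M.machine x) (haltList M.machine (M.run x)) := by
  have start : ReachesIn (TM2.step M.program) 1 (config (some .start) none x [] [] [] [])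
      (config (some (.read M.start)) none x M.bottom [] [] []) := by
    refine .single ?_
    simp [program, stacksOf, stepAux_pushAll]
  have h := (start.trans (M.reachesIn_read M.start none x M.bottom [])).trans
    (M.reachesIn_exec _ _ [])
  have stacksOf_nil : stacksOf [] [] [] [] [] = fun k => ([] : List (Alphabet Γ A B O k)) := by
    funext k; cases k <;> rfl
  unfold config at h
  rw [← update_output [] [] [] [] [], ← update_input [] x, stacksOf_nil] at h
  have hinit := initList_eq M.machine x
  have hhalt := haltList_eq M.machine (M.run x)
  exact hinit.symm ▸ hhalt.symm ▸ h

theorem polyTime {α β : Type} {ea : α → List Γ} {eb : β → List O} {f : α → β}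
    (h : ∀ a, M.run (ea a) = eb (f a)) : Nonempty (TM2ComputableInPolyTime ea eb f) := by
  obtain ⟨p, hp⟩ := M.exists_steps_le
  refine ⟨⟨⟨M.machine, .refl _, .refl _⟩, p, fun a => ⟨⟨_, ?_⟩, hp (ea a)⟩⟩⟩
  have hrun := M.reachesIn_machine (ea a)
  rw [h] at hrun
  have hinput : (ea a).map (Equiv.refl Γ).invFun = ea a := List.map_id _
  have houtput : (eb (f a)).map (Equiv.refl O).invFun = eb (f a) := List.map_id _
  exact hinput.symm ▸ houtput.symm ▸ hrun

end Machine

end Sweeper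

/-! ### Values of explicit sums of monomials -/

theorem SumOfMonomials.eval_eq {n : ℕ} (P : SumOfMonomials n) (x : Fin n → ℝ) :
    P.eval x = (P.map fun t => (t.1 : ℝ) * ∏ i, x i ^ t.2 i).sum := by
  simp only [SumOfMonomials.eval, SumOfMonomials.toPoly, map_list_sum, List.map_map]
  congr 1
  refine List.map_congr_left fun t _ => ?_
  rw [Function.comp_apply, MvPolynomial.aeval_monomial, Finsupp.prod_fintype _ _ (by simp)]
  simp

theorem SumOfMonomials.eval_append {n : ℕ} (P Q : SumOfMonomials n) (x : Fin n → ℝ) :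
    SumOfMonomials.eval (P ++ Q) x = P.eval x + Q.eval x := by
  simp [SumOfMonomials.eval_eq]

theorem foldr_bit_bits (n : ℕ) : n.bits.foldr Nat.bit 0 = n := by
  induction n using Nat.binaryRec' with
  | zero => simp
  | bit b n hn ih => simp [Nat.bits_append_bit n b hn, ih]

/-- The term in `n` variables with a given list of exponents; missing exponents are `0`. -/
def listTerm (n : ℕ) (t : ℤ × List ℕ) : ℤ × (Fin n → ℕ) := (t.1, fun j => t.2.getD j 0)

/-- The string that represents a term with listed exponents. -/
def encListTerm (t : ℤ × List ℕ) : List Symbol := encInt t.1 ++ t.2.flatMap encNat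

theorem ofFn_getD {α : Type*} {n : ℕ} {l : List α} (h : l.length = n) (a : α) :
    List.ofFn (fun j : Fin n => l.getD j a) = l := by
  subst h
  refine List.ext_getElem (by simp) fun i h₁ h₂ => ?_
  simp

theorem encTerm_listTerm {n : ℕ} {t : ℤ × List ℕ} (h : t.2.length = n) :
    encTerm (listTerm n t) = encListTerm t := by
  simp only [encTerm, listTerm, encListTerm, ofFn_getD h]

theorem prod_pow_getD {n : ℕ} {l : List ℕ} (h : l.length = n) (x : Fin n → ℝ) :
    ∏ j, x j ^ l.getD j 0 = (List.zipWith (· ^ ·) (List.ofFn x) l).prod := by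
  subst h
  rw [← List.prod_ofFn]
  congr 1
  refine List.ext_getElem (by simp) fun i h₁ h₂ => ?_
  simp

namespace Hardness

/-! ### Straight-line programs over the reals -/

/-- The registers of a straight-line program. -/
inductive Register
  /-- The value of the part of a polynomial that has been read. -/
  | poly
  /-- The value of the part of a monomial that has been read. -/
  | mono
  /-- The power, or the coefficient, that is being read. -/
  | power
  /-- The stack of truth values, encoded in one real number. -/
  | stack
  | truth
  | truth'
  /-- A square root of the positive part of `poly`. -/
  | posRoot
  /-- A square root of the negative part of `poly`. -/
  | negRoot
  deriving DecidableEq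

instance : Fintype Register :=
  ⟨{.poly, .mono, .power, .stack, .truth, .truth', .posRoot, .negRoot},
    fun r => by cases r <;> simp⟩

/-- The role of a real variable at some moment of a straight-line program: a coordinate of the
point (`ahead` of, `current` at or `passed` by a cursor), the coordinate `sgn` that separates the
clusters, one of the two variables `new₁`, `new₂` that the current operation determines, a
variable not used yet, the present content of a register, or a variable not needed any more. -/
inductive Tag
  | dead
  | ahead
  | current
  | passed
  | sgn
  | new₁
  | new₂
  | fresh
  | reg (r : Register)
  deriving DecidableEq, Fintype

open Register Tag

/-- How an operation moves the cursor on the coordinates. -/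
inductive CursorMove
  | keep
  | advance
  | clear
  | reset
  deriving DecidableEq

/-- The operations of a straight-line program. -/
inductive Operation
  | start
  | endExponent
  | exponentBit (b : Bool)
  | endCoefficient
  | coefficientBit (b : Bool)
  | addTerm (neg : Bool)
  | testPoly
  | testPosRoot
  | testNegRoot
  | split
  | negate
  | save
  | conj
  | push
  | peek
  | pop
  | check
  deriving DecidableEq, Fintype

/-- A polynomial in tagged variables, as a sum of terms. Operations equate such polynomials with
zero. -/
abbrev TagPolynomial := List (ℤ × List Tag)

namespace TagPolynomial

/-- The terms of `-g * h`. -/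
def negMul (g h : TagPolynomial) : TagPolynomial :=
  g.flatMap fun s => h.map fun t => (-(s.1 * t.1), s.2 ++ t.2)

/-- The value of a polynomial when the tags have the values `ρ`. -/
noncomputable def eval (ρ : Tag → ℝ) (g : TagPolynomial) : ℝ :=
  (g.map fun t => (t.1 : ℝ) * (t.2.map ρ).prod).sum

variable (ρ : Tag → ℝ)

theorem eval_append (g h : TagPolynomial) : eval ρ (g ++ h) = eval ρ g + eval ρ h := by
  simp [eval]

theorem eval_negMul (g h : TagPolynomial) : eval ρ (negMul g h) = -(eval ρ g * eval ρ h) := by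
  have eval_map_neg_mul (s : ℤ × List Tag) :
      eval ρ (h.map fun t => (-(s.1 * t.1), s.2 ++ t.2)) =
        -(s.1 * (s.2.map ρ).prod) * eval ρ h := by
    simp only [eval, List.map_map, ← List.sum_map_mul_left]
    congr 1
    refine List.map_congr_left fun t _ => ?_
    simp only [Function.comp_apply, List.map_append, List.prod_append]
    push_cast
    ring
  induction g with
  | nil => simp [eval, negMul]
  | cons s g ih =>
    have : negMul (s :: g) h = h.map (fun t => (-(s.1 * t.1), s.2 ++ t.2)) ++ negMul g h := rfl
    rw [this, eval_append, eval_map_neg_mul, ih]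
    simp only [eval, List.map_cons, List.sum_cons]
    ring

end TagPolynomial

/-- The equations `r * new₁ = 0` and `r * new₂ + new₁ = 1`, which make `new₁` the truth value of
`r = 0`. -/
def vanishingTest (r : Register) : List TagPolynomial :=
  [[(1, [reg r, new₁])], [(1, [reg r, new₂]), (1, [new₁]), (-1, [])]]

namespace Operation

/-- The equations that determine the new variables of an operation. A pushed truth value `b`
turns the stack `s` into `(s + 2 * b) / 3`, whose first base-`3` digit is `2 * b`. -/
def equations : Operation → List TagPolynomial
  | start => [[(1, [new₁])], [(1, [new₂])]]
  | endExponent => [[(1, [new₁]), (-1, [reg mono, reg power])]]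
  | exponentBit b =>
    [[(1, [new₁]), (-1, if b then [reg power, reg power, current] else [reg power, reg power])]]
  | endCoefficient => [[(1, [new₁]), (-1, [reg mono, reg power])], [(1, [new₂])]]
  | coefficientBit b => [[(1, [new₁]), (-2, [reg power]), (if b then -1 else 0, [])]]
  | addTerm neg =>
    [[(1, [new₁]), (-1, [reg poly]), (if neg then 1 else -1, [reg power, reg mono])]]
  | testPoly => vanishingTest poly
  | testPosRoot => vanishingTest posRoot
  | testNegRoot => vanishingTest negRoot
  | split => [[(1, [new₁, new₁]), (-1, [new₂, new₂]), (-1, [reg poly])], [(1, [new₁, new₂])]]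
  | negate => [[(1, [new₁]), (1, [reg truth]), (-1, [])]]
  | save => [[(1, [new₁]), (-1, [reg truth])]]
  | conj => [[(1, [new₁]), (-1, [reg truth, reg truth'])]]
  | push => [[(3, [new₁]), (-1, [reg stack]), (-2, [reg truth])], [(1, [new₂])]]
  | peek => [[(1, [new₁]), (-2, [reg stack]), (1, [])]]
  | pop => [[(1, [new₁]), (-3, [reg stack]), (2, [reg truth])]]
  | check => [[(3, [reg stack]), (-2, [])], [(1, [sgn, sgn]), (-1, [])]]

/-- The registers that an operation overwrites or discards. -/
def discarded : Operation → List Register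
  | start => [poly, stack]
  | endExponent => [mono, power]
  | exponentBit _ => [power]
  | endCoefficient => [mono, power]
  | coefficientBit _ => [power]
  | addTerm _ => [poly, power, mono]
  | testPoly => [poly, posRoot, negRoot, truth]
  | testPosRoot => [poly, posRoot, negRoot, truth]
  | testNegRoot => [poly, posRoot, negRoot, truth]
  | split => [poly, posRoot, negRoot]
  | negate => [truth]
  | save => [truth, truth']
  | conj => [truth, truth']
  | push => [stack, truth, poly]
  | peek => [poly]
  | pop => [stack]
  | check => []

/-- The register into which the first new variable goes. -/
def dest₁ : Operation → Option Register
  | start => poly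
  | endExponent => mono
  | exponentBit _ => power
  | endCoefficient => mono
  | coefficientBit _ => power
  | addTerm _ => poly
  | testPoly => truth
  | testPosRoot => truth
  | testNegRoot => truth
  | split => posRoot
  | negate => truth
  | save => truth'
  | conj => truth
  | push => stack
  | peek => poly
  | pop => stack
  | check => none

/-- The register into which the second new variable goes. -/
def dest₂ : Operation → Option Register
  | start => stack
  | endCoefficient => power
  | split => negRoot
  | push => poly
  | _ => none

/-- The cursor movement of an operation. -/
def cursorMove : Operation → CursorMove
  | endExponent => .advance
  | addTerm _ => .reset
  | push => .clear
  | _ => .keep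

/-- The terms that an operation contributes to the polynomial of the instance: those of minus the
sum of the squares of its equations, and of the summand `1` in the case of `check`. -/
def terms (m : Operation) : TagPolynomial :=
  (m.equations.flatMap fun g => g.negMul g) ++ if m = check then [(1, [])] else []

/-- The equations of an operation hold when the tags have the values `ρ`. -/
def Holds (m : Operation) (ρ : Tag → ℝ) : Prop := ∀ g ∈ m.equations, g.eval ρ = 0

/-- The values of the polynomials that an operation equates with zero. -/
noncomputable def residuals (m : Operation) (ρ : Tag → ℝ) : List ℝ :=
  m.equations.map (TagPolynomial.eval ρ)

theorem forall_mem_residuals (m : Operation) (ρ : Tag → ℝ) :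
    (∀ a ∈ m.residuals ρ, a = 0) ↔ m.Holds ρ := by
  simp [residuals, Holds]

theorem eval_terms (m : Operation) (ρ : Tag → ℝ) :
    m.terms.eval ρ = (if m = check then 1 else 0) - ((m.residuals ρ).map (· ^ 2)).sum := by
  have eval_flatMap_negMul (l : List TagPolynomial) :
      TagPolynomial.eval ρ (l.flatMap fun g => g.negMul g) =
        -((l.map (TagPolynomial.eval ρ)).map (· ^ 2)).sum := by
    induction l with
    | nil => simp [TagPolynomial.eval]
    | cons g l ih =>
      rw [List.flatMap_cons, TagPolynomial.eval_append, TagPolynomial.eval_negMul, ih]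
      simp only [List.map_cons, List.sum_cons]
      ring
  rw [terms, TagPolynomial.eval_append, eval_flatMap_negMul, residuals, neg_add_eq_sub]
  split_ifs <;> simp [TagPolynomial.eval]

end Operation

/-- The effect of a cursor movement on a coordinate. The Boolean tells whether the place of the
cursor is still to come. -/
def CursorMove.act : CursorMove → Bool → Tag → Bool × Tag
  | .keep, s, t => (s, t)
  | .advance, true, ahead => (false, current)
  | .advance, true, _ => (true, passed)
  | .advance, false, t => (false, t)
  | .clear, s, _ => (s, ahead)
  | .reset, true, _ => (false, current)
  | .reset, false, _ => (false, ahead)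

/-- The control of the sweep that updates the tags: how many new variables have to be found, and
whether the place of the cursor is still to come. -/
abbrev RetagState := Fin 3 × Bool

/-- The state of the control and the tag of a variable after the variable has been passed. -/
def retag (m : Operation) : RetagState → Tag → RetagState × Tag
  | (_, s), new₁ => ((2, s), m.dest₁.elim dead reg)
  | (c, s), new₂ => ((c, s), m.dest₂.elim dead reg)
  | (2, s), fresh => ((1, s), new₁)
  | (1, s), fresh => ((0, s), new₂)
  | (0, s), fresh => ((0, s), fresh)
  | (c, s), reg r => ((c, s), if r ∈ m.discarded then dead else reg r)
  | (c, s), dead => ((c, s), dead)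
  | (c, s), sgn => ((c, s), sgn)
  | (c, s), ahead => ((c, (m.cursorMove.act s ahead).1), (m.cursorMove.act s ahead).2)
  | (c, s), current => ((c, (m.cursorMove.act s current).1), (m.cursorMove.act s current).2)
  | (c, s), passed => ((c, (m.cursorMove.act s passed).1), (m.cursorMove.act s passed).2)

/-- The update of a row of tags. -/
def retagRow (m : Operation) : RetagState → List Tag → List Tag
  | _, [] => []
  | c, t :: r => (retag m c t).2 :: retagRow m (retag m c t).1 r

@[simp]
theorem length_retagRow (m : Operation) (c : RetagState) (r : List Tag) :
    (retagRow m c r).length = r.length := by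
  induction r generalizing c with
  | nil => rfl
  | cons t r ih => simp [retagRow, ih]

/-! ### The operations for a formula -/

/-- The part of the input that is being read. -/
inductive Mode
  | vars
  | body
  | coef
  deriving DecidableEq

instance : Fintype Mode := ⟨{.vars, .body, .coef}, fun p => by cases p <;> simp⟩

/-- The mode after a symbol. -/
def nextMode : Mode → Symbol → Mode
  | .vars, .semi => .body
  | .vars, _ => .vars
  | .body, .plus => .coef
  | .body, .minus => .coef
  | .body, _ => .body
  | .coef, .semi => .body
  | .coef, _ => .coef

/-- The operations that move the top of the stack into the register `truth`. -/
def popTruth : List Operation := [.peek, .split, .testNegRoot, .pop]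

/-- The operations for a symbol. -/
def symbolOps : Mode → Symbol → List Operation
  | .vars, _ => []
  | .coef, .bit b => [.coefficientBit b]
  | .coef, .semi => [.endCoefficient]
  | .coef, _ => []
  | .body, .bit b => [.exponentBit b]
  | .body, .semi => [.endExponent]
  | .body, .var => []
  | .body, .plus => [.addTerm false]
  | .body, .minus => [.addTerm true]
  | .body, .eq => [.testPoly, .push]
  | .body, .ge => [.split, .testNegRoot, .push]
  | .body, .gt => [.split, .testPosRoot, .negate, .push]
  | .body, .not => popTruth ++ [.negate, .push]
  | .body, .and => popTruth ++ (.save :: popTruth ++ [.conj, .push])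
  | .body, .or =>
    popTruth ++ (.negate :: .save :: popTruth ++ [.negate, .conj, .negate, .push])

/-- The operations for a string. The string is processed from right to left, so that a formula in
Polish notation becomes a program for the stack of truth values. -/
def stringOps : Mode → List Symbol → List Operation
  | _, [] => []
  | p, x :: w => stringOps (nextMode p x) w ++ symbolOps p x

theorem stringOps_append (p : Mode) (u v : List Symbol) :
    stringOps p (u ++ v) = stringOps (u.foldl nextMode p) v ++ stringOps p u := by
  induction u generalizing p with
  | nil => simp [stringOps]
  | cons x u ih => simp [stringOps, ih]

/-- The operations for a sentence. -/
def sentenceOps (S : Sentence) : List Operation :=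
  .start :: stringOps .body (encFormula S.Φ) ++ [.check]

/-! ### The instance of VSC -/

/-- The terms that an operation contributes, for the given tags; the variables are numbered from
the end of the row. -/
def rowTerms (m : Operation) (r : List Tag) : List (ℤ × List ℕ) :=
  m.terms.map fun t => (t.1, (r.map t.2.count).reverse)

/-- The terms that a sequence of operations contributes, the last ones first. -/
def opsTerms : List Operation → List Tag → List (ℤ × List ℕ)
  | [], _ => []
  | m :: ms, r => opsTerms ms (retagRow m (0, true) r) ++ (rowTerms m r).reverse

theorem length_of_mem_opsTerms {ms : List Operation} {r : List Tag} {t : ℤ × List ℕ}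
    (h : t ∈ opsTerms ms r) : t.2.length = r.length := by
  induction ms generalizing r with
  | nil => simp [opsTerms] at h
  | cons m ms ih =>
    simp only [opsTerms, List.mem_append, List.mem_reverse, rowTerms, List.mem_map] at h
    rcases h with h | ⟨s, _, rfl⟩
    · simpa using ih h
    · simp

/-- The initial tags: every operation finds the two new variables that it needs, and there is one
more coordinate than there are variables, the last place of the cursor. -/
def initialRow (S : Sentence) : List Tag :=
  [new₁, new₂, fresh, fresh] ++
    (List.replicate (2 * (stringOps .body (encFormula S.Φ)).length) fresh ++
      (sgn :: List.replicate (S.n + 1) ahead))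

/-- The reduction of the existential theory of the reals to VSC. -/
def toVSC (S : Sentence) : VSCInstance where
  d := (initialRow S).length
  f := (opsTerms (sentenceOps S) (initialRow S)).map (listTerm _)
  θ := 1
  θ_pos := one_pos

theorem encPoly_toVSC (S : Sentence) :
    encPoly (toVSC S).f =
      (opsTerms (sentenceOps S) (initialRow S)).flatMap encListTerm ++ [.semi] := by
  simp only [encPoly, toVSC, List.flatMap_map]
  congr 1
  exact List.flatMap_congr fun t ht => encTerm_listTerm (length_of_mem_opsTerms ht)

/-! ### The machine -/

/-- The instructions of the machine: write a term, update the tags, write the end of the output,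
a separator, the declaration of the variables. -/
inductive Instr
  | term (z : Σ m : Operation, Fin m.terms.length)
  | update (m : Operation)
  | tail
  | semi
  | vars
  deriving Fintype

/-- The instructions for an operation. -/
def opInstrs (m : Operation) : List Instr :=
  (List.finRange m.terms.length).map (fun k => .term ⟨m, k⟩) ++ [.update m]

/-- The machine that computes the reduction. -/
def machine : Sweeper Symbol Instr Tag Symbol Mode (Instr × RetagState) where
  start := .vars
  bottom := opInstrs .check ++ [.semi, .vars]
  read p x := (nextMode p x, (symbolOps p x).flatMap opInstrs,
    match p, x with
    | .vars, .semi => [sgn, ahead]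
    | .vars, _ => [ahead]
    | p, x => List.replicate (2 * (symbolOps p x).length) fresh)
  close := (.tail :: opInstrs .start, [new₁, new₂, fresh, fresh])
  enter a := (a, (0, true))
  sweep q t := match q with
    | (.term z, c) => ((.term z, c), t, encNat ((z.1.terms.get z.2).2.count t))
    | (.update m, c) => ((.update m, (retag m c t).1), (retag m c t).2, [])
    | (.vars, c) => ((.vars, c), t, [.var])
    | q => (q, t, [])
  leave q := match q.1 with
    | .term z => encInt (z.1.terms.get z.2).1
    | .tail => .semi :: encPosRat 1
    | .semi => [.semi]
    | _ => []

theorem exec_tail (I : List Instr) (r : List Tag) (out : List Symbol) :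
    machine.exec (.tail :: I) r out = machine.exec I r (.semi :: encPosRat 1 ++ out) := by
  rw [Sweeper.exec_cons_of_const (e := fun _ => []) fun _ => rfl]
  rw [List.flatMap_eq_nil_iff.mpr fun _ _ => rfl, List.append_nil]
  rfl

theorem exec_semi (I : List Instr) (r : List Tag) (out : List Symbol) :
    machine.exec (.semi :: I) r out = machine.exec I r (.semi :: out) := by
  rw [Sweeper.exec_cons_of_const (e := fun _ => []) fun _ => rfl]
  rw [List.flatMap_eq_nil_iff.mpr fun _ _ => rfl, List.append_nil]
  rfl

theorem exec_vars (I : List Instr) (r : List Tag) (out : List Symbol) :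
    machine.exec (.vars :: I) r out = machine.exec I r (List.replicate r.length .var ++ out) := by
  rw [Sweeper.exec_cons_of_const (e := fun _ => [.var]) fun _ => rfl, ← List.map_eq_flatMap,
    List.map_const', List.length_reverse]
  rfl

theorem exec_term (z : Σ m : Operation, Fin m.terms.length) (I : List Instr) (r : List Tag)
    (out : List Symbol) :
    machine.exec (.term z :: I) r out = machine.exec I r
      (encListTerm
        ((z.1.terms.get z.2).1, (r.map (z.1.terms.get z.2).2.count).reverse) ++ out) := by
  rw [Sweeper.exec_cons_of_const
      (e := fun t => encNat ((z.1.terms.get z.2).2.count t)) fun _ => rfl,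
    encListTerm, ← List.map_reverse, List.flatMap_map]
  rfl

theorem exec_terms (m : Operation) (l : List (Fin m.terms.length)) (I : List Instr) (r : List Tag)
    (out : List Symbol) :
    machine.exec (l.map (fun k => .term ⟨m, k⟩) ++ I) r out = machine.exec I r
      (((l.map m.terms.get).map fun t => (t.1, (r.map t.2.count).reverse)).reverse.flatMap
        encListTerm ++ out) := by
  induction l generalizing out with
  | nil => rfl
  | cons k l ih =>
    rw [List.map_cons, List.cons_append, exec_term, ih]
    simp

theorem rewriteRow_update (m : Operation) (c : RetagState) (r : List Tag) :
    machine.rewriteRow (.update m, c) r = retagRow m c r := by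
  induction r generalizing c with
  | nil => rfl
  | cons t r ih => exact congrArg _ (ih (retag m c t).1)

theorem emit_update (m : Operation) (c : RetagState) (r : List Tag) :
    machine.emit (.update m, c) r = [] := by
  induction r generalizing c with
  | nil => rfl
  | cons t r ih => exact (List.append_nil _).trans (ih (retag m c t).1)

theorem exec_opInstrs (m : Operation) (I : List Instr) (r : List Tag) (out : List Symbol) :
    machine.exec (opInstrs m ++ I) r out = machine.exec I (retagRow m (0, true) r)
      ((rowTerms m r).reverse.flatMap encListTerm ++ out) := by
  have enter_update : machine.enter (.update m) = (.update m, (0, true)) := rfl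
  rw [opInstrs, List.append_assoc, exec_terms, List.map_get_finRange, List.singleton_append,
    Sweeper.exec, enter_update, rewriteRow_update, emit_update]
  rfl

theorem exec_flatMap_opInstrs (ms : List Operation) (I : List Instr) (r : List Tag)
    (out : List Symbol) :
    ∃ r', r'.length = r.length ∧ machine.exec (ms.flatMap opInstrs ++ I) r out =
      machine.exec I r' ((opsTerms ms r).flatMap encListTerm ++ out) := by
  induction ms generalizing r out with
  | nil => exact ⟨r, rfl, rfl⟩
  | cons m ms ih =>
    obtain ⟨r', hr', h⟩ := ih (retagRow m (0, true) r)
      ((rowTerms m r).reverse.flatMap encListTerm ++ out)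
    refine ⟨r', by simpa using hr', ?_⟩
    rw [List.flatMap_cons, List.append_assoc, exec_opInstrs, h]
    simp [opsTerms]

theorem load_of_ne_vars {p : Mode} (hp : p ≠ .vars) (w : List Symbol) (I : List Instr)
    (R : List Tag) :
    machine.load p w I R =
      (.tail :: opInstrs .start ++ (stringOps p w).flatMap opInstrs ++ I,
        [new₁, new₂, fresh, fresh] ++
          (List.replicate (2 * (stringOps p w).length) fresh ++ R)) := by
  induction w generalizing p I R with
  | nil => simp [Sweeper.load, stringOps, machine]
  | cons x w ih =>
    have hp' : nextMode p x ≠ .vars := by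
      cases p <;> cases x <;> simp_all [nextMode]
    have read_eq : machine.read p x = (nextMode p x, (symbolOps p x).flatMap opInstrs,
        List.replicate (2 * (symbolOps p x).length) fresh) := by
      cases p <;> simp_all [machine]
    rw [Sweeper.load, read_eq, ih hp', stringOps]
    simp only [List.flatMap_append, List.append_assoc, List.length_append, Nat.mul_add,
      List.replicate_add]

theorem load_encVars (n : ℕ) (w : List Symbol) (I : List Instr) (R : List Tag) :
    machine.load .vars (encVars n ++ w) I R =
      machine.load .body w I (sgn :: List.replicate (n + 1) ahead ++ R) := by
  induction n generalizing R with
  | zero => rfl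
  | succ n ih =>
    have := ih (ahead :: R)
    rw [List.cons_append, List.append_cons, ← List.replicate_succ', ← List.cons_append] at this
    exact this

theorem loaded_machine (S : Sentence) : machine.loaded S.encode =
    (.tail :: ((sentenceOps S).flatMap opInstrs ++ [.semi, .vars]), initialRow S) := by
  have start_eq : machine.start = .vars := rfl
  have bottom_eq : machine.bottom = opInstrs .check ++ [.semi, .vars] := rfl
  rw [Sweeper.loaded, start_eq, bottom_eq, Sentence.encode, load_encVars,
    load_of_ne_vars (by simp)]
  simp [sentenceOps, initialRow]

theorem run_machine (S : Sentence) : machine.run S.encode = (toVSC S).encode := by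
  rw [Sweeper.run, loaded_machine, exec_tail]
  obtain ⟨r', hr', h⟩ := exec_flatMap_opInstrs (sentenceOps S) [.semi, .vars] (initialRow S)
    (.semi :: encPosRat 1 ++ [])
  rw [h, exec_semi, exec_vars, hr', Sweeper.exec, VSCInstance.encode, encPoly_toVSC]
  simp [encVars, toVSC]

theorem polyTime_toVSC :
    Nonempty (TM2ComputableInPolyTime Sentence.encode VSCInstance.encode toVSC) :=
  machine.polyTime run_machine

/-! ### The polynomial is one minus a sum of squares -/

section Val

variable {T : Type*} [DecidableEq T]

/-- The product of the values of the variables with a given tag. -/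
noncomputable def val (v : List (T × ℝ)) (t : T) : ℝ :=
  (v.map fun p => if p.1 = t then p.2 else 1).prod

theorem val_append (v w : List (T × ℝ)) (t : T) : val (v ++ w) t = val v t * val w t := by
  simp [val]

theorem val_cons (p : T × ℝ) (w : List (T × ℝ)) (t : T) :
    val (p :: w) t = (if p.1 = t then p.2 else 1) * val w t := by
  simp [val]

theorem val_eq_one {v : List (T × ℝ)} {t : T} (h : ∀ p ∈ v, p.1 ≠ t) : val v t = 1 := by
  refine List.prod_eq_one fun a ha => ?_
  obtain ⟨p, hp, rfl⟩ := List.mem_map.1 ha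
  exact if_neg (h p hp)

theorem prod_pow_count (v : List (T × ℝ)) (l : List T) :
    (v.map fun p => p.2 ^ l.count p.1).prod = (l.map (val v)).prod := by
  induction l with
  | nil => simp
  | cons t l ih =>
    rw [List.map_cons, List.prod_cons, ← ih, val, ← List.prod_map_mul]
    congr 1
    refine List.map_congr_left fun p _ => ?_
    rw [List.count_cons]
    by_cases h : p.1 = t
    · simp [h, pow_succ']
    · simp [h, Ne.symm h]

end Val

/-- The update of the tags of a row whose cells also carry the values of the variables. -/
def retagCells (m : Operation) : RetagState → List (Tag × ℝ) → List (Tag × ℝ)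
  | _, [] => []
  | c, (t, a) :: v => ((retag m c t).2, a) :: retagCells m (retag m c t).1 v

theorem map_fst_retagCells (m : Operation) (c : RetagState) (v : List (Tag × ℝ)) :
    (retagCells m c v).map Prod.fst = retagRow m c (v.map Prod.fst) := by
  induction v generalizing c with
  | nil => rfl
  | cons p v ih => simp [retagCells, retagRow, ih]

theorem map_snd_retagCells (m : Operation) (c : RetagState) (v : List (Tag × ℝ)) :
    (retagCells m c v).map Prod.snd = v.map Prod.snd := by
  induction v generalizing c with
  | nil => rfl
  | cons p v ih => simp [retagCells, ih]

/-- The row after a sequence of operations. -/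
def cellsAfter : List Operation → List (Tag × ℝ) → List (Tag × ℝ)
  | [], v => v
  | m :: ms, v => cellsAfter ms (retagCells m (0, true) v)

/-- The values of the polynomials that a sequence of operations equates with zero. -/
noncomputable def residuals : List Operation → List (Tag × ℝ) → List ℝ
  | [], _ => []
  | m :: ms, v => m.residuals (val v) ++ residuals ms (retagCells m (0, true) v)

/-- The equations of a sequence of operations hold. -/
def AllHold : List Operation → List (Tag × ℝ) → Prop
  | [], _ => True
  | m :: ms, v => m.Holds (val v) ∧ AllHold ms (retagCells m (0, true) v)

theorem forall_mem_residuals (ms : List Operation) (v : List (Tag × ℝ)) :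
    (∀ a ∈ residuals ms v, a = 0) ↔ AllHold ms v := by
  induction ms generalizing v with
  | nil => simp [residuals, AllHold]
  | cons m ms ih =>
    rw [residuals, List.forall_mem_append, m.forall_mem_residuals, ih, AllHold]

theorem allHold_append (ms ms' : List Operation) (v : List (Tag × ℝ)) :
    AllHold (ms ++ ms') v ↔ AllHold ms v ∧ AllHold ms' (cellsAfter ms v) := by
  induction ms generalizing v with
  | nil => simp [AllHold, cellsAfter]
  | cons m ms ih => simp [AllHold, cellsAfter, ih, and_assoc]

theorem sum_sq_nonpos_iff (l : List ℝ) : (l.map (· ^ 2)).sum ≤ 0 ↔ ∀ a ∈ l, a = 0 := by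
  have sq_nonneg_of_mem : ∀ b ∈ l.map (· ^ 2), 0 ≤ b :=
    List.forall_mem_map.2 fun a _ => sq_nonneg a
  refine ⟨fun h a ha => ?_, fun h => (List.sum_eq_zero ?_).le⟩
  · have sum_eq_zero := h.antisymm (List.sum_nonneg sq_nonneg_of_mem)
    exact pow_eq_zero_iff two_ne_zero |>.1 <| List.all_zero_of_le_zero_le_of_sum_eq_zero
      sq_nonneg_of_mem sum_eq_zero (List.mem_map_of_mem ha)
  · exact List.forall_mem_map.2 fun a ha => by simp [h a ha]

/-- The value of a term with listed exponents. -/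
noncomputable def listTermVal (y : List ℝ) (t : ℤ × List ℕ) : ℝ :=
  (t.1 : ℝ) * (List.zipWith (· ^ ·) y t.2).prod

theorem eval_map_listTerm {n : ℕ} (x : Fin n → ℝ) {l : List (ℤ × List ℕ)}
    (h : ∀ t ∈ l, t.2.length = n) :
    SumOfMonomials.eval (l.map (listTerm n)) x = (l.map (listTermVal (List.ofFn x))).sum := by
  rw [SumOfMonomials.eval_eq, List.map_map]
  congr 1
  refine List.map_congr_left fun t ht => ?_
  simp only [Function.comp, listTerm, listTermVal, prod_pow_getD (h t ht)]

theorem listTermVal_counts (v : List (Tag × ℝ)) (c : ℤ) (l : List Tag) :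
    listTermVal (v.map Prod.snd).reverse (c, ((v.map Prod.fst).map l.count).reverse) =
      (c : ℝ) * (l.map (val v)).prod := by
  rw [listTermVal, ← prod_pow_count, ← List.reverse_zipWith (by simp), List.prod_reverse,
    List.map_map, List.zipWith_map, List.zipWith_self]
  rfl

theorem sum_rowTerms (m : Operation) (v : List (Tag × ℝ)) :
    ((rowTerms m (v.map Prod.fst)).map (listTermVal (v.map Prod.snd).reverse)).sum =
      m.terms.eval (val v) := by
  rw [rowTerms, List.map_map]
  exact congrArg _ (List.map_congr_left fun t _ => listTermVal_counts v t.1 t.2)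

theorem sum_opsTerms (ms : List Operation) (v : List (Tag × ℝ)) :
    ((opsTerms ms (v.map Prod.fst)).map (listTermVal (v.map Prod.snd).reverse)).sum =
      ms.count .check - ((residuals ms v).map (· ^ 2)).sum := by
  induction ms generalizing v with
  | nil => simp [opsTerms, residuals]
  | cons m ms ih =>
    have sum_rest := ih (retagCells m (0, true) v)
    rw [map_fst_retagCells, map_snd_retagCells] at sum_rest
    rw [opsTerms, List.map_append, List.sum_append, sum_rest, List.map_reverse, List.sum_reverse,
      sum_rowTerms, m.eval_terms, residuals, List.map_append, List.sum_append, List.count_cons]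
    simp only [beq_iff_eq, Nat.cast_add, Nat.cast_ite, Nat.cast_one, Nat.cast_zero]
    ring

/-! ### The rows of an execution -/

/-- The coordinate cells, with the cursor at the given place (counted from one). -/
def coordCells : ℕ → List ℝ → List (Tag × ℝ)
  | _, [] => []
  | 0, x :: l => (ahead, x) :: coordCells 0 l
  | 1, x :: l => (current, x) :: coordCells 0 l
  | k + 2, x :: l => (passed, x) :: coordCells (k + 1) l

/-- The coordinate under the cursor, with the value `1` outside the list. -/
def coordAt (xs : List ℝ) : ℕ → ℝ
  | 0 => 1
  | k + 1 => xs.getD k 1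

/-- The place of the cursor after a movement. -/
def CursorMove.next : CursorMove → ℕ → ℕ
  | .keep, k => k
  | .advance, k => k + 1
  | .clear, _ => 0
  | .reset, _ => 1

theorem retagCells_coordCells_of_passed (m : Operation) (c : Fin 3) (xs : List ℝ) :
    retagCells m (c, false) (coordCells 0 xs) = coordCells 0 xs := by
  induction xs with
  | nil => rfl
  | cons x xs ih => cases h : m.cursorMove <;> simp [coordCells, retagCells, retag, h,
      CursorMove.act, ih]

theorem retagCells_coordCells_reset {m : Operation} (h : m.cursorMove = .reset) (c : Fin 3)
    (k : ℕ) (xs : List ℝ) : retagCells m (c, false) (coordCells k xs) = coordCells 0 xs := by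
  induction xs generalizing k with
  | nil => simp [coordCells, retagCells]
  | cons x xs ih =>
    rcases k with _ | _ | k <;> simp [coordCells, retagCells, retag, h, CursorMove.act, ih]

theorem retagCells_coordCells (m : Operation) (c : Fin 3) (k : ℕ) (xs : List ℝ) :
    retagCells m (c, true) (coordCells k xs) = coordCells (m.cursorMove.next k) xs := by
  induction xs generalizing k with
  | nil => simp [coordCells, retagCells]
  | cons x xs ih =>
    cases h : m.cursorMove with
    | reset =>
      rcases k with _ | _ | k <;>
        simp [coordCells, retagCells, retag, h, CursorMove.act, CursorMove.next,
          retagCells_coordCells_reset h]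
    | _ =>
      rcases k with _ | _ | k <;>
        simp_all [coordCells, retagCells, retag, CursorMove.act, CursorMove.next,
          retagCells_coordCells_of_passed]

theorem val_coordCells_current (k : ℕ) (xs : List ℝ) :
    val (coordCells k xs) current = coordAt xs k := by
  have val_coordCells_zero (xs : List ℝ) : val (coordCells 0 xs) current = 1 := by
    induction xs with
    | nil => rfl
    | cons x xs ih => simp [coordCells, val_cons, ih]
  induction xs generalizing k with
  | nil => cases k <;> rfl
  | cons x xs ih =>
    rcases k with _ | _ | k
    · exact val_coordCells_zero _
    · simp [coordCells, val_cons, val_coordCells_zero, coordAt]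
    · simp [coordCells, val_cons, ih, coordAt]

theorem val_coordCells_of_ne (k : ℕ) (xs : List ℝ) {t : Tag} (h₁ : t ≠ ahead) (h₂ : t ≠ current)
    (h₃ : t ≠ passed) : val (coordCells k xs) t = 1 := by
  induction xs generalizing k with
  | nil => rfl
  | cons x xs ih =>
    rcases k with _ | _ | k <;> simp [coordCells, val_cons, ih, h₁.symm, h₂.symm, h₃.symm]

/-- The cells of the variables used so far: each is dead (`none`) or the content of a register. -/
abbrev UsedCells := List (Option Register × ℝ)

/-- The tag of a variable that has been used. -/
def usedTag (o : Option Register) : Tag := o.elim dead reg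

/-- A row with the values `a`, `b` of the new variables, the values `F` of the fresh ones, the
separating coordinate `s` and the coordinates `xs`, the cursor being at the place `k`. -/
def mkRow (U : UsedCells) (a b : ℝ) (F : List ℝ) (s : ℝ) (k : ℕ) (xs : List ℝ) :
    List (Tag × ℝ) :=
  U.map (Prod.map usedTag id) ++
    ((new₁, a) :: (new₂, b) :: (F.map (Prod.mk fresh) ++ (sgn, s) :: coordCells k xs))

/-- The used cells after an operation. -/
def nextUsed (m : Operation) (U : UsedCells) (a b : ℝ) : UsedCells :=
  U.map (Prod.map (Option.filter (· ∉ m.discarded)) id) ++ [(m.dest₁, a), (m.dest₂, b)]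

theorem retagCells_used (m : Operation) (c : RetagState) (U : UsedCells) (w : List (Tag × ℝ)) :
    retagCells m c (U.map (Prod.map usedTag id) ++ w) =
      (U.map (Prod.map (Option.filter (· ∉ m.discarded)) id)).map (Prod.map usedTag id) ++
        retagCells m c w := by
  induction U with
  | nil => rfl
  | cons p U ih =>
    obtain ⟨_ | r, a⟩ := p
    · simpa [retagCells, retag, usedTag] using ih
    · by_cases h : r ∈ m.discarded <;>
        simpa [retagCells, retag, usedTag, Option.filter_some, h] using ih

theorem retagCells_fresh (m : Operation) (s : Bool) (F : List ℝ) (w : List (Tag × ℝ)) :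
    retagCells m (0, s) (F.map (Prod.mk fresh) ++ w) =
      F.map (Prod.mk fresh) ++ retagCells m (0, s) w := by
  induction F with
  | nil => rfl
  | cons a F ih => simp [retagCells, retag, ih]

theorem retagCells_mkRow (m : Operation) (U : UsedCells) (a b a' b' : ℝ) (F : List ℝ) (s : ℝ)
    (k : ℕ) (xs : List ℝ) :
    retagCells m (0, true) (mkRow U a b (a' :: b' :: F) s k xs) =
      mkRow (nextUsed m U a b) a' b' F s (m.cursorMove.next k) xs := by
  rw [mkRow, retagCells_used]
  simp [retagCells, retag, retagCells_fresh, retagCells_coordCells, mkRow, nextUsed, usedTag]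

/-! ### Register states -/

/-- A state of the straight-line program: the place of the cursor and the values of the
registers. -/
@[ext]
structure State where
  cursor : ℕ
  regs : Register → ℝ

/-- The register values in a list of used cells; discarded registers have the value `1`. -/
noncomputable def regVal (U : UsedCells) (r : Register) : ℝ := val U (some r)

/-- The values of the tags in a state, for the values `a`, `b` of the new variables. Only tags
that occur in the equations of operations matter. -/
def State.tagVal (s : ℝ) (xs : List ℝ) (σ : State) (a b : ℝ) : Tag → ℝ
  | reg r => σ.regs r
  | new₁ => a
  | new₂ => b
  | sgn => s
  | current => coordAt xs σ.cursor
  | _ => 1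

/-- The state after an operation. -/
def State.next (σ : State) (m : Operation) (a b : ℝ) : State where
  cursor := m.cursorMove.next σ.cursor
  regs r := if m.dest₁ = some r then a else if m.dest₂ = some r then b else
    if r ∈ m.discarded then 1 else σ.regs r

theorem val_map_filter (m : Operation) (U : UsedCells) (r : Register) :
    val (U.map (Prod.map (Option.filter (· ∉ m.discarded)) id)) (some r) =
      if r ∈ m.discarded then 1 else val U (some r) := by
  split_ifs with h
  · refine val_eq_one fun p hp => ?_
    obtain ⟨q, _, rfl⟩ := List.mem_map.1 hp
    simp [Option.filter_eq_some_iff, h]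
  · simp only [val, List.map_map]
    congr 1
    refine List.map_congr_left fun p _ => ?_
    simp [Option.filter_eq_some_iff, h]

theorem regVal_nextUsed (m : Operation) (U : UsedCells) (k : ℕ) (a b : ℝ) :
    regVal (nextUsed m U a b) = (State.next ⟨k, regVal U⟩ m a b).regs := by
  funext r
  rw [regVal, nextUsed, val_append, val_map_filter, val_cons, val_cons]
  cases m <;> cases r <;>
    simp [val, State.next, regVal, Operation.dest₁, Operation.dest₂, Operation.discarded]

theorem val_mkRow (U : UsedCells) (a b : ℝ) (F : List ℝ) (s : ℝ) (k : ℕ) (xs : List ℝ) {t : Tag}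
    (h₁ : t ≠ ahead) (h₂ : t ≠ passed) (h₃ : t ≠ dead) (h₄ : t ≠ fresh) :
    val (mkRow U a b F s k xs) t = State.tagVal s xs ⟨k, regVal U⟩ a b t := by
  have val_fresh : val (F.map (Prod.mk fresh)) t = 1 := by
    refine val_eq_one fun p hp => ?_
    obtain ⟨q, _, rfl⟩ := List.mem_map.1 hp
    exact h₄.symm
  have val_used (ht : ∀ r, t ≠ reg r) : val (U.map (Prod.map usedTag id)) t = 1 := by
    refine val_eq_one fun p hp => ?_
    obtain ⟨⟨_ | r, c⟩, _, rfl⟩ := List.mem_map.1 hp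
    · exact h₃.symm
    · exact (ht r).symm
  rw [mkRow, val_append, val_cons, val_cons, val_append, val_cons, val_fresh]
  cases t with
  | reg r =>
    have val_used_reg : val (U.map (Prod.map usedTag id)) (reg r) = regVal U r := by
      simp only [val, regVal, List.map_map]
      congr 1
      refine List.map_congr_left fun p _ => ?_
      obtain ⟨_ | r', c⟩ := p <;> simp [usedTag]
    simp [val_coordCells_of_ne, State.tagVal, val_used_reg]
  | current => simp [val_coordCells_current, State.tagVal, val_used]
  | new₁ | new₂ | sgn => simp [val_coordCells_of_ne, State.tagVal, val_used]
  | _ => contradiction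

theorem ne_of_mem_equations {m : Operation} : ∀ g ∈ m.equations, ∀ p ∈ g, ∀ t ∈ p.2,
    t ≠ ahead ∧ t ≠ passed ∧ t ≠ dead ∧ t ≠ fresh := by
  cases m with
  | exponentBit b => cases b <;> simp [Operation.equations, -Prod.forall]
  | _ => simp [Operation.equations, vanishingTest, -Prod.forall]

theorem holds_mkRow (m : Operation) (U : UsedCells) (a b : ℝ) (F : List ℝ) (s : ℝ) (k : ℕ)
    (xs : List ℝ) :
    m.Holds (val (mkRow U a b F s k xs)) ↔ m.Holds (State.tagVal s xs ⟨k, regVal U⟩ a b) := by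
  refine forall₂_congr fun g hg => ?_
  suffices g.eval (val (mkRow U a b F s k xs)) = g.eval (State.tagVal s xs ⟨k, regVal U⟩ a b) by
    rw [this]
  refine congrArg List.sum (List.map_congr_left fun p hp => ?_)
  congr 2
  refine List.map_congr_left fun t ht => ?_
  obtain ⟨h₁, h₂, h₃, h₄⟩ := ne_of_mem_equations g hg p hp t ht
  exact val_mkRow U a b F s k xs h₁ h₂ h₃ h₄

/-- The operation can lead from the first state to the second one, when the separating coordinate
is `s` and the coordinates are `xs`. -/
def Operation.Step (s : ℝ) (xs : List ℝ) (m : Operation) (σ σ' : State) : Prop :=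
  ∃ a b, m.Holds (σ.tagVal s xs a b) ∧ σ' = σ.next m a b

/-- The operations can lead from the first state to the second one. -/
def Leads (s : ℝ) (xs : List ℝ) : List Operation → State → State → Prop
  | [], σ, σ' => σ' = σ
  | m :: ms, σ, σ' => ∃ σ₁, m.Step s xs σ σ₁ ∧ Leads s xs ms σ₁ σ'

theorem leads_append {s : ℝ} {xs : List ℝ} {ms ms' : List Operation} {σ σ' : State} :
    Leads s xs (ms ++ ms') σ σ' ↔ ∃ σ₁, Leads s xs ms σ σ₁ ∧ Leads s xs ms' σ₁ σ' := by
  induction ms generalizing σ with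
  | nil => simp [Leads]
  | cons m ms ih =>
    simp only [List.cons_append, Leads, ih]
    tauto

theorem leads_of_allHold {ms : List Operation} {U : UsedCells} {a b : ℝ} {F : List ℝ} {s : ℝ}
    {k : ℕ} {xs : List ℝ} (hF : 2 * ms.length ≤ F.length)
    (h : AllHold ms (mkRow U a b F s k xs)) :
    ∃ U' a' b' F' k', Leads s xs ms ⟨k, regVal U⟩ ⟨k', regVal U'⟩ ∧
      cellsAfter ms (mkRow U a b F s k xs) = mkRow U' a' b' F' s k' xs := by
  induction ms generalizing U a b F k with
  | nil => exact ⟨U, a, b, F, k, rfl, rfl⟩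
  | cons m ms ih =>
    match F, hF with
    | [_], hF => simp at hF; omega
    | a₁ :: b₁ :: F₁, hF =>
      rw [AllHold, retagCells_mkRow, holds_mkRow] at h
      obtain ⟨U', a', b', F', k', hleads, hcells⟩ := ih (by simp at hF; omega) h.2
      rw [regVal_nextUsed m U k] at hleads
      exact ⟨U', a', b', F', k', ⟨_, ⟨a, b, h.1, rfl⟩, hleads⟩, by
        rw [cellsAfter, retagCells_mkRow, hcells]⟩

theorem exists_vanishingTest (s : ℝ) (xs : List ℝ) (σ : State) (r : Register) :
    ∃ a b, ∀ g ∈ vanishingTest r, g.eval (σ.tagVal s xs a b) = 0 := by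
  by_cases h : σ.regs r = 0
  · exact ⟨1, 0, by simp [vanishingTest, TagPolynomial.eval, State.tagVal, h]⟩
  · exact ⟨0, (σ.regs r)⁻¹, by simp [vanishingTest, TagPolynomial.eval, State.tagVal, h]⟩

theorem exists_split (s : ℝ) (xs : List ℝ) (σ : State) :
    ∃ a b, Operation.split.Holds (σ.tagVal s xs a b) := by
  rcases le_total 0 (σ.regs poly) with h | h
  · exact ⟨√(σ.regs poly), 0, by
      simp [Operation.Holds, Operation.equations, TagPolynomial.eval, State.tagVal,
        Real.mul_self_sqrt h]⟩
  · exact ⟨0, √(-σ.regs poly), by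
      simp [Operation.Holds, Operation.equations, TagPolynomial.eval, State.tagVal,
        Real.mul_self_sqrt (neg_nonneg.2 h)]⟩

theorem Operation.exists_holds {m : Operation} (hm : m ≠ .check) (s : ℝ) (xs : List ℝ)
    (σ : State) : ∃ a b, m.Holds (σ.tagVal s xs a b) := by
  cases m with
  | check => exact absurd rfl hm
  | testPoly | testPosRoot | testNegRoot => exact exists_vanishingTest s xs σ _
  | split => exact exists_split s xs σ
  | start => exact ⟨0, 0, by simp [Holds, equations, TagPolynomial.eval, State.tagVal]⟩
  | endExponent | endCoefficient =>
    exact ⟨σ.regs mono * σ.regs power, 0, by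
      simp [Holds, equations, TagPolynomial.eval, State.tagVal]⟩
  | exponentBit b =>
    exact ⟨σ.regs power * (σ.regs power * if b then coordAt xs σ.cursor else 1), 0, by
      cases b <;> simp [Holds, equations, TagPolynomial.eval, State.tagVal]⟩
  | coefficientBit b =>
    exact ⟨2 * σ.regs power + if b then 1 else 0, 0, by
      cases b <;> simp [Holds, equations, TagPolynomial.eval, State.tagVal]; ring⟩
  | addTerm b =>
    exact ⟨σ.regs poly + (if b then -1 else 1) * (σ.regs power * σ.regs mono), 0, by
      cases b <;> simp [Holds, equations, TagPolynomial.eval, State.tagVal] <;> ring⟩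
  | push =>
    exact ⟨(σ.regs stack + 2 * σ.regs truth) / 3, 0, by
      simp [Holds, equations, TagPolynomial.eval, State.tagVal]; ring⟩
  | conj =>
    exact ⟨σ.regs truth * σ.regs truth', 0, by
      simp [Holds, equations, TagPolynomial.eval, State.tagVal]⟩
  | negate =>
    exact ⟨1 - σ.regs truth, 0, by
      simp [Holds, equations, TagPolynomial.eval, State.tagVal]; ring⟩
  | save => exact ⟨σ.regs truth, 0, by simp [Holds, equations, TagPolynomial.eval, State.tagVal]⟩
  | peek =>
    exact ⟨2 * σ.regs stack - 1, 0, by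
      simp [Holds, equations, TagPolynomial.eval, State.tagVal]⟩
  | pop =>
    exact ⟨3 * σ.regs stack - 2 * σ.regs truth, 0, by
      simp [Holds, equations, TagPolynomial.eval, State.tagVal]⟩

theorem exists_allHold {ms : List Operation} (hms : Operation.check ∉ ms) (U : UsedCells) {n : ℕ}
    (hn : 2 * ms.length ≤ n) (s : ℝ) (k : ℕ) (xs : List ℝ) :
    ∃ a b F, F.length = n ∧ AllHold ms (mkRow U a b F s k xs) := by
  induction ms generalizing U k n with
  | nil => exact ⟨0, 0, List.replicate n 0, by simp, trivial⟩
  | cons m ms ih =>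
    simp only [List.mem_cons, not_or] at hms
    rw [List.length_cons] at hn
    obtain ⟨a, b, hab⟩ := Operation.exists_holds (Ne.symm hms.1) s xs ⟨k, regVal U⟩
    obtain ⟨a', b', F, hF, h⟩ := ih hms.2 (nextUsed m U a b) (n := n - 2) (by omega)
      (m.cursorMove.next k)
    refine ⟨a, b, a' :: b' :: F, ?_, (holds_mkRow ..).2 hab, ?_⟩
    · rw [List.length_cons, List.length_cons, hF]; omega
    · rwa [retagCells_mkRow]

/-! ### Evaluation of polynomials -/

open Classical in
/-- The truth value of a proposition as a real number. -/
noncomputable def ind (q : Prop) : ℝ := if q then 1 else 0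

/-- A stack of truth values as a real number, with base-`3` digits `0` and `2`. -/
noncomputable def stackVal : List Prop → ℝ
  | [] => 0
  | q :: st => (stackVal st + 2 * ind q) / 3

/-- The state with the values `p`, `m`, `z` of the registers `poly`, `mono`, `power`, the stack
`st` and the truth values `t` and `t'`; the registers for the roots are empty. -/
noncomputable def evalState (k : ℕ) (p m z : ℝ) (st : List Prop) (t t' : Prop) : State where
  cursor := k
  regs
    | poly => p
    | mono => m
    | power => z
    | stack => stackVal st
    | truth => ind t
    | truth' => ind t'
    | posRoot => 1
    | negRoot => 1

section Evaluation

variable {s : ℝ} {xs : List ℝ} {k : ℕ} {p m z : ℝ} {st : List Prop} {t t' : Prop} {σ : State}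

attribute [local simp] Operation.Holds Operation.equations Operation.dest₁ Operation.dest₂
  Operation.discarded TagPolynomial.eval State.tagVal State.next evalState

theorem step_exponentBit {b : Bool}
    (h : (Operation.exponentBit b).Step s xs (evalState k p m z st t t') σ) :
    σ = evalState k p m (z * z * if b then coordAt xs k else 1) st t t' := by
  obtain ⟨a, c, hm, rfl⟩ := h
  have ha : a = z * z * if b then coordAt xs k else 1 := by
    cases b <;> simp at hm <;> simp <;> linarith
  exact State.ext rfl (funext fun r => by cases r <;> simp [ha])

theorem step_endExponent (h : Operation.endExponent.Step s xs (evalState k p m z st t t') σ) :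
    σ = evalState (k + 1) p (m * z) 1 st t t' := by
  obtain ⟨a, c, hm, rfl⟩ := h
  have ha : a = m * z := by
    simp at hm
    linarith
  exact State.ext rfl (funext fun r => by cases r <;> simp [ha])

theorem step_coefficientBit {b : Bool}
    (h : (Operation.coefficientBit b).Step s xs (evalState k p m z st t t') σ) :
    σ = evalState k p m (2 * z + if b then 1 else 0) st t t' := by
  obtain ⟨a, c, hm, rfl⟩ := h
  have ha : a = 2 * z + if b then 1 else 0 := by
    cases b <;> simp at hm <;> simp <;> linarith
  exact State.ext rfl (funext fun r => by cases r <;> simp [ha])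

theorem step_endCoefficient
    (h : Operation.endCoefficient.Step s xs (evalState k p m z st t t') σ) :
    σ = evalState k p (m * z) 0 st t t' := by
  obtain ⟨a, c, hm, rfl⟩ := h
  obtain ⟨hsum, hc⟩ : a + -(m * z) = 0 ∧ c = 0 := by simpa using hm
  have ha : a = m * z := by linarith
  exact State.ext rfl (funext fun r => by cases r <;> simp [ha, hc])

theorem step_addTerm {b : Bool}
    (h : (Operation.addTerm b).Step s xs (evalState k p m z st t t') σ) :
    σ = evalState 1 (p + (if b then -1 else 1) * (z * m)) 1 1 st t t' := by
  obtain ⟨a, c, hm, rfl⟩ := h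
  have ha : a = p + (if b then -1 else 1) * (z * m) := by
    cases b <;> simp at hm <;> simp <;> linarith
  exact State.ext rfl (funext fun r => by cases r <;> simp [ha])

theorem foldl_nextMode_bits {q : Mode} (hq : q ≠ .vars) (l : List Bool) :
    (l.map Symbol.bit).foldl nextMode q = q := by
  induction l with
  | nil => rfl
  | cons b l ih => cases q <;> simp_all [nextMode]

theorem foldl_nextMode_encNat {q : Mode} (hq : q ≠ .vars) (e : ℕ) :
    (encNat e).foldl nextMode q = .body := by
  rw [encNat, List.foldl_append, foldl_nextMode_bits hq]
  cases q <;> simp_all [nextMode]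

theorem foldl_nextMode_flatMap {α : Type*} {f : α → List Symbol} {q : Mode}
    (hf : ∀ a, (f a).foldl nextMode q = q) (l : List α) :
    (l.flatMap f).foldl nextMode q = q := by
  induction l with
  | nil => rfl
  | cons a l ih => rw [List.flatMap_cons, List.foldl_append, hf, ih]

theorem leads_exponentBits (l : List Bool)
    (h : Leads s xs (stringOps .body (l.map .bit)) (evalState k p m 1 st t t') σ) :
    σ = evalState k p m (coordAt xs k ^ l.foldr Nat.bit 0) st t t' := by
  induction l generalizing σ with
  | nil => simpa [stringOps, Leads] using h
  | cons b l ih =>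
    simp only [List.map_cons, stringOps, nextMode, symbolOps, leads_append, Leads] at h
    obtain ⟨_, h₁, _, h₂, rfl⟩ := h
    obtain rfl := ih h₁
    rw [step_exponentBit h₂, List.foldr_cons, Nat.bit_val]
    cases b <;> simp [pow_add, two_mul]

theorem leads_coefficientBits (l : List Bool)
    (h : Leads s xs (stringOps .coef (l.map .bit)) (evalState k p m 0 st t t') σ) :
    σ = evalState k p m (l.foldr Nat.bit 0 : ℕ) st t t' := by
  induction l generalizing σ with
  | nil => simpa [stringOps, Leads] using h
  | cons b l ih =>
    simp only [List.map_cons, stringOps, nextMode, symbolOps, leads_append, Leads] at h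
    obtain ⟨_, h₁, _, h₂, rfl⟩ := h
    obtain rfl := ih h₁
    rw [step_coefficientBit h₂, List.foldr_cons, Nat.bit_val]
    cases b <;> simp

theorem leads_exponent (e : ℕ)
    (h : Leads s xs (stringOps .body (encNat e)) (evalState k p m z st t t') σ) :
    σ = evalState (k + 1) p (m * z) (coordAt xs (k + 1) ^ e) st t t' := by
  rw [encNat, stringOps_append, foldl_nextMode_bits (by simp)] at h
  obtain ⟨_, ⟨_, h₁, rfl⟩, h₂⟩ := leads_append.1 h
  obtain rfl := step_endExponent h₁
  rw [leads_exponentBits _ h₂, foldr_bit_bits]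

theorem leads_coefficient (c : ℕ)
    (h : Leads s xs (stringOps .coef (encNat c)) (evalState k p m z st t t') σ) :
    σ = evalState k p (m * z) c st t t' := by
  rw [encNat, stringOps_append, foldl_nextMode_bits (by simp)] at h
  obtain ⟨_, ⟨_, h₁, rfl⟩, h₂⟩ := leads_append.1 h
  obtain rfl := step_endCoefficient h₁
  rw [leads_coefficientBits _ h₂, foldr_bit_bits]

/- The exponents are read from right to left while the cursor runs from left to right, so the
coordinates are listed in reverse order, behind one coordinate for the initial cursor place `1`. -/
theorem leads_exponents (es : List ℕ) {ys zs : List ℝ} (hl : es.length = ys.length) {x₀ : ℝ}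
    (h : Leads s (x₀ :: (ys.reverse ++ zs)) (stringOps .body (es.flatMap encNat))
      (evalState 1 p m z st t t') σ) :
    ∃ m' z', σ = evalState (es.length + 1) p m' z' st t t' ∧
      m' * z' = m * z * (List.zipWith (· ^ ·) ys es).prod := by
  induction es generalizing ys zs σ with
  | nil => exact ⟨m, z, h, by simp⟩
  | cons e es ih =>
    obtain ⟨y, ys, rfl⟩ := List.exists_cons_of_length_eq_add_one hl.symm
    simp only [List.length_cons, add_left_inj] at hl
    rw [List.flatMap_cons, stringOps_append, foldl_nextMode_encNat (by simp), List.reverse_cons,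
      List.append_assoc, List.singleton_append] at h
    obtain ⟨_, h₁, h₂⟩ := leads_append.1 h
    obtain ⟨m₁, z₁, rfl, hmz⟩ := ih hl h₁
    refine ⟨_, _, leads_exponent e h₂, ?_⟩
    have coordAt_eq : coordAt (x₀ :: (ys.reverse ++ y :: zs)) (es.length + 1 + 1) = y := by
      simp [coordAt, hl]
    rw [List.length_cons, coordAt_eq, hmz, List.zipWith_cons_cons, List.prod_cons]
    ring

variable {n : ℕ} {x : Fin n → ℝ} {x₀ : ℝ}

theorem sign_mul_natAbs (c : ℤ) :
    (if decide (c < 0) then (-1 : ℝ) else 1) * (c.natAbs : ℝ) = c := by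
  rw [Nat.cast_natAbs, Int.cast_abs]
  by_cases h : c < 0
  · have : (c : ℝ) < 0 := by exact_mod_cast h
    simp [h, abs_of_neg this]
  · have : (0 : ℝ) ≤ c := by exact_mod_cast not_lt.1 h
    simp [h, abs_of_nonneg this]

theorem nextMode_sign (b : Bool) :
    nextMode .body (if b then Symbol.minus else Symbol.plus) = .coef := by
  cases b <;> rfl

theorem symbolOps_sign (b : Bool) :
    symbolOps .body (if b then Symbol.minus else Symbol.plus) = [.addTerm b] := by
  cases b <;> rfl

theorem encTerm_eq_cons (u : ℤ × (Fin n → ℕ)) :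
    encTerm u = (if decide (u.1 < 0) then Symbol.minus else Symbol.plus) ::
      (encNat u.1.natAbs ++ (List.ofFn u.2).flatMap encNat) := by
  simp [encTerm, encInt]

theorem foldl_nextMode_encTerm (u : ℤ × (Fin n → ℕ)) :
    (encTerm u).foldl nextMode .body = .body := by
  rw [encTerm_eq_cons, List.foldl_cons, nextMode_sign, List.foldl_append,
    foldl_nextMode_encNat (by simp), foldl_nextMode_flatMap (foldl_nextMode_encNat (by simp))]

theorem leads_term (u : ℤ × (Fin n → ℕ))
    (h : Leads s (x₀ :: (List.ofFn x).reverse) (stringOps .body (encTerm u))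
      (evalState 1 p 1 1 st t t') σ) :
    σ = evalState 1 (p + (u.1 : ℝ) * ∏ i, x i ^ u.2 i) 1 1 st t t' := by
  rw [encTerm_eq_cons, stringOps, nextMode_sign, symbolOps_sign, stringOps_append,
    foldl_nextMode_encNat (by simp)] at h
  simp only [leads_append, Leads] at h
  obtain ⟨_, ⟨_, h₁, h₂⟩, _, h₃, rfl⟩ := h
  obtain ⟨m', z', rfl, hmz⟩ := leads_exponents (List.ofFn u.2) (ys := List.ofFn x) (zs := [])
    (by simp) (by simpa using h₁)
  obtain rfl := leads_coefficient _ h₂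
  have prod_eq : ∏ i, x i ^ u.2 i = m' * z' := by
    rw [hmz, mul_one, one_mul, ← prod_pow_getD (by simp)]
    simp
  rw [step_addTerm h₃, prod_eq, ← sign_mul_natAbs u.1, mul_assoc]

theorem leads_terms (P : SumOfMonomials n)
    (h : Leads s (x₀ :: (List.ofFn x).reverse) (stringOps .body (P.flatMap encTerm))
      (evalState 1 p 1 1 st t t') σ) :
    σ = evalState 1 (p + P.eval x) 1 1 st t t' := by
  induction P generalizing σ with
  | nil => simpa [stringOps, Leads, SumOfMonomials.eval_eq] using h
  | cons u P ih =>
    rw [List.flatMap_cons, stringOps_append, foldl_nextMode_encTerm] at h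
    obtain ⟨_, h₁, h₂⟩ := leads_append.1 h
    obtain rfl := ih h₁
    rw [leads_term u h₂]
    simp only [SumOfMonomials.eval_eq, List.map_cons, List.sum_cons]
    congr 1
    ring

theorem leads_encPoly (P : SumOfMonomials n)
    (h : Leads s (x₀ :: (List.ofFn x).reverse) (stringOps .body (encPoly P))
      (evalState 0 0 1 1 st t t') σ) :
    σ = evalState 1 (P.eval x) 1 1 st t t' := by
  rw [encPoly, stringOps_append, foldl_nextMode_flatMap foldl_nextMode_encTerm] at h
  obtain ⟨_, ⟨_, h₁, rfl⟩, h₂⟩ := leads_append.1 h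
  obtain rfl := step_endExponent h₁
  rw [mul_one] at h₂
  rw [leads_terms P h₂, zero_add]

/-! ### Evaluation of formulas -/

theorem ind_eq_zero_or_one (q : Prop) : ind q = 0 ∨ ind q = 1 := by
  unfold ind; split_ifs <;> simp

theorem ind_not (q : Prop) : ind (¬ q) = 1 - ind q := by
  by_cases h : q <;> simp [ind, h]

theorem ind_and (q r : Prop) : ind (q ∧ r) = ind q * ind r := by
  by_cases h : q <;> by_cases h' : r <;> simp [ind, h, h']

theorem stackVal_mem_Ico (st : List Prop) : stackVal st ∈ Set.Ico 0 1 := by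
  induction st with
  | nil => simp [stackVal]
  | cons q st ih =>
    rw [Set.mem_Ico] at ih ⊢
    rw [stackVal]
    rcases ind_eq_zero_or_one q with h | h <;> rw [h] <;> constructor <;> linarith

theorem two_mul_stackVal_sub_one_nonneg_iff (q : Prop) (st : List Prop) :
    0 ≤ 2 * stackVal (q :: st) - 1 ↔ q := by
  have := stackVal_mem_Ico st
  rw [Set.mem_Ico] at this
  by_cases h : q
  · simp only [stackVal, ind, h, if_true, iff_true]; linarith
  · simp only [stackVal, ind, h, if_false, iff_false, not_le]; linarith

theorem eq_ind_of_vanishingTest {r a b : ℝ} (h₁ : r * a = 0) (h₂ : r * b + (a - 1) = 0) :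
    a = ind (r = 0) := by
  by_cases h : r = 0
  · subst h
    simp only [ind, if_true]
    linarith
  · simpa [ind, h] using h₁

theorem split_iff {y w p : ℝ} (h₁ : y * y - w * w = p) (h₂ : y * w = 0) :
    (w = 0 ↔ 0 ≤ p) ∧ (y = 0 ↔ ¬ 0 < p) := by
  subst h₁
  rcases mul_eq_zero.1 h₂ with rfl | rfl
  · refine ⟨⟨by rintro rfl; simp, fun h => ?_⟩, by simp [mul_self_nonneg]⟩
    have := mul_self_nonneg w
    exact mul_self_eq_zero.1 (by linarith)
  · refine ⟨by simp [mul_self_nonneg], ⟨by rintro rfl; simp, fun h => ?_⟩⟩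
    by_contra hy
    exact h (by simpa using mul_self_pos.2 hy)

theorem step_testPoly (h : Operation.testPoly.Step s xs (evalState k p m z st t t') σ) :
    σ = evalState k 1 m z st (p = 0) t' := by
  obtain ⟨a, c, hm, rfl⟩ := h
  obtain ⟨hmul, hsum⟩ : (p = 0 ∨ a = 0) ∧ p * c + (a + -1) = 0 := by
    simpa [vanishingTest] using hm
  have ha : a = ind (p = 0) := eq_ind_of_vanishingTest (by simpa using hmul) hsum
  exact State.ext rfl (funext fun r => by cases r <;> simp [ha])

theorem leads_testNegRoot
    (h : Leads s xs [.split, .testNegRoot] (evalState k p m z st t t') σ) :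
    σ = evalState k 1 m z st (0 ≤ p) t' := by
  obtain ⟨_, ⟨y, w, hsplit, rfl⟩, _, ⟨a, c, htest, rfl⟩, rfl⟩ := h
  obtain ⟨hdiff, hyw⟩ : y * y + (-(w * w) + -p) = 0 ∧ (y = 0 ∨ w = 0) := by simpa using hsplit
  obtain ⟨hmul, hsum⟩ : (w = 0 ∨ a = 0) ∧ w * c + (a + -1) = 0 := by
    simpa [vanishingTest] using htest
  have hw := (split_iff (y := y) (w := w) (p := p) (by linarith) (by simpa using hyw)).1
  have ha : a = ind (0 ≤ p) := by
    rw [eq_ind_of_vanishingTest (by simpa using hmul) hsum, propext hw]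
  exact State.ext rfl (funext fun r => by cases r <;> simp [ha])

theorem leads_testPosRoot
    (h : Leads s xs [.split, .testPosRoot] (evalState k p m z st t t') σ) :
    σ = evalState k 1 m z st (¬ 0 < p) t' := by
  obtain ⟨_, ⟨y, w, hsplit, rfl⟩, _, ⟨a, c, htest, rfl⟩, rfl⟩ := h
  obtain ⟨hdiff, hyw⟩ : y * y + (-(w * w) + -p) = 0 ∧ (y = 0 ∨ w = 0) := by simpa using hsplit
  obtain ⟨hmul, hsum⟩ : (y = 0 ∨ a = 0) ∧ y * c + (a + -1) = 0 := by
    simpa [vanishingTest] using htest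
  have hy := (split_iff (y := y) (w := w) (p := p) (by linarith) (by simpa using hyw)).2
  have ha : a = ind (¬ 0 < p) := by
    rw [eq_ind_of_vanishingTest (by simpa using hmul) hsum, propext hy]
  exact State.ext rfl (funext fun r => by cases r <;> simp [ha])

theorem step_negate (h : Operation.negate.Step s xs (evalState k p m z st t t') σ) :
    σ = evalState k p m z st (¬ t) t' := by
  obtain ⟨a, c, hm, rfl⟩ := h
  have ha : a = ind (¬ t) := by
    simp at hm
    rw [ind_not]
    linarith
  exact State.ext rfl (funext fun r => by cases r <;> simp [ha])

theorem step_save (h : Operation.save.Step s xs (evalState k p m z st t t') σ) :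
    σ = evalState k p m z st True t := by
  obtain ⟨a, c, hm, rfl⟩ := h
  have ha : a = ind t := by
    simp at hm
    linarith
  exact State.ext rfl (funext fun r => by cases r <;> simp [ha, ind])

theorem step_conj (h : Operation.conj.Step s xs (evalState k p m z st t t') σ) :
    σ = evalState k p m z st (t ∧ t') True := by
  obtain ⟨a, c, hm, rfl⟩ := h
  have ha : a = ind (t ∧ t') := by
    simp at hm
    rw [ind_and]
    linarith
  exact State.ext rfl (funext fun r => by cases r <;> simp [ha, ind])

theorem step_push (h : Operation.push.Step s xs (evalState k p m z st t t') σ) :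
    σ = evalState 0 0 m z (t :: st) True t' := by
  obtain ⟨a, c, hm, rfl⟩ := h
  obtain ⟨hsum, hc⟩ : 3 * a + (-stackVal st + -(2 * ind t)) = 0 ∧ c = 0 := by simpa using hm
  have ha : a = (stackVal st + 2 * ind t) / 3 := by linarith
  exact State.ext rfl (funext fun r => by cases r <;> simp [ha, hc, stackVal, ind])

theorem step_peek (h : Operation.peek.Step s xs (evalState k p m z st t t') σ) :
    σ = evalState k (2 * stackVal st - 1) m z st t t' := by
  obtain ⟨a, c, hm, rfl⟩ := h
  have ha : a = 2 * stackVal st - 1 := by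
    simp at hm
    linarith
  exact State.ext rfl (funext fun r => by cases r <;> simp [ha])

theorem step_pop (h : Operation.pop.Step s xs (evalState k p m z (t :: st) t t') σ) :
    σ = evalState k p m z st t t' := by
  obtain ⟨a, c, hm, rfl⟩ := h
  have ha : a = stackVal st := by
    simp [stackVal] at hm
    linarith
  exact State.ext rfl (funext fun r => by cases r <;> simp [ha])

theorem leads_popTruth {q : Prop}
    (h : Leads s xs popTruth (evalState k p m z (q :: st) t t') σ) :
    σ = evalState k 1 m z st q t' := by
  obtain ⟨_, h₁, h⟩ := h
  obtain ⟨_, h₂, _, h₃, rfl⟩ :=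
    (leads_append (ms := [.split, .testNegRoot]) (ms' := [.pop])).1 h
  obtain rfl := step_peek h₁
  obtain rfl := leads_testNegRoot h₂
  rw [propext (two_mul_stackVal_sub_one_nonneg_iff q st)] at h₃
  exact step_pop h₃

/-- The state between the parts of a formula. -/
noncomputable abbrev stackState (st : List Prop) : State := evalState 0 0 1 1 st True True

theorem leads_comparison (c : Comparison)
    (h : Leads s xs (symbolOps .body c.symbol) (evalState k p 1 1 st True True) σ) :
    σ = stackState (c.Holds p :: st) := by
  cases c with
  | eq =>
    obtain ⟨_, h₁, _, h₂, rfl⟩ := h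
    obtain rfl := step_testPoly h₁
    exact step_push h₂
  | ge =>
    obtain ⟨_, h₁, _, h₂, rfl⟩ :=
      (leads_append (ms := [.split, .testNegRoot]) (ms' := [.push])).1 h
    obtain rfl := leads_testNegRoot h₁
    exact step_push h₂
  | gt =>
    obtain ⟨_, h₁, _, h₂, _, h₃, rfl⟩ :=
      (leads_append (ms := [.split, .testPosRoot]) (ms' := [.negate, .push])).1 h
    obtain rfl := leads_testPosRoot h₁
    obtain rfl := step_negate h₂
    rw [step_push h₃, not_not]
    rfl

variable {q r : Prop}

theorem leads_not (h : Leads s xs (symbolOps .body .not) (stackState (q :: st)) σ) :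
    σ = stackState ((¬ q) :: st) := by
  simp only [symbolOps, leads_append, Leads] at h
  obtain ⟨_, h₁, _, h₂, _, h₃, rfl⟩ := h
  obtain rfl := leads_popTruth h₁
  obtain rfl := step_negate h₂
  exact step_push h₃

theorem leads_and (h : Leads s xs (symbolOps .body .and) (stackState (q :: r :: st)) σ) :
    σ = stackState ((q ∧ r) :: st) := by
  simp only [symbolOps, leads_append, Leads] at h
  obtain ⟨_, h₁, _, ⟨_, h₂, h₃⟩, _, h₄, _, h₅, rfl⟩ := h
  obtain rfl := leads_popTruth h₁
  obtain rfl := step_save h₂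
  obtain rfl := leads_popTruth h₃
  obtain rfl := step_conj h₄
  rw [step_push h₅, and_comm]

theorem leads_or (h : Leads s xs (symbolOps .body .or) (stackState (q :: r :: st)) σ) :
    σ = stackState ((q ∨ r) :: st) := by
  simp only [symbolOps, leads_append, Leads] at h
  obtain ⟨_, h₁, _, ⟨_, h₂, _, h₃, h₄⟩, _, h₅, _, h₆, _, h₇, _, h₈, rfl⟩ := h
  obtain rfl := leads_popTruth h₁
  obtain rfl := step_negate h₂
  obtain rfl := step_save h₃
  obtain rfl := leads_popTruth h₄
  obtain rfl := step_negate h₅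
  obtain rfl := step_conj h₆
  obtain rfl := step_negate h₇
  rw [step_push h₈, and_comm, ← not_or, not_not]

theorem nextMode_comparison (c : Comparison) : nextMode .body c.symbol = .body := by
  cases c <;> rfl

theorem foldl_nextMode_encFormula (φ : QFFormula n) :
    (encFormula φ).foldl nextMode .body = .body := by
  induction φ with
  | atom c P =>
    rw [encFormula, List.foldl_cons, nextMode_comparison, encPoly, List.foldl_append,
      foldl_nextMode_flatMap foldl_nextMode_encTerm]
    rfl
  | not _ ih => exact ih
  | and φ ψ ih₁ ih₂ | or φ ψ ih₁ ih₂ =>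
    rw [encFormula, List.foldl_cons, nextMode, List.foldl_append, ih₁, ih₂] <;> simp

theorem leads_encFormula (φ : QFFormula n)
    (h : Leads s (x₀ :: (List.ofFn x).reverse) (stringOps .body (encFormula φ))
      (stackState st) σ) :
    σ = stackState (φ.Holds x :: st) := by
  induction φ generalizing st σ with
  | atom c P =>
    rw [encFormula, stringOps, nextMode_comparison] at h
    obtain ⟨_, h₁, h₂⟩ := leads_append.1 h
    obtain rfl := leads_encPoly P h₁
    exact leads_comparison c h₂
  | not _ ih =>
    obtain ⟨_, h₁, h₂⟩ := leads_append.1 h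
    obtain rfl := ih h₁
    exact leads_not h₂
  | and φ ψ ihφ ihψ | or φ ψ ihφ ihψ =>
    obtain ⟨_, h, hop⟩ := leads_append.1 h
    rw [nextMode, stringOps_append, foldl_nextMode_encFormula] at h
    · obtain ⟨_, hψ, hφ⟩ := leads_append.1 h
      obtain rfl := ihψ hψ
      obtain rfl := ihφ hφ
      first | exact leads_and hop | exact leads_or hop
    all_goals simp

theorem leads_sentence (S : Sentence) {x : Fin S.n → ℝ}
    (h : Leads s (x₀ :: (List.ofFn x).reverse)
      (.start :: stringOps .body (encFormula S.Φ)) ⟨0, fun _ => 1⟩ σ) :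
    σ = stackState [S.Φ.Holds x] := by
  obtain ⟨_, ⟨a, b, hm, rfl⟩, h⟩ := h
  have hab : a = 0 ∧ b = 0 := by simpa using hm
  have next_start : State.next ⟨0, fun _ => 1⟩ .start a b = stackState [] :=
    State.ext rfl (funext fun r => by cases r <;> simp [hab, stackVal, ind])
  rw [next_start] at h
  exact leads_encFormula S.Φ h

end Evaluation

/-! ### The clusters of the instance -/

theorem check_notMem_stringOps (p : Mode) (w : List Symbol) : .check ∉ stringOps p w := by
  induction w generalizing p with
  | nil => simp [stringOps]
  | cons x w ih =>
    rw [stringOps, List.mem_append, not_or]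
    exact ⟨ih _, by cases p <;> cases x <;> simp [symbolOps, popTruth]⟩

theorem holds_check_iff {ρ : Tag → ℝ} :
    Operation.check.Holds ρ ↔ 3 * ρ (reg stack) - 2 = 0 ∧ ρ sgn ^ 2 = 1 := by
  simp [Operation.Holds, Operation.equations, TagPolynomial.eval, sq, sub_eq_add_neg,
    add_neg_eq_zero]

theorem three_mul_stackVal_singleton (q : Prop) : 3 * stackVal [q] - 2 = 0 ↔ q := by
  by_cases h : q
  · simp only [stackVal, ind, h]
    norm_num
  · simp [stackVal, ind, h]

variable (S : Sentence)

/-- The operations that evaluate a sentence. -/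
def evalOps : List Operation := .start :: stringOps .body (encFormula S.Φ)

variable {S}

theorem count_check_sentenceOps : (sentenceOps S).count .check = 1 := by
  simp [sentenceOps, List.count_eq_zero.2 (check_notMem_stringOps _ _)]

theorem allHold_sentenceOps {a b : ℝ} {F : List ℝ} (hF : F.length = 2 * (evalOps S).length)
    {s x₀ : ℝ} {x : Fin S.n → ℝ} :
    AllHold (sentenceOps S) (mkRow [] a b F s 0 (x₀ :: (List.ofFn x).reverse)) ↔
      AllHold (evalOps S) (mkRow [] a b F s 0 (x₀ :: (List.ofFn x).reverse)) ∧
        S.Φ.Holds x ∧ s ^ 2 = 1 := by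
  rw [show sentenceOps S = evalOps S ++ [.check] from rfl, allHold_append]
  refine and_congr_right fun h => ?_
  obtain ⟨U, a', b', F', k, hleads, hcells⟩ := leads_of_allHold hF.ge h
  have hregs := congrArg State.regs (leads_sentence S hleads)
  rw [hcells, AllHold, holds_mkRow, holds_check_iff, AllHold, and_true]
  have reg_stack : regVal U stack = stackVal [S.Φ.Holds x] := congrFun hregs stack
  rw [← three_mul_stackVal_singleton (S.Φ.Holds x), ← reg_stack]
  rfl

/-- The row `v` lists the coordinates of the point `y`, in reverse order, with their initial
tags. -/
def Represents (v : List (Tag × ℝ)) (y : Fin (toVSC S).d → ℝ) : Prop :=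
  v.map Prod.fst = initialRow S ∧ (v.map Prod.snd).reverse = List.ofFn y

theorem one_le_eval_toVSC_iff {v : List (Tag × ℝ)} {y : Fin (toVSC S).d → ℝ}
    (h : Represents v y) : 1 ≤ (toVSC S).f.eval y ↔ AllHold (sentenceOps S) v := by
  have eval_eq : (toVSC S).f.eval y = 1 - ((residuals (sentenceOps S) v).map (· ^ 2)).sum := by
    refine (eval_map_listTerm y fun t ht => length_of_mem_opsTerms ht).trans ?_
    rw [← h.1, ← h.2, sum_opsTerms, count_check_sentenceOps, Nat.cast_one]
  rw [eval_eq, le_sub_self_iff, sum_sq_nonpos_iff, forall_mem_residuals]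

theorem coordCells_zero (xs : List ℝ) : coordCells 0 xs = xs.map (Prod.mk ahead) := by
  induction xs with
  | nil => rfl
  | cons x xs ih => simp [coordCells, ih]

theorem map_fst_map_mk {α β : Type*} (t : α) (l : List β) :
    (l.map (Prod.mk t)).map Prod.fst = List.replicate l.length t := by
  rw [List.map_map]
  exact List.map_const

theorem map_fst_eq_replicate {α β : Type*} {t : α} {n : ℕ} {w : List (α × β)}
    (h : w.map Prod.fst = List.replicate n t) : ∃ l : List β, l.length = n ∧ w = l.map (.mk t) := by
  refine ⟨w.map Prod.snd, by simpa using congrArg List.length h, ?_⟩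
  rw [List.map_map]
  conv_lhs => rw [← List.map_id w]
  refine List.map_congr_left fun p hp => ?_
  have fst_mem : p.1 ∈ List.replicate n t := h ▸ List.mem_map_of_mem hp
  exact Prod.ext (List.eq_of_mem_replicate fst_mem) rfl

theorem initialRow_eq : initialRow S = new₁ :: new₂ ::
    (List.replicate (2 * (evalOps S).length) fresh ++ sgn :: List.replicate (S.n + 1) ahead) := by
  simp [initialRow, evalOps, Nat.mul_add, List.replicate_succ]

theorem map_fst_mkRow {a b : ℝ} {F : List ℝ} (hF : F.length = 2 * (evalOps S).length) {s x₀ : ℝ}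
    {x : Fin S.n → ℝ} :
    (mkRow [] a b F s 0 (x₀ :: (List.ofFn x).reverse)).map Prod.fst = initialRow S := by
  simp only [mkRow, List.map_nil, List.nil_append, List.map_cons, List.map_append,
    map_fst_map_mk, coordCells_zero, initialRow_eq, hF]
  simp [List.replicate_succ]

theorem exists_eq_mkRow {v : List (Tag × ℝ)} (h : v.map Prod.fst = initialRow S) :
    ∃ a b F s x₀, ∃ x : Fin S.n → ℝ, F.length = 2 * (evalOps S).length ∧
      v = mkRow [] a b F s 0 (x₀ :: (List.ofFn x).reverse) := by
  rw [initialRow_eq] at h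
  obtain ⟨⟨_, a⟩, _, rfl, rfl, hnew⟩ := List.map_eq_cons_iff.1 h
  obtain ⟨⟨_, b⟩, _, rfl, rfl, hrest⟩ := List.map_eq_cons_iff.1 hnew
  obtain ⟨_, _, rfl, hfresh, hsgn⟩ := List.map_eq_append_iff.1 hrest
  obtain ⟨F, hF, rfl⟩ := map_fst_eq_replicate hfresh
  obtain ⟨⟨_, s⟩, _, rfl, rfl, hahead⟩ := List.map_eq_cons_iff.1 hsgn
  obtain ⟨xs, hxs, rfl⟩ := map_fst_eq_replicate hahead
  obtain ⟨x₀, xs, rfl⟩ := List.exists_cons_of_length_eq_add_one hxs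
  have length_reverse : xs.reverse.length = S.n := by simpa using hxs
  refine ⟨a, b, F, s, x₀, fun j => xs.reverse.getD j 0, hF, ?_⟩
  rw [ofFn_getD length_reverse, List.reverse_reverse, mkRow, coordCells_zero]
  rfl

variable (S)

/-- The index of the separating coordinate. -/
def sgnIndex : Fin (toVSC S).d :=
  ⟨S.n + 1, by
    simp only [toVSC, initialRow, List.length_append, List.length_cons, List.length_replicate]
    omega⟩

variable {S}

theorem apply_sgnIndex {y : Fin (toVSC S).d → ℝ} {a b : ℝ} {F : List ℝ} {s x₀ : ℝ}
    {x : Fin S.n → ℝ} (h : Represents (mkRow [] a b F s 0 (x₀ :: (List.ofFn x).reverse)) y) :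
    y (sgnIndex S) = s := by
  have getElem?_ofFn : (List.ofFn y)[S.n + 1]? = some (y (sgnIndex S)) := by
    rw [List.getElem?_eq_getElem (by rw [List.length_ofFn]; exact (sgnIndex S).2),
      List.getElem_ofFn]
    rfl
  rw [← h.2, mkRow, coordCells_zero] at getElem?_ofFn
  simpa using getElem?_ofFn.symm

theorem exists_one_le_eval_toVSC {x : Fin S.n → ℝ} (hx : S.Φ.Holds x) {s : ℝ} (hs : s ^ 2 = 1) :
    ∃ y : Fin (toVSC S).d → ℝ, 1 ≤ (toVSC S).f.eval y ∧ y (sgnIndex S) = s := by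
  have check_notMem : .check ∉ evalOps S := by simp [evalOps, check_notMem_stringOps]
  obtain ⟨a, b, F, hF, h⟩ :=
    exists_allHold check_notMem [] le_rfl s 0 (0 :: (List.ofFn x).reverse)
  have length_eq :
      ((mkRow [] a b F s 0 (0 :: (List.ofFn x).reverse)).map Prod.snd).reverse.length =
        (toVSC S).d := by
    rw [List.length_reverse, List.length_map, ← List.length_map Prod.fst, map_fst_mkRow hF]
    rfl
  have hy : Represents (mkRow [] a b F s 0 (0 :: (List.ofFn x).reverse)) _ :=
    ⟨map_fst_mkRow hF, (ofFn_getD length_eq 0).symm⟩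
  exact ⟨_, (one_le_eval_toVSC_iff hy).2 ((allHold_sentenceOps hF).2 ⟨h, hx, hs⟩),
    apply_sgnIndex hy⟩

theorem isTrue_of_one_le_eval_toVSC {y : Fin (toVSC S).d → ℝ} (h : 1 ≤ (toVSC S).f.eval y) :
    S.IsTrue ∧ y (sgnIndex S) ^ 2 = 1 := by
  have length_eq : (initialRow S).length = (List.ofFn y).reverse.length := by
    rw [List.length_reverse, List.length_ofFn]
    rfl
  have hy : Represents ((initialRow S).zip (List.ofFn y).reverse) y :=
    ⟨List.map_fst_zip length_eq.le, by rw [List.map_snd_zip length_eq.ge, List.reverse_reverse]⟩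
  obtain ⟨a, b, F, s, x₀, x, hF, hv⟩ := exists_eq_mkRow hy.1
  rw [hv] at hy
  obtain ⟨-, hx, hs⟩ := (allHold_sentenceOps hF).1 ((one_le_eval_toVSC_iff hy).1 h)
  exact ⟨⟨x, hx⟩, by rwa [apply_sgnIndex hy]⟩

theorem toVSC_correct (S : Sentence) : S.IsTrue ↔ (toVSC S).HasValley := by
  have cast_θ : ((toVSC S).θ : ℝ) = 1 := by simp [toVSC]
  rw [VSCInstance.HasValley, cast_θ]
  constructor
  · rintro ⟨x, hx⟩
    obtain ⟨p, hp, hps⟩ := exists_one_le_eval_toVSC hx (s := 1) (by norm_num)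
    obtain ⟨q, hq, hqs⟩ := exists_one_le_eval_toVSC hx (s := -1) (by norm_num)
    refine ⟨p, q, hp, hq, lt_of_not_ge fun h => ?_⟩
    have sq_eq_one := (isTrue_of_one_le_eval_toVSC h).2
    simp [hps, hqs] at sq_eq_one
  · rintro ⟨p, -, hp, -, -⟩
    exact (isTrue_of_one_le_eval_toVSC hp).1

end Hardness

namespace Membership

/-! ### Membership: the sentence -/

/-- The copy number `κ` of the variable `i`: the first two copies are the coordinates of the two
points, the third one those of their midpoint. Variable `0` is left for the threshold. -/
def copyVar {d : ℕ} (i : Fin d) (κ : Fin 3) : Fin (d * 3 + 1) := (finProdFinEquiv (i, κ)).succ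

/-- A term `t`, written in the variables of the copy number `κ`. -/
def copyTerm {d : ℕ} (κ : Fin 3) (t : ℤ × (Fin d → ℕ)) : ℤ × (Fin (d * 3 + 1) → ℕ) :=
  (t.1, Matrix.vecCons 0 fun j =>
    if (finProdFinEquiv.symm j).2 = κ then t.2 (finProdFinEquiv.symm j).1 else 0)

/-- The multiple `c` of the variable for the threshold. -/
def thresholdTerm (d : ℕ) (c : ℤ) : ℤ × (Fin (d * 3 + 1) → ℕ) := (c, Matrix.vecCons 1 0)

theorem eval_map_copyTerm {d : ℕ} (κ : Fin 3) (P : SumOfMonomials d)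
    (y : Fin (d * 3 + 1) → ℝ) :
    SumOfMonomials.eval (P.map (copyTerm κ)) y = P.eval fun i => y (copyVar i κ) := by
  have prod_copyTerm (t : ℤ × (Fin d → ℕ)) :
      ∏ j, y j ^ (copyTerm κ t).2 j = ∏ i, y (copyVar i κ) ^ t.2 i := by
    rw [Fin.prod_univ_succ, ← finProdFinEquiv.prod_comp, Fintype.prod_prod_type]
    simp [copyTerm, copyVar, -finProdFinEquiv_symm_apply, pow_ite]
  simp only [SumOfMonomials.eval_eq, List.map_map, Function.comp_def, prod_copyTerm]
  rfl

theorem eval_thresholdTerm {d : ℕ} (c : ℤ) (y : Fin (d * 3 + 1) → ℝ) :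
    SumOfMonomials.eval [thresholdTerm d c] y = c * y 0 := by
  simp [SumOfMonomials.eval_eq, thresholdTerm, Fin.prod_univ_succ]

/-- The coefficients of the copies of a variable in the equation that defines the midpoint. -/
def midpointCoeff : Fin 3 → ℤ := ![1, 1, -2]

/-- A term of the equation that defines the midpoint. -/
def midpointTerm {d : ℕ} (i : Fin d) (κ : Fin 3) : ℤ × (Fin (d * 3 + 1) → ℕ) :=
  copyTerm κ (midpointCoeff κ, Pi.single i 1)

theorem eval_midpointTerm {d : ℕ} (i : Fin d) (κ : Fin 3) (y : Fin (d * 3 + 1) → ℝ) :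
    SumOfMonomials.eval [midpointTerm i κ] y = midpointCoeff κ * y (copyVar i κ) := by
  have h := eval_map_copyTerm κ [(midpointCoeff κ, Pi.single i 1)] y
  rw [List.map_singleton] at h
  simp [midpointTerm, h, SumOfMonomials.eval_eq, Pi.single_apply, pow_ite]

/-- The polynomial `pᵢ + qᵢ - 2 mᵢ`. -/
def midpointPoly {d : ℕ} (i : Fin d) : SumOfMonomials (d * 3 + 1) :=
  [midpointTerm i 0] ++ [midpointTerm i 1] ++ [midpointTerm i 2]

theorem eval_midpointPoly {d : ℕ} (i : Fin d) (y : Fin (d * 3 + 1) → ℝ) :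
    (midpointPoly i).eval y = y (copyVar i 0) + y (copyVar i 1) - 2 * y (copyVar i 2) := by
  simp only [midpointPoly, SumOfMonomials.eval_append, eval_midpointTerm, midpointCoeff]
  simp
  ring

variable (I : VSCInstance)

/-- The polynomial that vanishes when the variable for the threshold has the value `θ`. -/
def thresholdPoly : SumOfMonomials (I.d * 3 + 1) :=
  [thresholdTerm I.d I.θ.den] ++ [copyTerm 0 (-I.θ.num.natAbs, 0)]

/-- The formula `f ≥ θ` for the copy number `κ` of the variables. -/
def aboveThreshold (κ : Fin 3) : QFFormula (I.d * 3 + 1) :=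
  .atom .ge (I.f.map (copyTerm κ) ++ [thresholdTerm I.d (-1)])

/-- The formula that places the copies with respect to the threshold. -/
def valley : QFFormula (I.d * 3 + 1) :=
  .and (.atom .eq (thresholdPoly I))
    (.and (aboveThreshold I 0) (.and (aboveThreshold I 1) (.not (aboveThreshold I 2))))

/-- The conjunction of `φ` and the equations of the midpoint for the given variables. -/
def withMidpoint {d : ℕ} (φ : QFFormula (d * 3 + 1)) (l : List (Fin d)) :
    QFFormula (d * 3 + 1) :=
  l.foldr (fun i ψ => .and (.atom .eq (midpointPoly i)) ψ) φ

/-- The reduction of VSC to the existential theory of the reals. -/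
def toETR : Sentence := ⟨I.d * 3 + 1, withMidpoint (valley I) (List.finRange I.d)⟩

theorem holds_withMidpoint {d : ℕ} (φ : QFFormula (d * 3 + 1)) (l : List (Fin d))
    (y : Fin (d * 3 + 1) → ℝ) :
    (withMidpoint φ l).Holds y ↔
      (∀ i ∈ l, y (copyVar i 2) = (y (copyVar i 0) + y (copyVar i 1)) / 2) ∧ φ.Holds y := by
  induction l with
  | nil => simp [withMidpoint]
  | cons i l ih =>
    have holds_midpointPoly : Comparison.eq.Holds ((midpointPoly i).eval y) ↔
        y (copyVar i 2) = (y (copyVar i 0) + y (copyVar i 1)) / 2 := by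
      rw [Comparison.Holds, eval_midpointPoly, sub_eq_zero, eq_div_iff two_ne_zero, eq_comm,
        mul_comm]
    rw [List.forall_mem_cons, and_assoc, ← ih, ← holds_midpointPoly]
    rfl

variable {I} in
theorem holds_thresholdPoly {y : Fin (I.d * 3 + 1) → ℝ} :
    (thresholdPoly I).eval y = 0 ↔ y 0 = I.θ := by
  have hnum : (I.θ.num.natAbs : ℝ) = I.θ * I.θ.den := by
    rw [Nat.cast_natAbs, abs_of_pos (Rat.num_pos.2 I.θ_pos)]
    exact_mod_cast (Rat.mul_den_eq_num I.θ).symm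
  have hden : (I.θ.den : ℝ) ≠ 0 := by exact_mod_cast I.θ.den_ne_zero
  have eval_const := eval_map_copyTerm 0 [(-(I.θ.num.natAbs : ℤ), 0)] y
  rw [List.map_singleton] at eval_const
  rw [thresholdPoly, SumOfMonomials.eval_append, eval_thresholdTerm, eval_const,
    SumOfMonomials.eval_eq]
  simp only [List.map_singleton, List.sum_singleton, Pi.zero_apply, pow_zero,
    Finset.prod_const_one, mul_one, Int.cast_neg, Int.cast_natCast, hnum]
  rw [← sub_eq_add_neg, sub_eq_zero, mul_comm, mul_left_inj' hden]

variable {I} in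
theorem holds_aboveThreshold {κ : Fin 3} {y : Fin (I.d * 3 + 1) → ℝ} :
    (aboveThreshold I κ).Holds y ↔ y 0 ≤ I.f.eval fun i => y (copyVar i κ) := by
  rw [aboveThreshold, QFFormula.Holds, Comparison.Holds, SumOfMonomials.eval_append,
    eval_map_copyTerm, eval_thresholdTerm]
  simp

variable {I} in
theorem holds_toETR {y : Fin (I.d * 3 + 1) → ℝ} :
    (toETR I).Φ.Holds y ↔
      (∀ i, y (copyVar i 2) = (y (copyVar i 0) + y (copyVar i 1)) / 2) ∧ y 0 = I.θ ∧
        y 0 ≤ I.f.eval (fun i => y (copyVar i 0)) ∧ y 0 ≤ I.f.eval (fun i => y (copyVar i 1)) ∧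
          I.f.eval (fun i => y (copyVar i 2)) < y 0 := by
  rw [← not_le, ← holds_thresholdPoly]
  simp only [← holds_aboveThreshold]
  refine (holds_withMidpoint ..).trans ?_
  simp only [List.mem_finRange, true_imp_iff]
  rfl

theorem toETR_correct : I.HasValley ↔ (toETR I).IsTrue := by
  constructor
  · rintro ⟨p, q, hp, hq, hm⟩
    let points : Fin 3 → Fin I.d → ℝ := ![p, q, (1 / 2 : ℝ) • (p + q)]
    let y : Fin (I.d * 3 + 1) → ℝ := Matrix.vecCons I.θ fun j =>
      points (finProdFinEquiv.symm j).2 (finProdFinEquiv.symm j).1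
    have y_copyVar (i : Fin I.d) (κ : Fin 3) : y (copyVar i κ) = points κ i := by
      simp [y, copyVar, -finProdFinEquiv_symm_apply]
    refine ⟨y, holds_toETR.2 ?_⟩
    simp only [y_copyVar]
    refine ⟨fun i => ?_, rfl, hp, hq, hm⟩
    simp only [points, Matrix.cons_val, Pi.smul_apply, Pi.add_apply, smul_eq_mul]
    ring
  · rintro ⟨y, hy⟩
    obtain ⟨hmid, hθ, hp, hq, hm⟩ := holds_toETR.1 hy
    refine ⟨fun i => y (copyVar i 0), fun i => y (copyVar i 1), hθ ▸ hp, hθ ▸ hq, ?_⟩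
    convert hθ ▸ hm using 2
    funext i
    simp only [hmid i, Pi.smul_apply, Pi.add_apply, smul_eq_mul]
    ring

/-! ### Membership: the encoding of the sentence -/

theorem encNat_zero : encNat 0 = [.semi] := rfl

/-- The exponents of the three copies of a variable, in binary, if the copy number `κ` has the
exponent `e` and the other ones do not occur. -/
def exponentBlock (κ : Fin 3) (e : ℕ) : List Symbol :=
  List.replicate κ .semi ++ (encNat e ++ List.replicate (2 - κ) .semi)

theorem exponentBlock_zero (κ : Fin 3) : exponentBlock κ 0 = List.replicate 3 .semi := by
  fin_cases κ <;> rfl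

theorem flatMap_encNat_ofFn_ite (κ : Fin 3) (e : ℕ) :
    (List.ofFn fun κ' : Fin 3 => if κ' = κ then e else 0).flatMap encNat =
      exponentBlock κ e := by
  fin_cases κ <;> simp [List.ofFn_succ, exponentBlock, encNat_zero]

theorem encTerm_copyTerm {d : ℕ} (κ : Fin 3) (t : ℤ × (Fin d → ℕ)) :
    encTerm (copyTerm κ t) =
      encInt t.1 ++ (encNat 0 ++ (List.ofFn t.2).flatMap (exponentBlock κ)) := by
  have symm_mk (i : Fin d) (κ' : Fin 3) (h) :
      finProdFinEquiv.symm (⟨i * 3 + κ', h⟩ : Fin (d * 3)) = (i, κ') := by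
    rw [Equiv.symm_apply_eq]
    ext
    simp [finProdFinEquiv, mul_comm, add_comm]
  rw [encTerm, copyTerm, List.ofFn_succ, List.flatMap_cons]
  simp only [Matrix.cons_val_zero, Matrix.cons_val_succ]
  rw [List.ofFn_mul, List.flatMap_def, List.map_flatten, List.flatten_flatten]
  simp only [List.map_ofFn, Function.comp_def, symm_mk, ← flatMap_encNat_ofFn_ite, List.flatMap_def]

theorem encTerm_thresholdTerm (d : ℕ) (c : ℤ) :
    encTerm (thresholdTerm d c) =
      encInt c ++ (encNat 1 ++ List.replicate (d * 3) .semi) := by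
  rw [encTerm, thresholdTerm, List.ofFn_succ, List.flatMap_cons]
  simp only [Matrix.cons_val_zero, Matrix.cons_val_succ, Pi.zero_apply, List.ofFn_const,
    List.flatMap_replicate, encNat_zero, List.flatten_replicate_singleton]

theorem encFormula_withMidpoint {d : ℕ} (φ : QFFormula (d * 3 + 1)) (l : List (Fin d)) :
    encFormula (withMidpoint φ l) =
      l.flatMap (fun i => .and :: encFormula (.atom .eq (midpointPoly i))) ++ encFormula φ := by
  induction l with
  | nil => rfl
  | cons i l ih =>
    rw [List.flatMap_cons, List.append_assoc, ← ih]
    rfl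

/-! ### Membership: the machine -/

open Hardness (Mode nextMode foldl_nextMode_bits foldl_nextMode_encNat foldl_nextMode_flatMap
  nextMode_sign encTerm_eq_cons foldl_nextMode_encTerm)

/-- The position of a variable of the instance with respect to a cursor. -/
inductive Mark
  | ahead
  | current
  | passed
  deriving DecidableEq

instance : Fintype Mark := ⟨{.ahead, .current, .passed}, fun m => by cases m <;> simp⟩

/-- The cells of the row: a variable of the instance, with its mark, or any other symbol of the
input, with the mode in which it was read. -/
inductive Cell
  | var (m : Mark)
  | symbol (p : Mode) (x : Symbol)
  deriving Fintype

/-- What a sweep that does not move the cursor writes: a symbol, the declaration of the copies of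
the variables, zero exponents for all copies, the exponents of the copy number `κ` of the current
variable, the denominator or the numerator of the threshold, or the copy number `κ` of the terms
of the polynomial. -/
inductive Writing
  | symbol (x : Symbol)
  | declare
  | zeros
  | unit (κ : Fin 3)
  | denominator
  | numerator
  | copy (κ : Fin 3)
  deriving Fintype

/-- The instructions of the machine: move the cursor to the preceding variable, or write. -/
inductive Instr
  | advance
  | write (w : Writing)
  deriving Fintype

/-- The part of the input that a sweep, from right to left, has reached. -/
inductive Place
  | start
  | denominator
  | numerator
  | terms
  | exponents
  deriving DecidableEq

instance : Fintype Place :=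
  ⟨{.start, .denominator, .numerator, .terms, .exponents}, fun c => by cases c <;> simp⟩

/-- The place after a cell. -/
def nextPlace : Place → Cell → Place
  | _, .symbol .coef .semi => .terms
  | .start, .symbol .body .semi => .denominator
  | .denominator, .symbol .body .semi => .numerator
  | .numerator, .symbol .body .semi => .terms
  | _, .symbol .body .semi => .exponents
  | c, _ => c

/-- The zero exponents that are still due to the left of an exponent of the copy number `κ`. -/
def padding (κ : Fin 3) : Place → List Symbol
  | .exponents => List.replicate κ .semi
  | _ => []

namespace Writing

/-- The symbols written when a sweep passes a cell. -/
def output : Writing → Place → Cell → List Symbol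
  | declare, _, .var _ => List.replicate 3 .var
  | zeros, _, .var _ => List.replicate 3 .semi
  | unit κ, _, .var .current => exponentBlock κ 1
  | unit κ, _, .var _ => exponentBlock κ 0
  | denominator, .start, .symbol .body .semi => [.semi]
  | denominator, .denominator, .symbol .body (.bit b) => [.bit b]
  | numerator, .denominator, .symbol .body .semi => [.semi]
  | numerator, .numerator, .symbol .body (.bit b) => [.bit b]
  | copy κ, c, .symbol .coef .semi => .semi :: (encNat 0 ++ padding κ c)
  | copy _, _, .symbol .coef x => [x]
  | copy κ, .terms, .symbol .body .semi => .semi :: List.replicate (2 - κ) .semi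
  | copy κ, .exponents, .symbol .body .semi =>
    .semi :: (List.replicate (2 - κ) .semi ++ padding κ .exponents)
  | copy _, .terms, .symbol .body x => [x]
  | copy _, .exponents, .symbol .body x => [x]
  | _, _, _ => []

/-- The symbols written at the end of a sweep. -/
def leave : Writing → List Symbol
  | symbol x => [x]
  | _ => []

end Writing

/-- The writings of a string. -/
def text (s : List Symbol) : List Writing := s.map .symbol

/-- The writings of the multiple `c` of the variable for the threshold. -/
def thresholdWritings (c : ℤ) : List Writing := text (encInt c ++ encNat 1) ++ [.zeros]

/-- The writings of `f - t` for the copy number `κ` of the variables. -/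
def copyWritings (κ : Fin 3) : List Writing :=
  .copy κ :: (thresholdWritings (-1) ++ text [.semi])

/-- The writings of the part of the formula that places the copies. -/
def valleyWritings : List Writing :=
  text [.and, .eq, .plus] ++ [.denominator] ++ text (encNat 1) ++ [.zeros] ++
    text [.minus] ++ [.numerator] ++ text (encNat 0) ++ [.zeros] ++
      text [.semi, .and, .ge] ++ copyWritings 0 ++
        text [.and, .ge] ++ copyWritings 1 ++ text [.not, .ge] ++ copyWritings 2

/-- The writings of a term of the midpoint equation of the current variable. -/
def midpointTermWritings (κ : Fin 3) : List Writing :=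
  text (encInt (midpointCoeff κ) ++ encNat 0) ++ [.unit κ]

/-- The writings of the midpoint equation of the current variable. -/
def midpointWritings : List Writing :=
  text [.and, .eq] ++ midpointTermWritings 0 ++ midpointTermWritings 1 ++
    midpointTermWritings 2 ++ text [.semi]

/-- The instructions for a list of writings. The output is written from right to left. -/
def writeInstrs (ws : List Writing) : List Instr := (ws.map .write).reverse

/-- The instructions for a symbol: a midpoint equation for every variable. -/
def symbolInstrs : Mode → Symbol → List Instr
  | .vars, .var => .advance :: writeInstrs midpointWritings
  | _, _ => []

/-- The cell for a symbol. -/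
def symbolCell : Mode → Symbol → Cell
  | .vars, .var => .var .ahead
  | p, x => .symbol p x

/-- The control of the sweeps. When the cursor moves, the Boolean tells whether its new place has
been found. -/
inductive Control
  | advance (found : Bool)
  | write (w : Writing) (c : Place)
  deriving Fintype

/-- The transitions of the sweeps. -/
def sweep : Control → Cell → Control × Cell × List Symbol
  | .advance false, .var .ahead => (.advance true, .var .current, [])
  | .advance false, .var _ => (.advance false, .var .passed, [])
  | .advance found, b => (.advance found, b, [])
  | .write w c, b => (.write w (nextPlace c b), b, w.output c b)

/-- The machine that computes the reduction. -/
def machine : Sweeper Symbol Instr Cell Symbol Mode Control where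
  start := .vars
  bottom := writeInstrs (.declare :: text [.var, .semi])
  read p x := (nextMode p x, symbolInstrs p x, [symbolCell p x])
  close := (writeInstrs valleyWritings, [])
  enter
    | .advance => .advance false
    | .write w => .write w .start
  sweep := sweep
  leave
    | .advance _ => []
    | .write w _ => w.leave

/-! ### Membership: the sweeps -/

/-- The place after the cells of a list have been passed, from right to left. -/
def lastPlace (c : Place) (l : List Cell) : Place := l.foldr (fun b c => nextPlace c b) c

theorem lastPlace_append (c : Place) (l l' : List Cell) :
    lastPlace c (l ++ l') = lastPlace (lastPlace c l') l := List.foldr_append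

namespace Writing

/-- The symbols written while the cells of a list are passed, from right to left. -/
def outputs (w : Writing) (c : Place) : List Cell → List Symbol
  | [] => []
  | b :: l => w.output (lastPlace c l) b ++ outputs w c l

theorem outputs_append (w : Writing) (c : Place) (l l' : List Cell) :
    w.outputs c (l ++ l') = w.outputs (lastPlace c l') l ++ w.outputs c l' := by
  induction l with
  | nil => rfl
  | cons b l ih => simp [outputs, ih, lastPlace]

theorem outputs_eq_nil {w : Writing} {p : Place → Prop} {c : Place} {l : List Cell}
    (h : ∀ b ∈ l, ∀ c, p c → p (nextPlace c b) ∧ w.output c b = []) (hc : p c) :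
    p (lastPlace c l) ∧ w.outputs c l = [] := by
  induction l with
  | nil => exact ⟨hc, rfl⟩
  | cons b l ih =>
    obtain ⟨hp, hl⟩ := ih fun b' hb' => h b' (List.mem_cons_of_mem _ hb')
    obtain ⟨hp', hb⟩ := h b List.mem_cons_self _ hp
    exact ⟨hp', by rw [outputs, hb, hl, List.append_nil]⟩

theorem emit_write (w : Writing) (c : Place) (l : List Cell) :
    machine.emit (.write w c) l.reverse = w.leave ++ w.outputs c l := by
  induction l using List.reverseRecOn generalizing c with
  | nil => simp [Sweeper.emit, machine, outputs]
  | append_singleton l b ih =>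
    rw [List.reverse_concat, Sweeper.emit, outputs_append]
    have := ih (nextPlace c b)
    simp only [machine, sweep, outputs, lastPlace, List.foldr, List.append_nil] at this ⊢
    rw [this, List.append_assoc]

end Writing

theorem rewriteRow_write (w : Writing) (c : Place) (r : List Cell) :
    machine.rewriteRow (.write w c) r = r := by
  induction r generalizing c with
  | nil => rfl
  | cons b r ih =>
    rw [Sweeper.rewriteRow]
    exact congrArg (b :: ·) (ih _)

/-- The output of a list of writings. -/
def written (ws : List Writing) (l : List Cell) : List Symbol :=
  ws.flatMap fun w => w.leave ++ w.outputs .start l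

theorem exec_writeInstrs (ws : List Writing) (J : List Instr) (l : List Cell)
    (out : List Symbol) :
    machine.exec (writeInstrs ws ++ J) l.reverse out =
      machine.exec J l.reverse (written ws l ++ out) := by
  induction ws generalizing J out with
  | nil => rfl
  | cons w ws ih =>
    have : writeInstrs (w :: ws) ++ J = writeInstrs ws ++ .write w :: J := by simp [writeInstrs]
    rw [this, ih, Sweeper.exec]
    change machine.exec J (machine.rewriteRow (.write w .start) _)
      (machine.emit (.write w .start) _ ++ _) = _
    rw [rewriteRow_write, w.emit_write, ← List.append_assoc]
    rfl

/-- The cells for a string. -/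
def cellsOf : Mode → List Symbol → List Cell
  | _, [] => []
  | p, x :: s => symbolCell p x :: cellsOf (nextMode p x) s

theorem cellsOf_append (p : Mode) (u v : List Symbol) :
    cellsOf p (u ++ v) = cellsOf p u ++ cellsOf (u.foldl nextMode p) v := by
  induction u generalizing p with
  | nil => rfl
  | cons x u ih => simp [cellsOf, ih]

theorem cellsOf_bits {p : Mode} (hp : p ≠ .vars) (l : List Bool) :
    cellsOf p (l.map Symbol.bit) = l.map fun b => .symbol p (.bit b) := by
  induction l with
  | nil => rfl
  | cons b l ih => cases p <;> simp_all [cellsOf, nextMode, symbolCell]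

theorem cellsOf_encNat {p : Mode} (hp : p ≠ .vars) (e : ℕ) :
    cellsOf p (encNat e) = e.bits.map (fun b => .symbol p (.bit b)) ++ [.symbol p .semi] := by
  rw [encNat, cellsOf_append, cellsOf_bits hp, foldl_nextMode_bits hp]
  cases p <;> simp_all [cellsOf, symbolCell]

theorem exists_eq_symbol_of_mem_cellsOf {p : Mode} (hp : p ≠ .vars) {s : List Symbol} {b : Cell}
    (hb : b ∈ cellsOf p s) : ∃ p' x, b = .symbol p' x := by
  induction s generalizing p with
  | nil => simp [cellsOf] at hb
  | cons x s ih =>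
    rcases List.mem_cons.1 hb with rfl | hb
    · cases p <;> simp_all [symbolCell]
    · exact ih (by cases p <;> cases x <;> simp_all [nextMode]) hb

/-! ### Membership: reading the input -/

theorem load_cells (p : Mode) (s : List Symbol) (J : List Instr) (r : List Cell) :
    (machine.load p s J r).2 = (cellsOf p s).reverse ++ r := by
  induction s generalizing p J r with
  | nil => rfl
  | cons x s ih =>
    rw [Sweeper.load, ih]
    simp [machine, cellsOf]

theorem load_instrs_of_ne_vars {p : Mode} (hp : p ≠ .vars) (s : List Symbol) (J : List Instr)
    (r : List Cell) : (machine.load p s J r).1 = writeInstrs valleyWritings ++ J := by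
  induction s generalizing p J r with
  | nil => rfl
  | cons x s ih =>
    rw [Sweeper.load, ih (by cases p <;> cases x <;> simp_all [machine, nextMode])]
    cases p <;> simp_all [machine, symbolInstrs]

/-- The instructions that move the cursor and write a midpoint equation, `k` times. -/
def midpointInstrs (k : ℕ) : List Instr :=
  (List.replicate k (.advance :: writeInstrs midpointWritings)).flatten

theorem load_instrs_encVars (n : ℕ) (s : List Symbol) (J : List Instr) (r : List Cell) :
    (machine.load .vars (encVars n ++ s) J r).1 =
      writeInstrs valleyWritings ++ (midpointInstrs n ++ J) := by
  induction n generalizing J r with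
  | zero =>
    refine (load_instrs_of_ne_vars (p := .body) (by simp) s _ _).trans ?_
    rfl
  | succ n ih =>
    refine (ih _ _).trans ?_
    simp [midpointInstrs, machine, symbolInstrs, List.replicate_succ']

theorem cellsOf_encVars (n : ℕ) :
    cellsOf .vars (encVars n) = List.replicate n (.var .ahead) ++ [.symbol .vars .semi] := by
  induction n with
  | zero => rfl
  | succ n ih => exact congrArg (_ :: ·) ih

theorem foldl_nextMode_encVars (n : ℕ) : (encVars n).foldl nextMode .vars = .body := by
  induction n with
  | zero => rfl
  | succ _ ih => exact ih

/-- The mark of the variable `j` when the cursor is at the variable `i`. -/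
def mark (i j : ℕ) : Mark := if j < i then .ahead else if j = i then .current else .passed

/-- The cells of `d` variables when the cursor is at the variable `i`. -/
def varCells (d i : ℕ) : List Cell := (List.range d).map fun j => .var (mark i j)

/-- The cells that follow those of the variables. -/
def bodyCells : List Cell :=
  .symbol .vars .semi :: cellsOf .body (encPoly I.f ++ encPosRat I.θ)

/-- The row, from left to right, when the cursor is at the variable `i`. -/
def rowCells (i : ℕ) : List Cell := varCells I.d i ++ bodyCells I

theorem loaded_encode :
    machine.loaded I.encode =
      (writeInstrs valleyWritings ++
        (midpointInstrs I.d ++ writeInstrs (.declare :: text [.var, .semi])),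
        (rowCells I I.d).reverse) := by
  have varCells_self : varCells I.d I.d = List.replicate I.d (.var .ahead) := by
    refine List.eq_replicate_iff.2 ⟨by simp [varCells], fun b hb => ?_⟩
    obtain ⟨j, hj, rfl⟩ := List.mem_map.1 hb
    simp [mark, List.mem_range.1 hj]
  refine Prod.ext (load_instrs_encVars ..) ((load_cells .vars ..).trans ?_)
  rw [VSCInstance.encode, cellsOf_append, cellsOf_encVars, foldl_nextMode_encVars,
    List.append_nil, rowCells, bodyCells, varCells_self]
  simp

/-! ### Membership: moving the cursor -/

theorem symbol_of_mem_bodyCells {b : Cell} (hb : b ∈ bodyCells I) : ∃ p x, b = .symbol p x := by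
  rcases List.mem_cons.1 hb with rfl | hb
  · exact ⟨_, _, rfl⟩
  · exact exists_eq_symbol_of_mem_cellsOf (by simp) hb

theorem rewriteRow_varCells (d i : ℕ) :
    machine.rewriteRow (.advance (decide (d ≤ i))) (varCells d (i + 1)).reverse =
      (varCells d i).reverse := by
  induction d with
  | zero => rfl
  | succ d ih =>
    have step : sweep (.advance (decide (d + 1 ≤ i))) (.var (mark (i + 1) d)) =
        (.advance (decide (d ≤ i)), .var (mark i d), []) := by
      rcases lt_trichotomy d i with h | rfl | h
      · simp [mark, h, h.le, Nat.lt_succ_of_lt h, Nat.succ_le_of_lt h, sweep]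
      · simp [mark, sweep]
      · obtain rfl | h' := (Nat.succ_le_of_lt h).eq_or_lt
        · simp [mark, sweep]
        · simp [mark, sweep, h.not_ge, h.not_gt, h.ne', h'.not_gt, h'.ne']
    simp only [varCells, List.range_succ, List.map_append, List.map_singleton,
      List.reverse_append, List.reverse_singleton, List.singleton_append] at ih ⊢
    rw [Sweeper.rewriteRow]
    simp only [machine] at ih ⊢
    rw [step, ih]

theorem rewriteRow_advance_append {found : Bool} {l : List Cell}
    (hl : ∀ b ∈ l, ∃ p x, b = .symbol p x) (r : List Cell) :
    machine.rewriteRow (.advance found) (l ++ r) = l ++ machine.rewriteRow (.advance found) r := by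
  induction l with
  | nil => rfl
  | cons b l ih =>
    obtain ⟨⟨p, x, rfl⟩, hl'⟩ := List.forall_mem_cons.1 hl
    rw [List.cons_append, Sweeper.rewriteRow]
    cases found <;> exact congrArg (_ :: ·) (ih hl')

theorem rewriteRow_advance {i : ℕ} (hi : i < I.d) :
    machine.rewriteRow (.advance false) (rowCells I (i + 1)).reverse = (rowCells I i).reverse := by
  have h := rewriteRow_varCells I.d i
  rw [decide_eq_false hi.not_ge] at h
  rw [rowCells, rowCells, List.reverse_append, List.reverse_append, ← h]
  exact rewriteRow_advance_append (fun b hb => symbol_of_mem_bodyCells I (List.mem_reverse.1 hb)) _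

theorem emit_advance (found : Bool) (r : List Cell) : machine.emit (.advance found) r = [] := by
  induction r generalizing found with
  | nil => rfl
  | cons b r ih =>
    have output_eq_nil : (sweep (.advance found) b).2.2 = [] := by
      rcases found with _ | _ <;> rcases b with ⟨_ | _ | _⟩ | _ <;> rfl
    obtain ⟨found', hfound⟩ : ∃ found', (sweep (.advance found) b).1 = .advance found' := by
      rcases found with _ | _ <;> rcases b with ⟨_ | _ | _⟩ | _ <;> exact ⟨_, rfl⟩
    rw [Sweeper.emit]
    simp only [machine] at ih ⊢
    rw [hfound, ih, output_eq_nil, List.append_nil]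

theorem exec_midpointInstrs {k : ℕ} (hk : k ≤ I.d) (J : List Instr) (out : List Symbol) :
    machine.exec (midpointInstrs k ++ J) (rowCells I k).reverse out =
      machine.exec J (rowCells I 0).reverse
        ((List.range k).flatMap (fun i => written midpointWritings (rowCells I i)) ++ out) := by
  induction k generalizing out with
  | zero => rfl
  | succ k ih =>
    have midpointInstrs_succ : midpointInstrs (k + 1) ++ J =
        .advance :: (writeInstrs midpointWritings ++ (midpointInstrs k ++ J)) := by
      simp [midpointInstrs, List.replicate_succ]
    rw [midpointInstrs_succ, Sweeper.exec]
    change machine.exec _ (machine.rewriteRow (.advance false) _)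
      (machine.emit (.advance false) _ ++ _) = _
    rw [rewriteRow_advance I hk, emit_advance, exec_writeInstrs, ih (Nat.le_of_succ_le hk)]
    simp [List.range_succ]

/-! ### Membership: the output of a sweep -/

namespace Writing

theorem outputs_map_of_fixed {α : Type*} {c : Place} {g : α → Cell}
    (h : ∀ a, nextPlace c (g a) = c) (w : Writing) (l : List α) :
    lastPlace c (l.map g) = c ∧ w.outputs c (l.map g) = l.flatMap fun a => w.output c (g a) := by
  induction l with
  | nil => exact ⟨rfl, rfl⟩
  | cons a l ih =>
    rw [List.map_cons, outputs, List.flatMap_cons, ih.1, ih.2]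
    exact ⟨(congrArg (nextPlace · (g a)) ih.1).trans (h a), rfl⟩

theorem outputs_varCells (w : Writing) (c : Place) (d i : ℕ) :
    w.outputs c (varCells d i) = (List.range d).flatMap fun j => w.output c (.var (mark i j)) :=
  (outputs_map_of_fixed (fun _ => by cases c <;> rfl) w _).2

theorem lastPlace_cellsOf_encNat (c : Place) (e : ℕ) :
    lastPlace c (cellsOf .body (encNat e)) = nextPlace c (.symbol .body .semi) := by
  rw [cellsOf_encNat (by simp), lastPlace_append]
  exact (outputs_map_of_fixed (fun _ => by cases c <;> rfl) .zeros _).1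

theorem outputs_cellsOf_encNat (w : Writing) (c : Place) (e : ℕ) :
    w.outputs c (cellsOf .body (encNat e)) =
      e.bits.flatMap (fun b =>
        w.output (nextPlace c (.symbol .body .semi)) (.symbol .body (.bit b))) ++
          w.output c (.symbol .body .semi) := by
  rw [cellsOf_encNat (by simp), outputs_append]
  congr 1
  · exact (outputs_map_of_fixed (fun _ => by cases c <;> rfl) w _).2
  · simp [outputs, lastPlace]

theorem outputs_rowCells_eq_varCells {w : Writing}
    (hw : ∀ c p x, w.output c (.symbol p x) = []) (i : ℕ) :
    w.outputs .start (rowCells I i) =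
      (List.range I.d).flatMap fun j => w.output (lastPlace .start (bodyCells I))
        (.var (mark i j)) := by
  have outputs_bodyCells : w.outputs .start (bodyCells I) = [] := by
    refine (outputs_eq_nil (p := fun _ => True) (fun b hb c _ => ⟨trivial, ?_⟩) trivial).2
    obtain ⟨p, x, rfl⟩ := symbol_of_mem_bodyCells I hb
    exact hw c p x
  rw [rowCells, outputs_append, outputs_varCells, outputs_bodyCells, List.append_nil]

theorem outputs_declare (i : ℕ) :
    declare.outputs .start (rowCells I i) = List.replicate (I.d * 3) .var := by
  rw [outputs_rowCells_eq_varCells I (by intros; rfl)]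
  simp only [output, List.flatMap_def, List.map_const', List.length_range,
    List.flatten_replicate_replicate]

theorem outputs_zeros (i : ℕ) :
    zeros.outputs .start (rowCells I i) = List.replicate (I.d * 3) .semi := by
  rw [outputs_rowCells_eq_varCells I (by intros; rfl)]
  simp only [output, List.flatMap_def, List.map_const', List.length_range,
    List.flatten_replicate_replicate]

theorem outputs_unit (κ : Fin 3) (i : Fin I.d) :
    (unit κ).outputs .start (rowCells I i) =
      (List.ofFn (Pi.single i 1)).flatMap (exponentBlock κ) := by
  have output_var (c : Place) (j : Fin I.d) :
      (unit κ).output c (.var (mark i j)) =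
        exponentBlock κ ((Pi.single i 1 : Fin I.d → ℕ) j) := by
    rcases lt_trichotomy j i with h | rfl | h
    · simp [mark, output, h, h.ne]
    · simp [mark, output]
    · simp [mark, output, h.ne', h.not_gt, Fin.val_inj]
  rw [outputs_rowCells_eq_varCells I (by intros; rfl), ← List.map_coe_finRange_eq_range,
    List.flatMap_map, List.ofFn_eq_map, List.flatMap_map]
  simp only [output_var]

theorem cellsOf_encPosRat (θ : ℚ) :
    cellsOf .body (encPosRat θ) =
      cellsOf .body (encNat θ.num.natAbs) ++ cellsOf .body (encNat θ.den) := by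
  rw [encPosRat, cellsOf_append, foldl_nextMode_encNat (by simp)]

theorem bodyCells_eq : bodyCells I = .symbol .vars .semi ::
    (cellsOf .body (I.f.flatMap encTerm) ++
      (.symbol .body .semi :: cellsOf .body (encPosRat I.θ))) := by
  rw [bodyCells, encPoly, List.append_assoc, cellsOf_append,
    foldl_nextMode_flatMap foldl_nextMode_encTerm]
  rfl

theorem flatMap_nil {α β : Type*} (l : List α) : (l.flatMap fun _ => ([] : List β)) = [] :=
  List.flatMap_eq_nil_iff.2 fun _ _ => rfl

theorem outputs_rowCells_eq_bodyCells {w : Writing} (hw : ∀ c m, w.output c (.var m) = [])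
    (hw' : ∀ c, w.output c (.symbol .vars .semi) = [])
    (hsemi : w.output .numerator (.symbol .body .semi) = []) (i : ℕ) :
    w.outputs .start (rowCells I i) =
      w.outputs .terms (cellsOf .body (I.f.flatMap encTerm)) ++
        w.outputs .start (cellsOf .body (encPosRat I.θ)) := by
  have lastPlace_encPosRat : lastPlace .start (cellsOf .body (encPosRat I.θ)) = .numerator := by
    rw [cellsOf_encPosRat, lastPlace_append, lastPlace_cellsOf_encNat, lastPlace_cellsOf_encNat]
    rfl
  rw [rowCells, outputs_append, outputs_varCells, bodyCells_eq]
  have lastPlace_semi :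
      lastPlace .start (.symbol .body .semi :: cellsOf .body (encPosRat I.θ)) = .terms :=
    congrArg (nextPlace · _) lastPlace_encPosRat
  simp only [hw, hw', outputs, outputs_append, lastPlace_encPosRat, lastPlace_semi, hsemi,
    flatMap_nil, List.nil_append]

theorem outputs_terms_eq_nil {w : Writing}
    (hw : ∀ p x, w.output .terms (.symbol p x) = [] ∧ w.output .exponents (.symbol p x) = [])
    (s : List Symbol) : w.outputs .terms (cellsOf .body s) = [] := by
  refine (outputs_eq_nil (p := fun c => c = .terms ∨ c = .exponents) (fun b hb c hc => ?_)
    (.inl rfl)).2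
  obtain ⟨p, x, rfl⟩ := exists_eq_symbol_of_mem_cellsOf (by simp) hb
  rcases hc with rfl | rfl
  · exact ⟨by cases p <;> cases x <;> simp [nextPlace], (hw p x).1⟩
  · exact ⟨by cases p <;> cases x <;> simp [nextPlace], (hw p x).2⟩

theorem outputs_denominator (i : ℕ) :
    denominator.outputs .start (rowCells I i) = encNat I.θ.den := by
  rw [outputs_rowCells_eq_bodyCells I (fun c _ => by cases c <;> rfl)
    (fun c => by cases c <;> rfl) rfl, outputs_terms_eq_nil (by simp [output]),
    cellsOf_encPosRat, outputs_append, lastPlace_cellsOf_encNat, outputs_cellsOf_encNat,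
    outputs_cellsOf_encNat]
  simp [nextPlace, output, encNat, List.map_eq_flatMap, flatMap_nil]

theorem outputs_numerator (i : ℕ) :
    numerator.outputs .start (rowCells I i) = encNat I.θ.num.natAbs := by
  rw [outputs_rowCells_eq_bodyCells I (fun c _ => by cases c <;> rfl)
    (fun c => by cases c <;> rfl) rfl, outputs_terms_eq_nil (by simp [output]),
    cellsOf_encPosRat, outputs_append, lastPlace_cellsOf_encNat, outputs_cellsOf_encNat,
    outputs_cellsOf_encNat]
  simp [nextPlace, output, encNat, List.map_eq_flatMap, flatMap_nil]

theorem outputs_exponents (κ : Fin 3) {c : Place} (hc : c = .terms ∨ c = .exponents)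
    (es : List ℕ) :
    let l := cellsOf .body (es.flatMap encNat)
    (lastPlace c l = .terms ∨ lastPlace c l = .exponents) ∧
      padding κ (lastPlace c l) ++ (copy κ).outputs c l =
        es.flatMap (exponentBlock κ) ++ padding κ c := by
  induction es with
  | nil => exact ⟨hc, List.append_nil _⟩
  | cons e es ih =>
    have cells_cons : cellsOf .body ((e :: es).flatMap encNat) =
        cellsOf .body (encNat e) ++ cellsOf .body (es.flatMap encNat) := by
      rw [List.flatMap_cons, cellsOf_append, foldl_nextMode_encNat (by simp)]
    obtain ⟨hplace, houtputs⟩ := ih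
    simp only [cells_cons, lastPlace_append, outputs_append, lastPlace_cellsOf_encNat,
      outputs_cellsOf_encNat]
    rw [List.flatMap_cons, List.append_assoc (exponentBlock κ e), ← houtputs]
    rcases hplace with h | h <;>
      simp [h, nextPlace, output, padding, exponentBlock, encNat, List.map_eq_flatMap,
        -List.replicate_append_replicate]

theorem outputs_encTerm {d : ℕ} (κ : Fin 3) (t : ℤ × (Fin d → ℕ)) :
    lastPlace .terms (cellsOf .body (encTerm t)) = .terms ∧
      (copy κ).outputs .terms (cellsOf .body (encTerm t)) = encTerm (copyTerm κ t) := by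
  obtain ⟨-, houtputs⟩ := outputs_exponents κ (.inl rfl) (List.ofFn t.2)
  have padding_terms : padding κ .terms = [] := rfl
  rw [padding_terms, List.append_nil] at houtputs
  obtain ⟨place_bits, outputs_bits⟩ := outputs_map_of_fixed (c := .terms)
    (g := fun b => .symbol .coef (.bit b)) (fun _ => rfl) (copy κ) t.1.natAbs.bits
  have place_semi (c : Place) : lastPlace c [.symbol .coef .semi] = .terms := rfl
  have place_coefficient (l : List Cell) : lastPlace .terms
      (t.1.natAbs.bits.map (fun b => .symbol .coef (.bit b)) ++ [.symbol .coef .semi] ++ l) =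
        .terms := by
    rw [lastPlace_append, lastPlace_append, place_semi, place_bits]
  have place_sign (b : Bool) : nextPlace .terms
      (symbolCell .body (if b then Symbol.minus else Symbol.plus)) = .terms := by
    cases b <;> rfl
  have output_sign (b : Bool) : (copy κ).output .terms
      (symbolCell .body (if b then Symbol.minus else Symbol.plus)) =
        [if b then Symbol.minus else Symbol.plus] := by
    cases b <;> rfl
  have output_semi (c : Place) : (copy κ).outputs c [.symbol .coef .semi] =
      .semi :: (encNat 0 ++ padding κ c) := by
    cases c <;> simp [outputs, output, lastPlace]
  rw [encTerm_eq_cons, cellsOf, nextMode_sign, cellsOf_append, cellsOf_encNat (by simp),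
    foldl_nextMode_encNat (by simp), encTerm_copyTerm, ← houtputs]
  refine ⟨(congrArg (nextPlace · _) (place_coefficient _)).trans (place_sign _), ?_⟩
  rw [outputs, place_coefficient, output_sign, outputs_append, outputs_append, place_semi,
    output_semi, outputs_bits]
  simp only [encInt, encNat, output, List.map_eq_flatMap]
  simp

theorem outputs_copy (κ : Fin 3) (i : ℕ) :
    (copy κ).outputs .start (rowCells I i) = (I.f.map (copyTerm κ)).flatMap encTerm := by
  have outputs_terms (P : SumOfMonomials I.d) :
      lastPlace .terms (cellsOf .body (P.flatMap encTerm)) = .terms ∧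
        (copy κ).outputs .terms (cellsOf .body (P.flatMap encTerm)) =
          (P.map (copyTerm κ)).flatMap encTerm := by
    induction P with
    | nil => exact ⟨rfl, rfl⟩
    | cons t P ih =>
      obtain ⟨place_encTerm, outputs_encTerm⟩ := outputs_encTerm κ t
      rw [List.flatMap_cons, cellsOf_append, foldl_nextMode_encTerm, outputs_append, ih.1,
        ih.2, outputs_encTerm, lastPlace_append, ih.1]
      exact ⟨place_encTerm, rfl⟩
  have outputs_encPosRat : (copy κ).outputs .start (cellsOf .body (encPosRat I.θ)) = [] := by
    rw [cellsOf_encPosRat, outputs_append, lastPlace_cellsOf_encNat, outputs_cellsOf_encNat,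
      outputs_cellsOf_encNat]
    simp [nextPlace, output, flatMap_nil]
  rw [outputs_rowCells_eq_bodyCells I (fun c _ => by cases c <;> rfl)
    (fun c => by cases c <;> rfl) rfl, (outputs_terms I.f).2, outputs_encPosRat, List.append_nil]

end Writing

/-! ### Membership: correctness of the machine -/

theorem written_append (ws ws' : List Writing) (l : List Cell) :
    written (ws ++ ws') l = written ws l ++ written ws' l := List.flatMap_append

theorem written_cons (w : Writing) (ws : List Writing) (l : List Cell) :
    written (w :: ws) l = w.leave ++ w.outputs .start l ++ written ws l := List.flatMap_cons

theorem written_nil (l : List Cell) : written [] l = [] := rfl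

theorem written_text (s : List Symbol) (l : List Cell) : written (text s) l = s := by
  have outputs_symbol (x : Symbol) : (Writing.symbol x).outputs .start l = [] :=
    (Writing.outputs_eq_nil (p := fun _ => True) (fun _ _ _ _ => ⟨trivial, rfl⟩) trivial).2
  simp [written, text, List.flatMap_map, outputs_symbol, Writing.leave]

theorem written_thresholdWritings (c : ℤ) (i : ℕ) :
    written (thresholdWritings c) (rowCells I i) = encTerm (thresholdTerm I.d c) := by
  rw [thresholdWritings, written_append, written_text, written_cons, Writing.outputs_zeros,
    encTerm_thresholdTerm]
  simp [written_nil, Writing.leave]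

theorem written_copyWritings (κ : Fin 3) (i : ℕ) :
    written (copyWritings κ) (rowCells I i) =
      encPoly (I.f.map (copyTerm κ) ++ [thresholdTerm I.d (-1)]) := by
  rw [copyWritings, written_cons, written_append, written_thresholdWritings, written_text,
    Writing.outputs_copy, encPoly]
  simp [Writing.leave]

theorem written_midpointTermWritings (κ : Fin 3) (i : Fin I.d) :
    written (midpointTermWritings κ) (rowCells I i) = encTerm (midpointTerm i κ) := by
  rw [midpointTermWritings, written_append, written_text, written_cons, Writing.outputs_unit,
    midpointTerm, encTerm_copyTerm]
  simp [written_nil, Writing.leave]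

theorem written_midpointWritings (i : Fin I.d) :
    written midpointWritings (rowCells I i) = .and :: encFormula (.atom .eq (midpointPoly i)) := by
  simp [midpointWritings, written_append, written_text, written_midpointTermWritings, encFormula,
    encPoly, midpointPoly, Comparison.symbol]

theorem encPoly_thresholdPoly :
    encPoly (thresholdPoly I) =
      .plus :: (encNat I.θ.den ++ (encNat 1 ++ (List.replicate (I.d * 3) .semi ++
        .minus :: (encNat I.θ.num.natAbs ++
          (encNat 0 ++ (List.replicate (I.d * 3) .semi ++ [.semi])))))) := by
  have encInt_den : encInt I.θ.den = .plus :: encNat I.θ.den := by simp [encInt]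
  have encInt_neg_num : encInt (-I.θ.num.natAbs) = .minus :: encNat I.θ.num.natAbs := by
    simp [encInt, I.θ_pos.ne', Int.natAbs_abs]
  have ofFn_zero : List.ofFn (0 : Fin I.d → ℕ) = List.replicate I.d 0 := List.ofFn_const ..
  rw [encPoly, thresholdPoly, List.flatMap_append, List.flatMap_singleton,
    List.flatMap_singleton, encTerm_thresholdTerm, encTerm_copyTerm, encInt_den, encInt_neg_num,
    ofFn_zero, List.flatMap_replicate, exponentBlock_zero, List.flatten_replicate_replicate]
  simp only [List.append_assoc, List.cons_append]

theorem written_valleyWritings (i : ℕ) :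
    written valleyWritings (rowCells I i) = encFormula (valley I) := by
  simp [valleyWritings, written_append, written_text, written_copyWritings, written_cons,
    Writing.leave, Writing.outputs_denominator, Writing.outputs_numerator,
    Writing.outputs_zeros, valley, encFormula, encPoly_thresholdPoly, aboveThreshold,
    Comparison.symbol]

theorem run_machine : machine.run I.encode = (toETR I).encode := by
  have range_eq : (List.range I.d).flatMap (fun i => written midpointWritings (rowCells I i)) =
      (List.finRange I.d).flatMap fun i =>
        .and :: encFormula (.atom .eq (midpointPoly i)) := by
    rw [← List.map_coe_finRange_eq_range, List.flatMap_map]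
    simp only [written_midpointWritings]
  have written_declare : written (.declare :: text [.var, .semi]) (rowCells I 0) =
      encVars (I.d * 3 + 1) := by
    rw [written_cons, Writing.outputs_declare, written_text, encVars, List.replicate_succ']
    simp [Writing.leave]
  rw [Sweeper.run, loaded_encode, exec_writeInstrs, exec_midpointInstrs I le_rfl,
    ← List.append_nil (writeInstrs (.declare :: _)), exec_writeInstrs, written_valleyWritings,
    written_declare, range_eq, List.append_nil, ← encFormula_withMidpoint]
  rfl

theorem polyTime_toETR :
    Nonempty (TM2ComputableInPolyTime VSCInstance.encode Sentence.encode toETR) :=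
  machine.polyTime run_machine

end Membership

end ExistsReals

theorem mainTheorem2 : ExistsReals.ExistsRComplete ExistsReals.VSC := by
  have membership : ExistsReals.PolyTimeReducible ExistsReals.VSC ExistsReals.ETR :=
    ⟨_, ExistsReals.Membership.polyTime_toETR, ExistsReals.Membership.toETR_correct⟩
  have hardness : ExistsReals.PolyTimeReducible ExistsReals.ETR ExistsReals.VSC :=
    ⟨_, ExistsReals.Hardness.polyTime_toVSC, ExistsReals.Hardness.toVSC_correct⟩
  exact ⟨membership, fun _ hP => hP.trans hardness⟩
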